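/- Let $X$ be a non-empty compact complex manifold of dimension $n$, let $L\to X$ be a holomorphic line bundle, and let $E\subset H^0(X;L)$ be a subspace of finite dimension $d$ which gives a projective embedding of $X$ (that is, $E$ has no base points, and the map $X\to\mathbf P(E^*)$, $x\mapsto\{s\in E: s(x)=0\}$, is injective with injective derivative at each point). For a smooth Hermitian metric $h$ on $L$ let $-i\omega_h$ be the curvature of the unitary connection defined by $h$, so that $\omega_{e^\phi h}=\omega_h+i\overline\partial\partial\phi$. Let $\mathcal K$ be the set of those $h$ for which the $(1,1)$-form $\omega_h$ is positive, write $d\mu_h=\omega_h^n/n!$, and let $V=\int_X d\mu_h$, which is the same for all $h\in\mathcal K$. For $h\in\mathcal K$ let $\mathrm{Hilb}(h)$ be the Hermitian metric on $E$ given by $\Vert s\Vert^2_{\mathrm{Hilb}(h)}=\frac dV\int_X|s|_h^2\,d\mu_h$. For a Hermitian metric $H$ on $E$ let $FS(H)$ be the metric on $L$ with $\sum_\alpha|s_\alpha|^2_{FS(H)}=1$ on $X$ for every $H$-orthonormal basis $(s_\alpha)$ of $E$. A metric $h\in\mathcal K$ is called balanced if there is a Hermitian metric $H$ on $E$ with $\mathrm{Hilb}(h)=H$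 and $FS(H)=h$. Fix a basis $(b_1,\dots,b_d)$ of $E$, let $\det H$ be the determinant of the matrix of $H$ in this basis (it depends only on $\Theta=b_1\wedge\dots\wedge b_d$), and put $\mathcal L(h)=\log\det\mathrm{Hilb}(h)$. Say that a functional $I:\mathcal K\to\mathbf R$ has property (*) if $\frac{d}{dt}I(h_t)=\int_X\dot\phi_t\,d\mu_{h_t}$ for each smooth path $h_t=e^{\phi_t}h_0$ in $\mathcal K$. (i) For each $h_0\in\mathcal K$ the functional $I(e^\phi h_0)=\int_0^1\int_X\phi\,d\mu_{e^{t\phi}h_0}\,dt$ has property (*). (ii) Let $I$ be any functional with property (*) (property (*) determines $I$ up to an additive constant), and put $\tilde{\mathcal L}=\mathcal L-\frac dV I$. Then a metric $h^*\in\mathcal K$ is balanced if and only if it is a critical point of $\tilde{\mathcal L}$ on $\mathcal K$, that is, $\frac{d}{dt}\big|_{t=0}\tilde{\mathcal L}(e^{t\psi}h^*)=0$ for every $\psi\in C^\infty(X)$. -/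

import Mathlib

open Set Filter Topology MeasureTheory Bundle
open scoped Manifold ContDiff ComplexConjugate ComplexOrder

noncomputable section

namespace Balanced

/-! ### Hermitian inner products on a complex vector space -/

section Linear

variable {V : Type*} [AddCommGroup V] [Module ℂ V]

/-- The inner product `c • H`, for a positive real number `c`. -/
@[reducible] def scaleCore (c : ℝ) (hc : 0 < c) (H : InnerProductSpace.Core ℂ V) :
    InnerProductSpace.Core ℂ V where
  inner v w := (c : ℂ) * H.inner v w
  conj_inner_symm v w := by
    rw [map_mul, Complex.conj_ofReal, H.conj_inner_symm]
  re_inner_nonneg v := by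
    have h := H.re_inner_nonneg v
    simp only [RCLike.re_eq_complex_re, Complex.re_ofReal_mul] at h ⊢
    exact mul_nonneg hc.le h
  add_left u v w := by rw [H.add_left, mul_add]
  smul_left v w r := by rw [H.smul_left]; ring
  definite v hv := by
    refine H.definite v ?_
    rcases mul_eq_zero.1 hv with h | h
    · exact absurd (Complex.ofReal_eq_zero.1 h) hc.ne'
    · exact h

/-- The inner product `⟨v, w⟩ = conj (ℓ v) * ℓ w` on a complex line, for an isomorphism `ℓ`
of the line with `ℂ`. -/
@[reducible] def lineCore (l : V ≃ₗ[ℂ] ℂ) : InnerProductSpace.Core ℂ V where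
  inner v w := conj (l v) * l w
  conj_inner_symm v w := by rw [map_mul, Complex.conj_conj, mul_comm]
  re_inner_nonneg v := by
    rw [mul_comm, Complex.mul_conj]
    simpa using Complex.normSq_nonneg (l v)
  add_left u v w := by rw [map_add, map_add, add_mul]
  smul_left v w r := by rw [map_smul, smul_eq_mul, map_mul]; ring
  definite v hv := by
    have : l v = 0 := by
      rcases mul_eq_zero.1 hv with h | h
      · simpa using h
      · exact h
    simpa using this

/-- `s` is orthonormal for the inner product `H`. -/
def IsOrthonormal (H : InnerProductSpace.Core ℂ V) {d : ℕ} (s : Fin d → V) : Prop :=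
  ∀ i j, H.inner (s i) (s j) = if i = j then 1 else 0

theorem exists_isOrthonormal [FiniteDimensional ℂ V] (H : InnerProductSpace.Core ℂ V) :
    ∃ s : Fin (Module.finrank ℂ V) → V, IsOrthonormal H s := by
  let _ : NormedAddCommGroup V := H.toNormedAddCommGroup
  let _ : InnerProductSpace ℂ V := InnerProductSpace.ofCore H.toCore
  refine ⟨stdOrthonormalBasis ℂ V, fun i j => ?_⟩
  exact orthonormal_iff_ite.1 (stdOrthonormalBasis ℂ V).orthonormal i j

/-- For a linear form `ℓ`, the sum `∑ |ℓ (s i)|²` is the same for all orthonormal bases, and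
vanishes only if `ℓ = 0`. -/
theorem exists_sum_sq_eq [FiniteDimensional ℂ V] (H : InnerProductSpace.Core ℂ V)
    (l : V →ₗ[ℂ] ℂ) : ∃ c : ℝ, (l ≠ 0 → 0 < c) ∧
      ∀ s : Fin (Module.finrank ℂ V) → V, IsOrthonormal H s → ∑ i, ‖l (s i)‖ ^ 2 = c := by
  let _ : NormedAddCommGroup V := H.toNormedAddCommGroup
  let _ : InnerProductSpace ℂ V := InnerProductSpace.ofCore H.toCore
  have : CompleteSpace V := FiniteDimensional.complete ℂ V
  set u : V := (InnerProductSpace.toDual ℂ V).symm (LinearMap.toContinuousLinearMap l) with hu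
  have hl : ∀ v, l v = inner ℂ u v := fun v => by
    rw [hu, InnerProductSpace.toDual_symm_apply]; rfl
  refine ⟨‖u‖ ^ 2, fun h => ?_, fun s hs => ?_⟩
  · have : u ≠ 0 := fun h0 => h (LinearMap.ext fun v => by rw [hl, h0, inner_zero_left]; rfl)
    positivity
  · have ho : Orthonormal ℂ s := orthonormal_iff_ite.2 hs
    have hspan : ⊤ ≤ Submodule.span ℂ (Set.range s) := by
      rw [ho.linearIndependent.span_eq_top_of_card_eq_finrank' (by simp)]
    have := (OrthonormalBasis.mk ho hspan).sum_sq_norm_inner_left u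
    simpa [hl] using this

end Linear

/-! ### Complex Hessians -/

/-- The matrix `∂²f / ∂z_j ∂z̄_k` of a real function on `ℂⁿ`, where
`∂/∂z_j = (∂/∂x_j - i ∂/∂y_j) / 2` and `∂/∂z̄_k = (∂/∂x_k + i ∂/∂y_k) / 2`. -/
def complexHessian {n : ℕ} (f : (Fin n → ℂ) → ℝ) (z : Fin n → ℂ) : Matrix (Fin n) (Fin n) ℂ :=
  fun j k =>
    let D : (Fin n → ℂ) → (Fin n → ℂ) → ℂ := fun u v => ((fderiv ℝ (fderiv ℝ f) z u v : ℝ) : ℂ)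
    let x : Fin n → (Fin n → ℂ) := fun i => Pi.single i 1
    let y : Fin n → (Fin n → ℂ) := fun i => Pi.single i Complex.I
    (1 / 4) * (D (x j) (x k) + D (y j) (y k) + Complex.I * (D (x j) (y k) - D (y j) (x k)))

/-! ### Manifolds and line bundles -/

section Bundle

variable {n : ℕ} {X : Type*} [TopologicalSpace X] [ChartedSpace (Fin n → ℂ) X]

/-- `C^∞(X)`: the smooth real functions on `X`, regarded as a real manifold of dimension `2n`. -/
abbrev SmoothFn (n : ℕ) (X : Type*) [TopologicalSpace X] [ChartedSpace (Fin n → ℂ) X] : Type _ :=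
  ContMDiffMap 𝓘(ℝ, Fin n → ℂ) 𝓘(ℝ, ℝ) X ℝ ∞

/-- A function that is holomorphic near a point is smooth there as a function on the underlying
real manifold. -/
theorem contMDiffAt_real {f : X → ℂ} {x : X}
    (hf : ContMDiffAt 𝓘(ℂ, Fin n → ℂ) 𝓘(ℂ, ℂ) ω f x) :
    ContMDiffAt 𝓘(ℝ, Fin n → ℂ) 𝓘(ℝ, ℂ) ∞ f x := by
  rw [contMDiffAt_iff] at hf ⊢
  exact ⟨hf.1, (hf.2.restrict_scalars ℝ).of_le le_top⟩

variable {L : X → Type*} [∀ x, AddCommGroup (L x)] [∀ x, Module ℂ (L x)]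
  [TopologicalSpace (TotalSpace ℂ L)] [∀ x, TopologicalSpace (L x)] [FiberBundle ℂ L]

/-- The coordinate of `v ∈ L_x` in the local trivialization of `L` chosen at `p`. -/
def coord (p : X) {x : X} (v : L x) : ℂ := (trivializationAt ℂ L p ⟨x, v⟩).2

/-- The local frame of `L` given by the local trivialization chosen at `p`: where the
trivialization is defined, `frame p x` is the element of `L_x` with coordinate `1`. -/
def frame (p x : X) : L x := (trivializationAt ℂ L p).symm x 1

variable [VectorBundle ℂ ℂ L]

theorem coord_eq {p x : X} (hx : x ∈ (trivializationAt ℂ L p).baseSet) (v : L x) :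
    (trivializationAt ℂ L p).linearEquivAt ℂ x hx v = coord p v := rfl

theorem coord_frame {p x : X} (hx : x ∈ (trivializationAt ℂ L p).baseSet) :
    coord p (frame (L := L) p x) = 1 := by
  rw [coord, frame, (trivializationAt ℂ L p).apply_mk_symm hx]

theorem coord_smul {p x : X} (hx : x ∈ (trivializationAt ℂ L p).baseSet) (c : ℂ) (v : L x) :
    coord p (c • v) = c * coord p v := by
  rw [← coord_eq hx, ← coord_eq hx, map_smul, smul_eq_mul]

theorem eq_coord_smul_frame {p x : X} (hx : x ∈ (trivializationAt ℂ L p).baseSet) (v : L x) :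
    v = coord p v • frame p x := by
  apply ((trivializationAt ℂ L p).linearEquivAt ℂ x hx).injective
  rw [coord_eq, coord_eq, coord_smul hx, coord_frame hx, mul_one]

theorem frame_ne_zero {p x : X} (hx : x ∈ (trivializationAt ℂ L p).baseSet) :
    frame (L := L) p x ≠ 0 := fun h => by
  have h1 := coord_frame (L := L) hx
  rw [h, ← coord_eq hx, map_zero] at h1
  exact zero_ne_one h1

/-! ### Hermitian metrics on `L` -/

/-- Smooth Hermitian metrics on the line bundle `L`: an inner product on each fibre, such that
the norm squared of each of the local frames is a smooth function. -/
@[ext]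
structure HermitianMetric (n : ℕ) {X : Type*} [TopologicalSpace X] [ChartedSpace (Fin n → ℂ) X]
    (L : X → Type*) [∀ x, AddCommGroup (L x)] [∀ x, Module ℂ (L x)]
    [TopologicalSpace (TotalSpace ℂ L)] [∀ x, TopologicalSpace (L x)] [FiberBundle ℂ L] where
  /-- the inner product on the fibre at `x` -/
  core : ∀ x, InnerProductSpace.Core ℂ (L x)
  smooth : ∀ p : X, ContMDiffOn 𝓘(ℝ, Fin n → ℂ) 𝓘(ℝ, ℝ) ∞
    (fun x => ((core x).inner (frame p x) (frame p x)).re) (trivializationAt ℂ L p).baseSet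

namespace HermitianMetric

/-- The pairing `(v, w)_h` on `L_x`, conjugate linear in `v`. -/
def pair (h : HermitianMetric n L) {x : X} (v w : L x) : ℂ := (h.core x).inner v w

/-- `|v|²_h`. -/
def normSq (h : HermitianMetric n L) {x : X} (v : L x) : ℝ := (h.pair v v).re

theorem normSq_smul (h : HermitianMetric n L) {x : X} (c : ℂ) (v : L x) :
    h.normSq (c • v) = ‖c‖ ^ 2 * h.normSq v := by
  have e : h.pair (c • v) (c • v) = ((‖c‖ ^ 2 : ℝ) : ℂ) * h.pair v v := by
    have h1 : h.pair v (c • v) = c * h.pair v v := by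
      rw [pair, ← (h.core x).conj_inner_symm, (h.core x).smul_left, map_mul,
        (h.core x).conj_inner_symm, Complex.conj_conj, pair]
    have h2 : h.pair (c • v) (c • v) = conj c * h.pair v (c • v) := (h.core x).smul_left _ _ _
    rw [h2, h1, ← mul_assoc, ← Complex.normSq_eq_conj_mul_self, Complex.normSq_eq_norm_sq]
  rw [normSq, e, Complex.re_ofReal_mul, normSq]

theorem normSq_pos (h : HermitianMetric n L) {x : X} {v : L x} (hv : v ≠ 0) :
    0 < h.normSq v := by
  have h0 : 0 ≤ h.normSq v := (h.core x).re_inner_nonneg v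
  refine lt_of_le_of_ne h0 fun h1 => hv ((h.core x).definite v ?_)
  apply Complex.ext
  · exact h1.symm
  · have := congrArg Complex.im ((h.core x).conj_inner_symm v v)
    rw [Complex.conj_im] at this
    simp only [Complex.zero_im]
    linarith

/-- The metric `e^φ h`. -/
def expMul (φ : SmoothFn n X) (h : HermitianMetric n L) : HermitianMetric n L where
  core x := scaleCore (Real.exp (φ x)) (Real.exp_pos _) (h.core x)
  smooth p := by
    have h1 : ContMDiffOn 𝓘(ℝ, Fin n → ℂ) 𝓘(ℝ, ℝ) ∞ (fun x => Real.exp (φ x))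
        (trivializationAt ℂ L p).baseSet :=
      (Real.contDiff_exp.contMDiff.comp φ.contMDiff).contMDiffOn
    refine (h1.mul (h.smooth p)).congr fun x _ => ?_
    exact Complex.re_ofReal_mul _ _

/-- The function `φ` with `h = e^φ h₀`. -/
def logRatio (h h₀ : HermitianMetric n L) : SmoothFn n X :=
  ⟨fun x => Real.log (h.normSq (frame (L := L) x x) / h₀.normSq (frame (L := L) x x)), by
    intro p
    have hp := FiberBundle.mem_baseSet_trivializationAt' (F := ℂ) (E := L) p
    have hU : (trivializationAt ℂ L p).baseSet ∈ 𝓝 p :=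
      (trivializationAt ℂ L p).open_baseSet.mem_nhds hp
    have hne : h₀.normSq (frame (L := L) p p) ≠ 0 := (h₀.normSq_pos (frame_ne_zero hp)).ne'
    have hne' : h.normSq (frame (L := L) p p) ≠ 0 := (h.normSq_pos (frame_ne_zero hp)).ne'
    have h1 := ((h.smooth p).contMDiffAt hU).div₀ ((h₀.smooth p).contMDiffAt hU) hne
    have h2 := ContMDiffAt.comp p
      ((Real.contDiffAt_log.2 (div_ne_zero hne' hne)).contMDiffAt (n := ∞)) h1
    refine h2.congr_of_eventuallyEq ?_
    filter_upwards [hU] with x hx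
    have hx' := FiberBundle.mem_baseSet_trivializationAt' (F := ℂ) (E := L) x
    have hc : coord p (frame (L := L) x x) ≠ 0 := fun h0 => by
      have := eq_coord_smul_frame hx (frame (L := L) x x)
      rw [h0, zero_smul] at this
      exact frame_ne_zero hx' this
    have hc2 : ‖coord p (frame (L := L) x x)‖ ^ 2 ≠ 0 := by positivity
    rw [eq_coord_smul_frame hx (frame (L := L) x x), normSq_smul, normSq_smul,
      mul_div_mul_left _ _ hc2]
    rfl⟩

/-! ### Curvature and volume -/

/-- The coefficients at `p` of `ω_h = i ∑ g_{jk} dz_j ∧ dz̄_k` in the holomorphic chart `c`.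
The unitary connection defined by `h` has curvature `∂̄∂ log |s|²_h = -i ω_h` for each
nonvanishing local holomorphic section `s`, so that `g_{jk} = -∂²(log |s|²_h) / ∂z_j ∂z̄_k`. -/
def kahlerMatrix (h : HermitianMetric n L) (c : OpenPartialHomeomorph X (Fin n → ℂ)) (p : X) :
    Matrix (Fin n) (Fin n) ℂ :=
  -complexHessian (fun z => Real.log (h.normSq (frame (L := L) p (c.symm z)))) (c p)

/-- `h ∈ 𝒦`: the form `ω_h` is positive. -/
def IsPositive (h : HermitianMetric n L) : Prop :=
  ∀ p : X, (h.kahlerMatrix (chartAt (Fin n → ℂ) p) p).PosDef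

variable [MeasurableSpace X]

/-- The measure `ω_hⁿ / n!` on the domain of the holomorphic chart `c`: as
`(i ∑ g_{jk} dz_j ∧ dz̄_k)ⁿ / n! = det g ∏ (i dz_j ∧ dz̄_j)` and `i dz ∧ dz̄ = 2 dx ∧ dy`, its
density in the chart with respect to Lebesgue measure is `2ⁿ det g`. -/
def localVolume (h : HermitianMetric n L) (c : OpenPartialHomeomorph X (Fin n → ℂ)) : Measure X :=
  Measure.map c.symm ((volume.restrict c.target).withDensity fun z =>
    ENNReal.ofReal (2 ^ n * (h.kahlerMatrix c (c.symm z)).det.re))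

/-- The measure `dμ_h = ω_hⁿ / n!` on `X`, for `h ∈ 𝒦`. On the domain of each chart it is the
measure `localVolume`; as these domains cover `X`, it is the supremum of these measures in the
lattice of measures on `X`. -/
def vol (h : HermitianMetric n L) : Measure X :=
  ⨆ p : X, h.localVolume (chartAt (Fin n → ℂ) p)

/-- The volume `V` of `X`. -/
def V (h : HermitianMetric n L) : ℝ := h.vol.real univ

/-! ### The functional `I` -/

/-- The characterization of the functional `I` on `𝒦` (only the values of `I` on `𝒦` matter):
for each smooth path `h_t = e^{φ_t} h₀`, `dI/dt = ∫ φ̇ dμ_{h_t}` whenever `h_t` is in `𝒦`. -/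
def IsEnergy (I : HermitianMetric n L → ℝ) : Prop :=
  ∀ (h₀ : HermitianMetric n L) (φ : ℝ → SmoothFn n X),
    ContMDiff (𝓘(ℝ, ℝ).prod 𝓘(ℝ, Fin n → ℂ)) 𝓘(ℝ, ℝ) ∞ (fun q : ℝ × X => φ q.1 q.2) →
    ∀ t : ℝ, (expMul (φ t) h₀).IsPositive →
      HasDerivAt (fun s => I (expMul (φ s) h₀))
        (∫ x, deriv (fun s => φ s x) t ∂(expMul (φ t) h₀).vol) t

/-- The functional `I(e^φ h₀) = ∫₀¹ ∫_X φ dμ_{e^{tφ} h₀} dt`, normalized by `I(h₀) = 0`. -/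
def energy (h₀ h : HermitianMetric n L) : ℝ :=
  ∫ t in (0 : ℝ)..1, ∫ x, logRatio h h₀ x ∂(expMul (t • logRatio h h₀) h₀).vol

/-- `h` is a critical point of `F`: the derivative of `F` at `h` vanishes in the direction of each
smooth function `ψ`. (For `h ∈ 𝒦`, the metrics `e^{tψ} h` are in `𝒦` for small `t`.) -/
def IsCriticalPoint (F : HermitianMetric n L → ℝ) (h : HermitianMetric n L) : Prop :=
  ∀ ψ : SmoothFn n X, HasDerivAt (fun t : ℝ => F (expMul (t • ψ) h)) 0 0

end HermitianMetric

/-! ### Holomorphic sections, `Hilb` and `FS` -/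

/-- `H⁰(X, L)`: the holomorphic sections of `L`. -/
abbrev HoloSection (n : ℕ) {X : Type*} [TopologicalSpace X] [ChartedSpace (Fin n → ℂ) X]
    (L : X → Type*) [∀ x, AddCommGroup (L x)] [∀ x, Module ℂ (L x)]
    [TopologicalSpace (TotalSpace ℂ L)] [∀ x, TopologicalSpace (L x)] [FiberBundle ℂ L] :
    Type _ :=
  ContMDiffSection 𝓘(ℂ, Fin n → ℂ) ℂ ω L

/-- `E ⊆ H⁰(X, L)` gives a projective embedding of `X`: the map which sends `x` to the subspace
`{s ∈ E | s(x) = 0}` is defined as a map to the space of hyperplanes in `E`, that is to `P(E*)`,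
it is injective, and its derivative is injective at each point. -/
structure GivesEmbedding (E : Submodule ℂ (HoloSection n L)) : Prop where
  basePointFree : ∀ x : X, ∃ s ∈ E, s x ≠ 0
  injective : ∀ x y : X, x ≠ y → ∃ s ∈ E, s x = 0 ∧ s y ≠ 0
  immersive : ∀ (x : X) (v : TangentSpace 𝓘(ℂ, Fin n → ℂ) x), v ≠ 0 → ∃ s ∈ E, s x = 0 ∧
    mfderiv 𝓘(ℂ, Fin n → ℂ) 𝓘(ℂ, ℂ) (fun y => coord x (s y)) x v ≠ 0

variable {E : Submodule ℂ (HoloSection n L)}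

/-- The linear form `s ↦ coord p (s x)` on `E`. -/
def evalForm (E : Submodule ℂ (HoloSection n L)) {p x : X}
    (hx : x ∈ (trivializationAt ℂ L p).baseSet) : E →ₗ[ℂ] ℂ where
  toFun s := coord p (s.1 x)
  map_add' s t := by
    have : (s + t).1 x = s.1 x + t.1 x := rfl
    rw [this, ← coord_eq hx, map_add]; rfl
  map_smul' c s := by
    have : (c • s).1 x = c • s.1 x := rfl
    rw [this, coord_smul hx]; rfl

theorem evalForm_ne_zero (hE : GivesEmbedding E) {p x : X}
    (hx : x ∈ (trivializationAt ℂ L p).baseSet) : evalForm E hx ≠ 0 := fun h => by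
  obtain ⟨s, hs, h0⟩ := hE.basePointFree x
  refine h0 ?_
  have : coord p (s x) = 0 := LinearMap.congr_fun h ⟨s, hs⟩
  rw [eq_coord_smul_frame hx (s x), this, zero_smul]

variable [FiniteDimensional ℂ E]

/-- An orthonormal basis of `E` with respect to `H`. -/
def onb (H : InnerProductSpace.Core ℂ E) : Fin (Module.finrank ℂ E) → E :=
  Classical.choose (exists_isOrthonormal H)

/-- `∑ |s_α(x)|²` in the local trivialization at `p`, for an orthonormal basis `(s_α)`. -/
def fsSum (H : InnerProductSpace.Core ℂ E) (p x : X) : ℝ := ∑ i, ‖coord p ((onb H i).1 x)‖ ^ 2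

theorem fsSum_eq (H : InnerProductSpace.Core ℂ E) {p x : X}
    (hx : x ∈ (trivializationAt ℂ L p).baseSet) (s : Fin (Module.finrank ℂ E) → E)
    (hs : IsOrthonormal H s) : ∑ i, ‖coord p ((s i).1 x)‖ ^ 2 = fsSum H p x := by
  obtain ⟨c, -, h⟩ := exists_sum_sq_eq H (evalForm E hx)
  exact (h s hs).trans (h _ (Classical.choose_spec (exists_isOrthonormal H))).symm

theorem fsSum_pos (hE : GivesEmbedding E) (H : InnerProductSpace.Core ℂ E) {p x : X}
    (hx : x ∈ (trivializationAt ℂ L p).baseSet) : 0 < fsSum H p x := by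
  obtain ⟨c, h0, h⟩ := exists_sum_sq_eq H (evalForm E hx)
  have := h _ (Classical.choose_spec (exists_isOrthonormal H))
  exact lt_of_lt_of_eq (h0 (evalForm_ne_zero hE hx)) this.symm

/-- The metric `FS(H)` on `L`, for which `∑ |s_α|² = 1` if `(s_α)` is an orthonormal basis of `E`
with respect to `H`. -/
def FS [ContMDiffVectorBundle ω ℂ L 𝓘(ℂ, Fin n → ℂ)] (hE : GivesEmbedding E)
    (H : InnerProductSpace.Core ℂ E) : HermitianMetric n L where
  core x := scaleCore (fsSum H x x)⁻¹
    (inv_pos.2 (fsSum_pos hE H (FiberBundle.mem_baseSet_trivializationAt' x)))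
    (lineCore ((trivializationAt ℂ L x).linearEquivAt ℂ x
      (FiberBundle.mem_baseSet_trivializationAt' x)))
  smooth p := by
    have h1 : ∀ s : HoloSection n L, ContMDiffOn 𝓘(ℝ, Fin n → ℂ) 𝓘(ℝ, ℝ) ∞
        (fun x => ‖coord p (s x)‖ ^ 2) (trivializationAt ℂ L p).baseSet := fun s x hx => by
      have a := ((trivializationAt ℂ L p).contMDiffAt_section_iff hx).1 (s.contMDiff x)
      have b := contMDiffAt_real a
      have c : ContDiff ℝ ∞ (fun z : ℂ => ‖z‖ ^ 2) := contDiff_norm_sq ℝ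
      exact (c.contMDiff.contMDiffAt.comp x b).contMDiffWithinAt
    have h2 : ContMDiffOn 𝓘(ℝ, Fin n → ℂ) 𝓘(ℝ, ℝ) ∞ (fun x => fsSum H p x)
        (trivializationAt ℂ L p).baseSet := contMDiffOn_finsetSum fun i _ => h1 _
    refine (h2.inv₀ fun x hx => (fsSum_pos hE H hx).ne').congr fun x hx => ?_
    have hx' := FiberBundle.mem_baseSet_trivializationAt' (F := ℂ) (E := L) x
    have h3 : fsSum H x x = ‖coord x (frame (L := L) p x)‖ ^ 2 * fsSum H p x := by
      rw [fsSum, fsSum, Finset.mul_sum]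
      refine Finset.sum_congr rfl fun i _ => ?_
      conv_lhs => rw [eq_coord_smul_frame hx ((onb H i).1 x), coord_smul hx', norm_mul, mul_pow]
      rw [mul_comm]
    have h4 : ‖coord x (frame (L := L) p x)‖ ^ 2 ≠ 0 := fun h0 => by
      rw [h0, zero_mul] at h3
      exact (fsSum_pos hE H hx').ne' h3
    change (((fsSum H x x)⁻¹ : ℝ) * (conj (coord x (frame (L := L) p x)) *
      coord x (frame (L := L) p x)) : ℂ).re = (fsSum H p x)⁻¹
    rw [← Complex.normSq_eq_conj_mul_self, Complex.normSq_eq_norm_sq, ← Complex.ofReal_mul,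
      Complex.ofReal_re, h3, mul_inv, mul_right_comm, inv_mul_cancel₀ h4, one_mul]

/-- The defining property of `FS(H)`. -/
theorem sum_normSq_FS [ContMDiffVectorBundle ω ℂ L 𝓘(ℂ, Fin n → ℂ)] (hE : GivesEmbedding E)
    (H : InnerProductSpace.Core ℂ E) (s : Fin (Module.finrank ℂ E) → E)
    (hs : IsOrthonormal H s) (x : X) : ∑ i, (FS hE H).normSq ((s i).1 x) = 1 := by
  have hx := FiberBundle.mem_baseSet_trivializationAt' (F := ℂ) (E := L) x
  have h1 : ∀ v : L x, (FS hE H).normSq v = (fsSum H x x)⁻¹ * ‖coord x v‖ ^ 2 := fun v => by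
    change (((fsSum H x x)⁻¹ : ℝ) * (conj (coord x v) * coord x v) : ℂ).re = _
    rw [← Complex.normSq_eq_conj_mul_self, Complex.normSq_eq_norm_sq, ← Complex.ofReal_mul,
      Complex.ofReal_re]
  simp_rw [h1]
  rw [← Finset.mul_sum, fsSum_eq H hx s hs, inv_mul_cancel₀ (fsSum_pos hE H hx).ne']

variable [MeasurableSpace X]

/-- The form `⟨s, t⟩ = (d / V) ∫ (s, t)_h dμ_h` of the metric `Hilb(h)` on `E`, `d = dim E`. -/
def Hilb (E : Submodule ℂ (HoloSection n L)) (h : HermitianMetric n L) (s t : E) : ℂ :=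
  ((Module.finrank ℂ E / h.V : ℝ) : ℂ) * ∫ x, h.pair (s.1 x) (t.1 x) ∂h.vol

/-- `h` is balanced: there is a metric `H` on `E` with `Hilb(h) = H` and `FS(H) = h`. -/
def IsBalanced [ContMDiffVectorBundle ω ℂ L 𝓘(ℂ, Fin n → ℂ)] (hE : GivesEmbedding E)
    (h : HermitianMetric n L) : Prop :=
  ∃ H : InnerProductSpace.Core ℂ E, (∀ s t, H.inner s t = Hilb E h s t) ∧ FS hE H = h

/-- `log det` of a Hermitian form on `E`, for the element `Θ = b₁ ∧ ⋯ ∧ b_d` of the top exterior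
power of `E`. -/
def logDet (b : Module.Basis (Fin (Module.finrank ℂ E)) ℂ E) (H : E → E → ℂ) : ℝ :=
  Real.log (Matrix.of fun i j => H (b i) (b j)).det.re

/-- The functional `𝓛 = log det ∘ Hilb`. -/
def calL (b : Module.Basis (Fin (Module.finrank ℂ E)) ℂ E) (h : HermitianMetric n L) : ℝ :=
  logDet b (Hilb E h)

/-- The functional `𝓛 - (d / V) I`. -/
def calLTilde (b : Module.Basis (Fin (Module.finrank ℂ E)) ℂ E) (I : HermitianMetric n L → ℝ)
    (h : HermitianMetric n L) : ℝ :=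
  calL b h - Module.finrank ℂ E / h.V * I h

end Bundle
end Balanced

end

/-! Everything rests on the linearization of the volume form. Write `dμ_{e^φ h} = R_φ dμ_h`
(`volRatio`), and let `D_φ v` be the derivative of `R` at `φ` in the direction `v`
(`volRatioDeriv`). In a chart the matrix of `e^φ h` is `g_φ = g - ∂∂̄φ`, affine in `φ`, so Jacobi's
formula gives `D_φ v = tr(adj(g_φ) (-∂∂̄v)) / det g`. Since `g_φ` is locally the complex Hessian of
a potential, its adjugate is divergence free (the Piola identity). Integrating by parts in charts
and gluing with a partition of unity gives `∫ u D_φ v dμ_h = ∫ v D_φ u dμ_h`; this is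
`integral_mul_volRatioDeriv_symm`.

(i) Along a path `χ_s`, differentiating `∫ χ R_{tχ} dμ` in `s` gives `∫ χ' R_{tχ} + t ∫ χ D_{tχ}
χ'`. By symmetry the last integral is `∫ χ' D_{tχ} χ`, so the sum is the derivative in `t` of `t ∫
χ' R_{tχ}`. Integration over `[0, 1]` leaves `∫ χ' R_χ`, the derivative required by property (*).

(ii) Let `ρ = ∑ |s_α|²_h` for a `Hilb(h)`-orthonormal basis (`bergman`). On a line bundle a metric
is determined by the value of such a sum, so `h` is balanced iff `ρ = 1`
(`isBalanced_iff_bergman_eq_one`). In the direction `ψ` the metric inside `Hilb` varies by `ψ` and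
the measure by `D_0 ψ`, while `V` is stationary. Hence `𝓛` varies by `(d/V) ∫ (ψ + D_0 ψ) ρ dμ_h`,
and by symmetry `𝓛 - (d/V) I` varies by `(d/V) ∫ ψ (ρ + D_0 ρ - 1) dμ_h` (`hasDerivAt_calLTilde`).
So `h` is critical iff `ρ + D_0 ρ = 1`. At a maximum of `ρ` one has `D_0 ρ ≥ 0`, hence `ρ ≤ 1`
there; at a minimum `ρ ≥ 1`. Thus the equation forces `ρ = 1`
(`eq_one_of_add_volRatioDeriv_eq_one`), and conversely `D_0 1 = 0`. -/

noncomputable section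

namespace Balanced

/-! ### Derivatives of determinants and adjugates -/

section Det

variable {F : Type*} [NormedAddCommGroup F] [NormedSpace ℝ F] {n : ℕ}

theorem det_updateRow_eq_sum (M : Matrix (Fin n) (Fin n) ℂ) (i : Fin n) (r : Fin n → ℂ) :
    (M.updateRow i r).det = ∑ j, M.adjugate j i * r j := by
  rw [Matrix.det_eq_sum_mul_adjugate_row _ i]
  refine Finset.sum_congr rfl fun j _ => ?_
  rw [Matrix.updateRow_self, Matrix.adjugate_apply, Matrix.adjugate_apply,
    Matrix.updateRow_idem, mul_comm]

/-- The determinant as a real continuous multilinear map of the rows. -/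
def detMultilinear (n : ℕ) : ContinuousMultilinearMap ℝ (fun _ : Fin n => Fin n → ℂ) ℂ where
  toMultilinearMap := (Matrix.detRowAlternating (n := Fin n) (R := ℂ)).toMultilinearMap.restrictScalars ℝ
  cont := Continuous.matrix_det (A := fun M : Matrix (Fin n) (Fin n) ℂ => M) continuous_id

/-- Jacobi's formula: the determinant is multilinear in the rows, and replacing one row by its
derivative gives a cofactor expansion. -/
theorem hasFDerivAt_det {M : F → Matrix (Fin n) (Fin n) ℂ} {M' : Fin n → Fin n → F →L[ℝ] ℂ} {x : F}
    (h : ∀ i j, HasFDerivAt (fun y => M y i j) (M' i j) x) :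
    HasFDerivAt (fun y => (M y).det) (∑ i, ∑ j, (M x).adjugate j i • M' i j) x := by
  have h1 : HasFDerivAt (fun y => (M y : Fin n → Fin n → ℂ))
      (ContinuousLinearMap.pi fun i => ContinuousLinearMap.pi fun j => M' i j) x :=
    hasFDerivAt_pi.2 fun i => hasFDerivAt_pi.2 fun j => h i j
  have h2 := ((detMultilinear n).hasFDerivAt (M x)).comp x h1
  refine h2.congr_fderiv ?_
  ext v
  have h3 : ∀ (i : Fin n) (r : Fin n → ℂ), detMultilinear n (Function.update (M x) i r) =
      ∑ j, (M x).adjugate j i * r j := fun i r => det_updateRow_eq_sum (M x) i r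
  rw [ContinuousLinearMap.comp_apply]
  erw [ContinuousMultilinearMap.linearDeriv_apply]
  simp only [h3]
  simp

theorem hasDerivAt_det {M : ℝ → Matrix (Fin n) (Fin n) ℂ} {M' : Matrix (Fin n) (Fin n) ℂ} {t : ℝ}
    (h : ∀ i j, HasDerivAt (fun s => M s i j) (M' i j) t) :
    HasDerivAt (fun s => (M s).det) (((M t).adjugate * M').trace) t := by
  have := (hasFDerivAt_det fun i j => (h i j).hasFDerivAt).hasDerivAt
  refine this.congr_deriv ?_
  simp only [Matrix.trace, Matrix.diag, Matrix.mul_apply]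
  rw [Finset.sum_comm]
  simp

/-- An entry of the adjugate is a determinant in which row `j` is a unit vector. Jacobi's formula
replaces a second row `l` by a unit vector; row `j` is constant, so `l = j` contributes nothing.
These double cofactors are what cancels in the Piola identity. -/
theorem hasFDerivAt_adjugate {M : F → Matrix (Fin n) (Fin n) ℂ}
    {M' : Fin n → Fin n → F →L[ℝ] ℂ} {x : F}
    (h : ∀ i j, HasFDerivAt (fun y => M y i j) (M' i j) x) (k j : Fin n) :
    HasFDerivAt (fun y => (M y).adjugate k j) (∑ l, ∑ m, (if l = j then 0 else
      (((M x).updateRow j (Pi.single k 1)).updateRow l (Pi.single m 1)).det) • M' l m) x := by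
  simp only [Matrix.adjugate_apply]
  have h1 : ∀ l m, HasFDerivAt (fun y => (M y).updateRow j (Pi.single k 1) l m)
      (if l = j then 0 else M' l m) x := fun l m => by
    by_cases hl : l = j
    · subst hl
      simpa using hasFDerivAt_const (𝕜 := ℝ) ((Pi.single k 1 : Fin n → ℂ) m) x
    · simpa [hl, Matrix.updateRow_ne hl] using h l m
  refine (hasFDerivAt_det h1).congr_fderiv ?_
  refine Finset.sum_congr rfl fun l _ => Finset.sum_congr rfl fun m _ => ?_
  by_cases hl : l = j
  · rw [if_pos hl, if_pos hl]
    exact (smul_zero (M := ℂ) _).trans (zero_smul ℂ (M' l m)).symm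
  · simp [hl, Matrix.adjugate_apply]

/-- The algebraic form of the Piola identity. -/
theorem piola_sum_eq_zero (M : Matrix (Fin n) (Fin n) ℂ) (N : Fin n → Fin n → Fin n → ℂ)
    (hN : ∀ j l m, N j l m = N l j m) (k : Fin n) :
    ∑ j, ∑ l, ∑ m, (if l = j then 0 else
      ((M.updateRow j (Pi.single k 1)).updateRow l (Pi.single m 1)).det) * N j l m = 0 := by
  -- Exchanging rows `j` and `l` changes the sign of the double cofactor, while `N` is symmetric in
  -- `j` and `l`. The summand is therefore antisymmetric in these indices.
  have anti : ∀ j l, (∑ m, (if l = j then 0 else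
      ((M.updateRow j (Pi.single k 1)).updateRow l (Pi.single m 1)).det) * N j l m) =
      -(∑ m, (if j = l then 0 else
      ((M.updateRow l (Pi.single k 1)).updateRow j (Pi.single m 1)).det) * N l j m) := by
    intro j l
    rw [← Finset.sum_neg_distrib]
    refine Finset.sum_congr rfl fun m _ => ?_
    by_cases hl : l = j
    · simp [hl]
    · have hl' : j ≠ l := fun h => hl h.symm
      rw [if_neg hl, if_neg hl', hN j l m, ← neg_mul]
      congr 1
      have h := Matrix.det_permute (Equiv.swap j l)
        ((M.updateRow l (Pi.single k 1)).updateRow j (Pi.single m 1))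
      rw [Equiv.Perm.sign_swap hl'] at h
      simp only [Units.val_neg, Units.val_one, Int.cast_neg, Int.cast_one, neg_mul, one_mul] at h
      rw [← h]
      congr 1
      ext a b
      simp only [Matrix.submatrix_apply, id, Matrix.updateRow_apply]
      by_cases ha : a = j
      · subst ha
        simp [hl, hl']
      · by_cases hb : a = l
        · subst hb
          simp
        · simp [Equiv.swap_apply_of_ne_of_ne ha hb, ha, hb]
  have h2 : ∀ (S : Fin n → Fin n → ℂ), (∀ j l, S j l = -S l j) → ∑ j, ∑ l, S j l = 0 := by
    intro S hS
    have : ∑ j, ∑ l, S j l = -∑ j, ∑ l, S j l := by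
      conv_lhs => rw [Finset.sum_comm]
      rw [← Finset.sum_neg_distrib]
      refine Finset.sum_congr rfl fun j _ => ?_
      rw [← Finset.sum_neg_distrib]
      exact Finset.sum_congr rfl fun l _ => hS l j
    exact self_eq_neg.1 this
  exact h2 _ anti

end Det

/-! ### Integrals that depend on a parameter -/

theorem hasDerivAt_integral_of_continuous {K : Type*} [TopologicalSpace K] [CompactSpace K]
    [MeasurableSpace K] [OpensMeasurableSpace K] (μ : Measure K) [IsFiniteMeasure μ]
    {F : Type*} [NormedAddCommGroup F] [NormedSpace ℝ F] [SecondCountableTopology F]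
    {f f' : ℝ → K → F} (hf : Continuous (fun q : ℝ × K => f q.1 q.2))
    (hf' : Continuous (fun q : ℝ × K => f' q.1 q.2))
    (hd : ∀ s x, HasDerivAt (fun r => f r x) (f' s x) s) (s : ℝ) :
    HasDerivAt (fun r => ∫ x, f r x ∂μ) (∫ x, f' s x ∂μ) s := by
  borelize F
  -- The dominating function is a constant: a bound of `f'` on the compact set `[s - 1, s + 1] × K`.
  obtain ⟨C, hC⟩ := ((isCompact_Icc (a := s - 1) (b := s + 1)).prod
    (isCompact_univ (X := K))).exists_bound_of_continuousOn hf'.continuousOn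
  have cf : ∀ r, Continuous (f r) := fun r => hf.comp (by fun_prop : Continuous fun x : K => (r, x))
  have cf' : ∀ r, Continuous (f' r) :=
    fun r => hf'.comp (by fun_prop : Continuous fun x : K => (r, x))
  have hint : ∀ g : K → F, Continuous g → Integrable g μ := fun g hg => by
    obtain ⟨B, hB⟩ := (isCompact_univ (X := K)).exists_bound_of_continuousOn hg.continuousOn
    exact Integrable.of_bound hg.aestronglyMeasurable B (ae_of_all _ fun x => hB x (mem_univ x))
  exact (hasDerivAt_integral_of_dominated_loc_of_deriv_le (bound := fun _ => C)
    (Icc_mem_nhds (by linarith : s - 1 < s) (by linarith : s < s + 1))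
    (Eventually.of_forall fun r => (cf r).aestronglyMeasurable) (hint _ (cf s))
    (cf' s).aestronglyMeasurable (ae_of_all _ fun x r hr => hC (r, x) ⟨hr, mem_univ _⟩)
    (integrable_const C) (ae_of_all _ fun x r _ => hd r x)).2

/-! ### Wirtinger derivatives -/

section Wirtinger

variable {n : ℕ}

/-- The derivative `(∂_v + ε ∂_{iv}) / 2`, which is `∂/∂z_j` for `v = e_j`, `ε = -i`, and
`∂/∂z̄_j` for `v = e_j`, `ε = i`. -/
def wirt (ε : ℂ) (v : Fin n → ℂ) (f : (Fin n → ℂ) → ℂ) (z : Fin n → ℂ) : ℂ :=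
  (1 / 2) * (fderiv ℝ f z v + ε * fderiv ℝ f z (Complex.I • v))

theorem two_le_infty : (2 : WithTop ℕ∞) ≤ ∞ := 
  WithTop.coe_le_coe.2 (le_top (a := (2 : ℕ∞)))

theorem wirt_mul {ε : ℂ} {v : Fin n → ℂ} {f g : (Fin n → ℂ) → ℂ} {z : Fin n → ℂ}
    (hf : DifferentiableAt ℝ f z) (hg : DifferentiableAt ℝ g z) :
    wirt ε v (fun y => f y * g y) z = f z * wirt ε v g z + g z * wirt ε v f z := by
  simp only [wirt, fderiv_fun_mul hf hg]
  simp
  ring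

theorem contDiffOn_wirt {ε : ℂ} {v : Fin n → ℂ} {f : (Fin n → ℂ) → ℂ} {W : Set (Fin n → ℂ)}
    (hW : IsOpen W) (hf : ContDiffOn ℝ ∞ f W) : ContDiffOn ℝ ∞ (wirt ε v f) W := by
  have h := hf.fderiv_of_isOpen hW (m := ∞) (by simp)
  unfold wirt
  exact contDiffOn_const.mul ((h.clm_apply contDiffOn_const).add
    (contDiffOn_const.mul (h.clm_apply contDiffOn_const)))

theorem fderiv_fderiv_comm {f : (Fin n → ℂ) → ℂ} {z : Fin n → ℂ} (hf : ContDiffAt ℝ 2 f z)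
    (u v : Fin n → ℂ) : fderiv ℝ (fderiv ℝ f) z u v = fderiv ℝ (fderiv ℝ f) z v u :=
  hf.isSymmSndFDerivAt (by simp) u v

theorem fderiv_wirt {ε : ℂ} {v : Fin n → ℂ} {f : (Fin n → ℂ) → ℂ} {z : Fin n → ℂ}
    (hf : ContDiffAt ℝ 2 f z) (u : Fin n → ℂ) :
    fderiv ℝ (wirt ε v f) z u = (1 / 2) * (fderiv ℝ (fderiv ℝ f) z u v +
      ε * fderiv ℝ (fderiv ℝ f) z u (Complex.I • v)) := by
  have h : DifferentiableAt ℝ (fderiv ℝ f) z :=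
    (hf.fderiv_right (m := 1) le_rfl).differentiableAt one_ne_zero
  have h1 : ∀ w, HasFDerivAt (fun y => fderiv ℝ f y w)
      ((fderiv ℝ (fderiv ℝ f) z).flip w) z := fun w => by
    simpa using h.hasFDerivAt.clm_apply (hasFDerivAt_const w z)
  have h2 := (((h1 v).add ((h1 (Complex.I • v)).const_mul ε)).const_mul (1 / 2 : ℂ)).fderiv
  change fderiv ℝ (fun y => (1 / 2 : ℂ) * (fderiv ℝ f y v + ε * fderiv ℝ f y (Complex.I • v))) z u = _
  erw [h2]
  simp
  ring

theorem wirt_comm {ε ε' : ℂ} {u v : Fin n → ℂ} {f : (Fin n → ℂ) → ℂ} {z : Fin n → ℂ}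
    (hf : ContDiffAt ℝ 2 f z) : wirt ε u (wirt ε' v f) z = wirt ε' v (wirt ε u f) z := by
  have h1 : ∀ (ε ε' : ℂ) (u v : Fin n → ℂ), wirt ε u (wirt ε' v f) z =
      (1 / 2) * (fderiv ℝ (wirt ε' v f) z u + ε * fderiv ℝ (wirt ε' v f) z (Complex.I • u)) :=
    fun _ _ _ _ => rfl
  rw [h1, h1, fderiv_wirt hf, fderiv_wirt hf, fderiv_wirt hf, fderiv_wirt hf,
    fderiv_fderiv_comm hf v u, fderiv_fderiv_comm hf v (Complex.I • u),
    fderiv_fderiv_comm hf (Complex.I • v) u, fderiv_fderiv_comm hf (Complex.I • v) (Complex.I • u)]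
  ring

/-- Iterated first-order operators are the form to which the product rule and integration by parts
apply. -/
theorem complexHessian_eq_wirt {f : (Fin n → ℂ) → ℝ} {z : Fin n → ℂ} (hf : ContDiffAt ℝ 2 f z)
    (j k : Fin n) : complexHessian f z j k =
      wirt (-Complex.I) (Pi.single j 1) (wirt Complex.I (Pi.single k 1) fun y => (f y : ℂ)) z := by
  have hI : ∀ i : Fin n, Complex.I • (Pi.single i 1 : Fin n → ℂ) = Pi.single i Complex.I :=
    fun i => by rw [← Pi.single_smul]; simp
  have hfc : ContDiffAt ℝ 2 (fun y => (f y : ℂ)) z :=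
    Complex.ofRealCLM.contDiff.contDiffAt.comp z hf
  have hev : ∀ᶠ y in 𝓝 z, fderiv ℝ (fun y => (f y : ℂ)) y =
      Complex.ofRealCLM.comp (fderiv ℝ f y) := by
    filter_upwards [hf.eventually (by simp)] with y hy
    exact (Complex.ofRealCLM.hasFDerivAt.comp y
      (hy.differentiableAt two_ne_zero).hasFDerivAt).fderiv
  have h : DifferentiableAt ℝ (fderiv ℝ f) z :=
    (hf.fderiv_right (m := 1) le_rfl).differentiableAt one_ne_zero
  have h2 : ∀ u v, fderiv ℝ (fderiv ℝ (fun y => (f y : ℂ))) z u v =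
      ((fderiv ℝ (fderiv ℝ f) z u v : ℝ) : ℂ) := fun u v => by
    rw [Filter.EventuallyEq.fderiv_eq hev]
    have := ((ContinuousLinearMap.compL ℝ (Fin n → ℂ) ℝ ℂ Complex.ofRealCLM).hasFDerivAt.comp z
      h.hasFDerivAt).fderiv
    erw [this]
    simp
  have h3 : ∀ (ε ε' : ℂ) (u v : Fin n → ℂ) (g : (Fin n → ℂ) → ℂ), wirt ε u (wirt ε' v g) z =
      (1 / 2) * (fderiv ℝ (wirt ε' v g) z u + ε * fderiv ℝ (wirt ε' v g) z (Complex.I • u)) :=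
    fun _ _ _ _ _ => rfl
  rw [h3, fderiv_wirt hfc, fderiv_wirt hfc, h2, h2, h2, h2, hI, hI, complexHessian]
  ring_nf
  simp
  ring

end Wirtinger

/-! ### Integration by parts on `ℂⁿ` and the divergence-free adjugate of a complex Hessian. -/

section IBP

variable {n : ℕ}

/-- A point outside `W` has the neighbourhood `Kᶜ`, on which the extension by zero vanishes
identically. -/
theorem contDiff_indicator {E G : Type*} [NormedAddCommGroup E] [NormedSpace ℝ E]
    [NormedAddCommGroup G] [NormedSpace ℝ G] {W K : Set E} {m : WithTop ℕ∞} (hW : IsOpen W)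
    (hK : IsClosed K) (hKW : K ⊆ W) {f : E → G} (hf : ContDiffOn ℝ m f W)
    (h0 : ∀ z ∈ W, z ∉ K → f z = 0) : ContDiff ℝ m (W.indicator f) := by
  rw [contDiff_iff_contDiffAt]
  intro z
  by_cases hz : z ∈ W
  · refine (hf.contDiffAt (hW.mem_nhds hz)).congr_of_eventuallyEq ?_
    filter_upwards [hW.mem_nhds hz] with y hy using indicator_of_mem hy f
  · refine (contDiffAt_const (c := (0 : G))).congr_of_eventuallyEq ?_
    filter_upwards [hK.isOpen_compl.mem_nhds fun h => hz (hKW h)] with y hy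
    by_cases hy' : y ∈ W
    · rw [indicator_of_mem hy', h0 y hy' hy]
    · exact indicator_of_notMem hy' f

theorem integrableOn_of_eq_zero_off_compact {W K : Set (Fin n → ℂ)} (hW : IsOpen W)
    (hK : IsCompact K) (hKW : K ⊆ W) {f : (Fin n → ℂ) → ℂ} (hf : ContinuousOn f W)
    (h0 : ∀ z ∈ W, z ∉ K → f z = 0) : IntegrableOn f W := by
  have h1 : IntegrableOn f K := (hf.mono hKW).integrableOn_compact hK
  have h2 : IntegrableOn f (W \ K) :=
    integrableOn_zero.congr_fun (fun z hz => (h0 z hz.1 hz.2).symm)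
      (hW.measurableSet.diff hK.measurableSet)
  exact (h1.union h2).mono_set fun z hz => by
    by_cases h : z ∈ K
    · exact Or.inl h
    · exact Or.inr ⟨hz, h⟩

theorem integral_fderiv_eq_zero {f : (Fin n → ℂ) → ℂ} (hf : ContDiff ℝ 1 f)
    (hs : HasCompactSupport f) (v : Fin n → ℂ) : ∫ z, fderiv ℝ f z v = 0 := by
  have c : Continuous fun z => fderiv ℝ f z v :=
    (hf.continuous_fderiv one_ne_zero).clm_apply continuous_const
  have hs' : HasCompactSupport fun z => fderiv ℝ f z v := hs.fderiv_apply ℝ v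
  have := integral_mul_fderiv_eq_neg_fderiv_mul_of_integrable (μ := (volume : Measure (Fin n → ℂ)))
    (f := fun _ => (1 : ℂ)) (g := f) (v := v) (by simp)
    (by simpa using c.integrable_of_hasCompactSupport hs')
    (by simpa using hf.continuous.integrable_of_hasCompactSupport hs)
    (fun _ _ => differentiableAt_const _) (fun _ _ => hf.differentiable one_ne_zero _)
  simpa using this

theorem wirt_eq_zero_off {ε : ℂ} {v : Fin n → ℂ} {W K : Set (Fin n → ℂ)} (hW : IsOpen W)
    (hK : IsClosed K) {f : (Fin n → ℂ) → ℂ} (h0 : ∀ z ∈ W, z ∉ K → f z = 0) :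
    ∀ z ∈ W, z ∉ K → wirt ε v f z = 0 := fun z hz hzK => by
  have : f =ᶠ[𝓝 z] fun _ => 0 := by
    filter_upwards [hW.mem_nhds hz, hK.isOpen_compl.mem_nhds hzK] with y hy hy' using h0 y hy hy'
  simp [wirt, this.fderiv_eq]

/-- Extended by zero, `f` is smooth on all of `ℂⁿ` with compact support, so each of its directional
derivatives has integral zero. -/
theorem setIntegral_wirt_eq_zero {ε : ℂ} {v : Fin n → ℂ} {W K : Set (Fin n → ℂ)} (hW : IsOpen W)
    (hK : IsCompact K) (hKW : K ⊆ W) {f : (Fin n → ℂ) → ℂ} (hf : ContDiffOn ℝ ∞ f W)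
    (h0 : ∀ z ∈ W, z ∉ K → f z = 0) :
    IntegrableOn (wirt ε v f) W ∧ ∫ z in W, wirt ε v f z = 0 := by
  refine ⟨integrableOn_of_eq_zero_off_compact hW hK hKW (contDiffOn_wirt hW hf).continuousOn
    (wirt_eq_zero_off hW hK.isClosed h0), ?_⟩
  have hg := contDiff_indicator hW hK.isClosed hKW hf h0
  have hs : HasCompactSupport (W.indicator f) := by
    refine HasCompactSupport.intro hK fun z hz => ?_
    by_cases h : z ∈ W
    · rw [indicator_of_mem h, h0 z h hz]
    · exact indicator_of_notMem h f
  have h1 := fun u => integral_fderiv_eq_zero (hg.of_le (by simp)) hs u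
  have c : ∀ u, Integrable fun z => fderiv ℝ (W.indicator f) z u := fun u =>
    ((hg.continuous_fderiv (by simp)).clm_apply continuous_const).integrable_of_hasCompactSupport
      (hs.fderiv_apply ℝ u)
  have h2 : ∫ z, wirt ε v (W.indicator f) z = 0 := by
    simp only [wirt]
    rw [integral_const_mul, integral_add (c _) ((c _).const_mul _), integral_const_mul, h1, h1]
    simp
  rw [← h2, ← integral_indicator hW.measurableSet]
  refine integral_congr_ae (ae_of_all _ fun z => ?_)
  by_cases hz : z ∈ W
  · have : W.indicator f =ᶠ[𝓝 z] f := by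
      filter_upwards [hW.mem_nhds hz] with y hy using indicator_of_mem hy f
    simp only [indicator_of_mem hz, wirt, this.fderiv_eq]
  · have : W.indicator f =ᶠ[𝓝 z] fun _ => 0 := by
      filter_upwards [hK.isClosed.isOpen_compl.mem_nhds fun h => hz (hKW h)] with y hy
      by_cases hy' : y ∈ W
      · rw [indicator_of_mem hy', h0 y hy' hy]
      · exact indicator_of_notMem hy' f
    simp [indicator_of_notMem hz, wirt, this.fderiv_eq]

theorem wirt_adjugate {ε : ℂ} {v : Fin n → ℂ} {M : (Fin n → ℂ) → Matrix (Fin n) (Fin n) ℂ}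
    {z : Fin n → ℂ} (h : ∀ i j, DifferentiableAt ℝ (fun y => M y i j) z) (k j : Fin n) :
    wirt ε v (fun y => (M y).adjugate k j) z = ∑ l, ∑ m, (if l = j then 0 else
      (((M z).updateRow j (Pi.single k 1)).updateRow l (Pi.single m 1)).det) *
        wirt ε v (fun y => M y l m) z := by
  simp only [wirt, (hasFDerivAt_adjugate (fun i j => (h i j).hasFDerivAt) k j).fderiv]
  simp only [sum_apply, smul_apply, smul_eq_mul,
    Finset.mul_sum, ← Finset.sum_add_distrib]
  refine Finset.sum_congr rfl fun l _ => Finset.sum_congr rfl fun m _ => ?_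
  ring

/-- The hypothesis `hM` expresses closedness of the form with coefficients `M`. It makes the
derivatives of `M` symmetric in exactly the two indices in which the double cofactors are
antisymmetric. -/
theorem sum_wirt_adjugate_eq_zero {ε : ℂ} {e : Fin n → Fin n → ℂ}
    {M : (Fin n → ℂ) → Matrix (Fin n) (Fin n) ℂ} {z : Fin n → ℂ}
    (h : ∀ i j, DifferentiableAt ℝ (fun y => M y i j) z)
    (hM : ∀ j l m, wirt ε (e j) (fun y => M y l m) z = wirt ε (e l) (fun y => M y j m) z)
    (k : Fin n) : ∑ j, wirt ε (e j) (fun y => (M y).adjugate k j) z = 0 := by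
  simp only [wirt_adjugate h]
  exact piola_sum_eq_zero (M z) (fun j l m => wirt ε (e j) (fun y => M y l m) z) hM k

theorem contDiffOn_adjugate {E : Type*} [NormedAddCommGroup E] [NormedSpace ℝ E]
    {M : E → Matrix (Fin n) (Fin n) ℂ} {W : Set E} {m : WithTop ℕ∞}
    (h : ∀ i j, ContDiffOn ℝ m (fun y => M y i j) W) (k j : Fin n) :
    ContDiffOn ℝ m (fun y => (M y).adjugate k j) W := by
  simp only [Matrix.adjugate_apply, Matrix.det_apply]
  refine ContDiffOn.sum fun σ _ => ContDiffOn.const_smul _ (contDiffOn_prod fun i _ => ?_)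
  by_cases hi : σ i = j
  · simp only [Matrix.updateRow_apply, hi, if_true]
    exact contDiffOn_const
  · simp only [Matrix.updateRow_apply, hi, if_false]
    exact h _ _

theorem contDiffOn_det {E : Type*} [NormedAddCommGroup E] [NormedSpace ℝ E]
    {M : E → Matrix (Fin n) (Fin n) ℂ} {W : Set E} {m : WithTop ℕ∞}
    (h : ∀ i j, ContDiffOn ℝ m (fun y => M y i j) W) :
    ContDiffOn ℝ m (fun y => (M y).det) W := by
  simp only [Matrix.det_apply]
  exact ContDiffOn.sum fun σ _ => ContDiffOn.const_smul _ (contDiffOn_prod fun i _ => h _ _)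

/-- The basis vectors of `ℂⁿ`. -/
abbrev stdVec (j : Fin n) : Fin n → ℂ := Pi.single j 1

theorem contDiffOn_complexHessian {f : (Fin n → ℂ) → ℝ} {W : Set (Fin n → ℂ)} (hW : IsOpen W)
    (hf : ContDiffOn ℝ ∞ f W) (j k : Fin n) :
    ContDiffOn ℝ ∞ (fun z => complexHessian f z j k) W := by
  have hfc : ContDiffOn ℝ ∞ (fun y => (f y : ℂ)) W :=
    Complex.ofRealCLM.contDiff.comp_contDiffOn hf
  refine ((contDiffOn_wirt hW (contDiffOn_wirt hW hfc)).congr fun z hz =>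
    complexHessian_eq_wirt ((hf.contDiffAt (hW.mem_nhds hz)).of_le two_le_infty) j k)

/-- The linearization of `f ↦ det ∂∂̄f` is formally self-adjoint. -/
theorem setIntegral_trace_adjugate_symm {W K : Set (Fin n → ℂ)} (hW : IsOpen W)
    (hK : IsCompact K) (hKW : K ⊆ W) {l u v : (Fin n → ℂ) → ℝ} (hl : ContDiffOn ℝ ∞ l W)
    (hu : ContDiffOn ℝ ∞ u W) (hv : ContDiffOn ℝ ∞ v W) (h0 : ∀ z ∈ W, z ∉ K → u z = 0) :
    ∫ z in W, u z * ((complexHessian l z).adjugate * complexHessian v z).trace.re =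
      ∫ z in W, v z * ((complexHessian l z).adjugate * complexHessian u z).trace.re := by
  have at' : ∀ {f : (Fin n → ℂ) → ℂ} {z}, ContDiffOn ℝ ∞ f W → z ∈ W → ContDiffAt ℝ ∞ f z :=
    fun hf hz => hf.contDiffAt (hW.mem_nhds hz)
  have da : ∀ {f : (Fin n → ℂ) → ℂ} {z}, ContDiffOn ℝ ∞ f W → z ∈ W → DifferentiableAt ℝ f z :=
    fun hf hz => (at' hf hz).differentiableAt (by simp)
  have cc : ∀ {f : (Fin n → ℂ) → ℝ}, ContDiffOn ℝ ∞ f W → ContDiffOn ℝ ∞ (fun y => (f y : ℂ)) W :=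
    fun hf => Complex.ofRealCLM.contDiff.comp_contDiffOn hf
  have he : ∀ {f : (Fin n → ℂ) → ℝ}, ContDiffOn ℝ ∞ f W → ∀ z ∈ W, ∀ j k, complexHessian f z j k =
      wirt (-Complex.I) (stdVec j) (wirt Complex.I (stdVec k) fun y => (f y : ℂ)) z :=
    fun hf z hz j k => complexHessian_eq_wirt ((hf.contDiffAt (hW.mem_nhds hz)).of_le two_le_infty) j k
  have he' : ∀ {f : (Fin n → ℂ) → ℝ}, ContDiffOn ℝ ∞ f W → ∀ z ∈ W, ∀ j k, complexHessian f z j k =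
      wirt Complex.I (stdVec k) (wirt (-Complex.I) (stdVec j) fun y => (f y : ℂ)) z :=
    fun hf z hz j k => by rw [he hf z hz, wirt_comm ((at' (cc hf) hz).of_le two_le_infty)]
  set C : Fin n → Fin n → (Fin n → ℂ) → ℂ := fun k j z => (complexHessian l z).adjugate k j with hC
  have sC : ∀ k j, ContDiffOn ℝ ∞ (C k j) W :=
    contDiffOn_adjugate (contDiffOn_complexHessian hW hl)
  have dM : ∀ z ∈ W, ∀ i j, DifferentiableAt ℝ (fun y => complexHessian l y i j) z :=
    fun z hz i j => da (contDiffOn_complexHessian hW hl i j) hz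
  have cg : ∀ {f g : (Fin n → ℂ) → ℂ} {ε v} {z}, z ∈ W → (∀ y ∈ W, f y = g y) →
      wirt ε v f z = wirt ε v g z := fun {f g ε v z} hz h => by
    have : f =ᶠ[𝓝 z] g := by filter_upwards [hW.mem_nhds hz] with y hy using h y hy
    simp only [wirt, this.fderiv_eq]
  -- The cofactor matrix is divergence free along its rows, since `∂_j ∂_a ∂̄_m l` is symmetric in
  -- `j` and `a`.
  have p1 : ∀ z ∈ W, ∀ k, ∑ j, wirt (-Complex.I) (stdVec j) (C k j) z = 0 := fun z hz k => by
    refine sum_wirt_adjugate_eq_zero (dM z hz) (fun j a m => ?_) k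
    rw [cg hz fun y hy => he hl y hy a m, cg hz fun y hy => he hl y hy j m]
    exact wirt_comm ((at' (contDiffOn_wirt hW (cc hl)) hz).of_le two_le_infty)
  -- The same along the columns: transpose, and let `∂` and `∂̄` exchange their roles.
  have p2 : ∀ z ∈ W, ∀ j, ∑ k, wirt Complex.I (stdVec k) (C k j) z = 0 := fun z hz j => by
    have := sum_wirt_adjugate_eq_zero (ε := Complex.I) (e := stdVec)
      (M := fun y => (complexHessian l y).transpose) (z := z) (fun a b => dM z hz b a)
      (fun a b m => ?_) j
    · simpa only [← Matrix.adjugate_transpose, Matrix.transpose_apply] using this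
    · simp only [Matrix.transpose_apply]
      rw [cg hz fun y hy => he' hl y hy m b, cg hz fun y hy => he' hl y hy m a]
      exact wirt_comm ((at' (contDiffOn_wirt hW (cc hl)) hz).of_le two_le_infty)
  -- `P` and `Q` are fluxes. As `C` is divergence free, `∑ ∂_j P_kj` is `u tr(C ∂∂̄v)` plus the
  -- cross term `∑ C_kj ∂̄_k v ∂_j u`, and `∑ ∂̄_k Q_kj` is `v tr(C ∂∂̄u)` plus the same cross term,
  -- which drops out of the difference.
  set P : Fin n → Fin n → (Fin n → ℂ) → ℂ := fun k j z =>
    (u z : ℂ) * (C k j z * wirt Complex.I (stdVec k) (fun y => (v y : ℂ)) z) with hP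
  set Q : Fin n → Fin n → (Fin n → ℂ) → ℂ := fun k j z =>
    (v z : ℂ) * (C k j z * wirt (-Complex.I) (stdVec j) (fun y => (u y : ℂ)) z) with hQ
  have h0c : ∀ z ∈ W, z ∉ K → (u z : ℂ) = 0 := fun z hz hz' => by rw [h0 z hz hz']; simp
  -- Only `u` has compact support, and that suffices: `P` contains `u` as a factor and `Q` contains
  -- a derivative of `u`.
  have iP := fun k j => setIntegral_wirt_eq_zero (ε := -Complex.I) (v := stdVec j) hW hK hKW
    (f := P k j) ((cc hu).mul ((sC k j).mul (contDiffOn_wirt hW (cc hv))))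
    (fun z hz hz' => by simp only [hP, h0c z hz hz', zero_mul])
  have iQ := fun k j => setIntegral_wirt_eq_zero (ε := Complex.I) (v := stdVec k) hW hK hKW
    (f := Q k j) ((cc hv).mul ((sC k j).mul (contDiffOn_wirt hW (cc hu))))
    (fun z hz hz' => by
      simp only [hQ, wirt_eq_zero_off hW hK.isClosed h0c z hz hz', mul_zero])
  have tr : ∀ (A : Matrix (Fin n) (Fin n) ℂ) (B : Matrix (Fin n) (Fin n) ℂ),
      (A * B).trace = ∑ k, ∑ j, A k j * B j k := fun A B => by
    simp only [Matrix.trace, Matrix.diag, Matrix.mul_apply]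
  have key : ∀ z ∈ W, (u z : ℂ) * ((complexHessian l z).adjugate * complexHessian v z).trace -
      (v z : ℂ) * ((complexHessian l z).adjugate * complexHessian u z).trace =
      ∑ k, ∑ j, (wirt (-Complex.I) (stdVec j) (P k j) z - wirt Complex.I (stdVec k) (Q k j) z) := by
    intro z hz
    have eP : ∀ k j, wirt (-Complex.I) (stdVec j) (P k j) z =
        (u z : ℂ) * (C k j z * complexHessian v z j k) +
        wirt Complex.I (stdVec k) (fun y => (v y : ℂ)) z * (u z : ℂ) *
          wirt (-Complex.I) (stdVec j) (C k j) z +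
        C k j z * wirt Complex.I (stdVec k) (fun y => (v y : ℂ)) z *
          wirt (-Complex.I) (stdVec j) (fun y => (u y : ℂ)) z := fun k j => by
      simp only [hP]
      rw [wirt_mul (da (cc hu) hz) (da ((sC k j).mul (contDiffOn_wirt hW (cc hv))) hz),
        wirt_mul (da (sC k j) hz) (da (contDiffOn_wirt hW (cc hv)) hz), ← he hv z hz]
      ring
    have eQ : ∀ k j, wirt Complex.I (stdVec k) (Q k j) z =
        (v z : ℂ) * (C k j z * complexHessian u z j k) +
        wirt (-Complex.I) (stdVec j) (fun y => (u y : ℂ)) z * (v z : ℂ) *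
          wirt Complex.I (stdVec k) (C k j) z +
        C k j z * wirt (-Complex.I) (stdVec j) (fun y => (u y : ℂ)) z *
          wirt Complex.I (stdVec k) (fun y => (v y : ℂ)) z := fun k j => by
      simp only [hQ]
      rw [wirt_mul (da (cc hv) hz) (da ((sC k j).mul (contDiffOn_wirt hW (cc hu))) hz),
        wirt_mul (da (sC k j) hz) (da (contDiffOn_wirt hW (cc hu)) hz), ← he' hu z hz]
      ring
    have s1 : ∑ k, ∑ j, wirt Complex.I (stdVec k) (fun y => (v y : ℂ)) z * (u z : ℂ) *
          wirt (-Complex.I) (stdVec j) (C k j) z = 0 := by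
      simp only [← Finset.mul_sum, p1 z hz, mul_zero, Finset.sum_const_zero]
    have s2 : ∑ k, ∑ j, wirt (-Complex.I) (stdVec j) (fun y => (u y : ℂ)) z * (v z : ℂ) *
          wirt Complex.I (stdVec k) (C k j) z = 0 := by
      rw [Finset.sum_comm]
      simp only [← Finset.mul_sum, p2 z hz, mul_zero, Finset.sum_const_zero]
    rw [tr, tr, Finset.mul_sum, Finset.mul_sum]
    simp only [Finset.mul_sum]
    simp only [eP, eQ, Finset.sum_sub_distrib, Finset.sum_add_distrib, s1, s2]
    have s3 : ∀ k j, C k j z * wirt (-Complex.I) (stdVec j) (fun y => (u y : ℂ)) z *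
          wirt Complex.I (stdVec k) (fun y => (v y : ℂ)) z =
        C k j z * wirt Complex.I (stdVec k) (fun y => (v y : ℂ)) z *
          wirt (-Complex.I) (stdVec j) (fun y => (u y : ℂ)) z := fun k j => by ring
    simp only [s3]
    ring
  have sm : ∀ {f : (Fin n → ℂ) → ℝ}, ContDiffOn ℝ ∞ f W → ContDiffOn ℝ ∞
      (fun z => ((complexHessian l z).adjugate * complexHessian f z).trace) W := fun hf => by
    simp only [tr]
    exact ContDiffOn.sum fun k _ => ContDiffOn.sum fun j _ =>
      (sC k j).mul (contDiffOn_complexHessian hW hf j k)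
  have i1 : IntegrableOn (fun z => (u z : ℂ) *
      ((complexHessian l z).adjugate * complexHessian v z).trace) W :=
    integrableOn_of_eq_zero_off_compact hW hK hKW ((cc hu).mul (sm hv)).continuousOn
      fun z hz hz' => by rw [h0c z hz hz', zero_mul]
  have i2 : IntegrableOn (fun z => (v z : ℂ) *
      ((complexHessian l z).adjugate * complexHessian u z).trace) W :=
    integrableOn_of_eq_zero_off_compact hW hK hKW ((cc hv).mul (sm hu)).continuousOn
      fun z hz hz' => by
        have : ∀ j k, complexHessian u z j k = 0 := fun j k => by
          rw [he hu z hz]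
          exact wirt_eq_zero_off hW hK.isClosed (wirt_eq_zero_off hW hK.isClosed h0c) z hz hz'
        simp [tr, this]
  have iR : ∀ k j, IntegrableOn (fun z =>
      wirt (-Complex.I) (stdVec j) (P k j) z - wirt Complex.I (stdVec k) (Q k j) z) W :=
    fun k j => (iP k j).1.sub (iQ k j).1
  suffices h : ∫ z in W, (u z : ℂ) * ((complexHessian l z).adjugate * complexHessian v z).trace =
      ∫ z in W, (v z : ℂ) * ((complexHessian l z).adjugate * complexHessian u z).trace by
    have h' := congrArg Complex.re h
    rw [← RCLike.re_eq_complex_re, ← integral_re i1, ← integral_re i2] at h'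
    simpa only [RCLike.re_eq_complex_re, Complex.re_ofReal_mul] using h'
  rw [← sub_eq_zero, ← integral_sub i1 i2, setIntegral_congr_fun hW.measurableSet key]
  refine (integral_finsetSum _ fun k _ => integrable_finsetSum _ fun j _ => iR k j).trans ?_
  refine Finset.sum_eq_zero fun k _ => ?_
  refine (integral_finsetSum _ fun j _ => iR k j).trans ?_
  refine Finset.sum_eq_zero fun j _ => ?_
  rw [integral_sub (iP k j).1 (iQ k j).1, (iP k j).2, (iQ k j).2, sub_zero]

end IBP

/-! ### The Levi form -/

section Levi

variable {E F : Type*} [NormedAddCommGroup E] [NormedSpace ℂ E] [NormedAddCommGroup F]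
  [NormedSpace ℂ F]

/-- The Levi form `∑ ∂²f/∂z_j∂z̄_k u_j v̄_k` of a real function, without coordinates. -/
def levi (f : E → ℝ) (z u v : E) : ℂ :=
  (1 / 4) * ((fderiv ℝ (fderiv ℝ f) z u v : ℝ) +
    (fderiv ℝ (fderiv ℝ f) z (Complex.I • u) (Complex.I • v) : ℝ) +
    Complex.I * ((fderiv ℝ (fderiv ℝ f) z u (Complex.I • v) : ℝ) -
      (fderiv ℝ (fderiv ℝ f) z (Complex.I • u) v : ℝ)))

theorem smul_eq_re_add_im (c : ℂ) (u : E) : c • u = c.re • u + c.im • (Complex.I • u) := by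
  conv_lhs => rw [← Complex.re_add_im c]
  rw [add_smul, mul_smul]
  rfl

theorem I_smul_I_smul (u : E) : Complex.I • (Complex.I • u) = -u := by
  rw [← mul_smul, Complex.I_mul_I, neg_one_smul]

/-- The Levi form as a sesquilinear map. -/
def leviMap (f : E → ℝ) (z : E) : E →ₗ[ℂ] E →ₛₗ[starRingEnd ℂ] ℂ :=
  LinearMap.mk₂'ₛₗ (RingHom.id ℂ) (starRingEnd ℂ) (levi f z)
    (fun u u' v => by simp [levi]; ring)
    (fun c u v => by
      rw [smul_eq_re_add_im c u]
      simp only [levi, smul_add, smul_comm Complex.I (_ : ℝ), I_smul_I_smul]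
      simp only [map_add, map_smul, map_neg, add_apply, smul_apply, neg_apply, smul_eq_mul,
        RingHom.id_apply]
      conv_rhs => rw [← Complex.re_add_im c]
      push_cast
      ring_nf
      simp only [Complex.I_sq]
      ring)
    (fun u v v' => by simp [levi]; ring)
    (fun c u v => by
      rw [smul_eq_re_add_im c v]
      simp only [levi, smul_add, smul_comm Complex.I (_ : ℝ), I_smul_I_smul]
      simp only [map_add, map_smul, map_neg, smul_eq_mul]
      have : (starRingEnd ℂ) c = c.re - c.im * Complex.I := by
        apply Complex.ext <;> simp
      rw [this]
      push_cast
      ring_nf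
      simp only [Complex.I_sq]
      ring)

/-- The second derivative of `f ∘ g` has the extra term `Df(D²g(·,·))`. For holomorphic `g` the map
`D²g` is complex bilinear, so `D²g(iu, iv) = -D²g(u, v)` and `D²g(u, iv) = D²g(iu, v)`, and this
term cancels in the Levi form. -/
theorem levi_comp {f : F → ℝ} {g : E → F} {z : E} (hf : ContDiffAt ℝ 2 f (g z))
    (hg : ContDiffAt ℂ 2 g z) (u v : E) :
    levi (fun y => f (g y)) z u v = levi f (g z) (fderiv ℂ g z u) (fderiv ℂ g z v) := by
  have hgr : ContDiffAt ℝ 2 g z := hg.restrict_scalars ℝ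
  have dg : ∀ᶠ y in 𝓝 z, fderiv ℝ g y = (fderiv ℂ g y).restrictScalars ℝ := by
    filter_upwards [hg.eventually (by simp)] with y hy
    exact (hy.differentiableAt two_ne_zero).fderiv_restrictScalars ℝ
  have h1 : ∀ᶠ y in 𝓝 z, fderiv ℝ (fun y => f (g y)) y =
      (fderiv ℝ f (g y)).comp (fderiv ℝ g y) := by
    filter_upwards [hgr.eventually (by simp),
      hgr.continuousAt.eventually (hf.eventually (by simp))] with y hy hy'
    exact fderiv_comp y (hy'.differentiableAt two_ne_zero) (hy.differentiableAt two_ne_zero)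
  have df : DifferentiableAt ℝ (fderiv ℝ f) (g z) :=
    (hf.fderiv_right (m := 1) le_rfl).differentiableAt one_ne_zero
  have dgc : DifferentiableAt ℂ (fderiv ℂ g) z :=
    (hg.fderiv_right (m := 1) le_rfl).differentiableAt one_ne_zero
  have dgr : DifferentiableAt ℝ (fderiv ℝ g) z :=
    (hgr.fderiv_right (m := 1) le_rfl).differentiableAt one_ne_zero
  have d2g : ∀ a b, fderiv ℝ (fderiv ℝ g) z a b = fderiv ℂ (fderiv ℂ g) z a b := fun a b => by
    rw [Filter.EventuallyEq.fderiv_eq dg]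
    have := ((ContinuousLinearMap.restrictScalarsL ℂ E F ℝ ℝ).hasFDerivAt.comp z
      (dgc.hasFDerivAt.restrictScalars ℝ)).fderiv
    erw [this]
    rfl
  have d2 : ∀ a b, fderiv ℝ (fderiv ℝ (fun y => f (g y))) z a b =
      fderiv ℝ (fderiv ℝ f) (g z) (fderiv ℂ g z a) (fderiv ℂ g z b) +
      fderiv ℝ f (g z) (fderiv ℂ (fderiv ℂ g) z a b) := fun a b => by
    rw [Filter.EventuallyEq.fderiv_eq h1]
    have h2 := ((df.hasFDerivAt.comp z
      (hgr.differentiableAt two_ne_zero).hasFDerivAt).clm_comp dgr.hasFDerivAt).fderiv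
    erw [h2]
    simp only [add_apply, ContinuousLinearMap.comp_apply, ContinuousLinearMap.compL_apply,
      ContinuousLinearMap.flip_apply, d2g]
    rw [dg.self_of_nhds, add_comm]
    rfl
  simp only [levi, d2, map_smul, smul_apply, I_smul_I_smul, map_neg]
  push_cast
  ring

theorem levi_re {z u v : ℂ} : levi Complex.re z u v = 0 := by
  have : fderiv ℝ Complex.re = fun _ => Complex.reCLM := by
    ext1 y
    exact Complex.reCLM.fderiv
  simp [levi, this]

/-- `log |g|²` is pluriharmonic: up to a constant it is locally the real part of the holomorphic
function `2 log g`. -/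
theorem levi_log_normSq {g : E → ℂ} {z : E} (hg : ContDiffAt ℂ 2 g z) (h0 : g z ≠ 0) (u v : E) :
    levi (fun y => Real.log (‖g y‖ ^ 2)) z u v = 0 := by
  -- Division by `g z` brings the argument of the logarithm near `1`, away from the branch cut,
  -- whatever the value `g z`.
  set k : E → ℂ := fun y => 2 * Complex.log (g y / g z) with hk
  have hkd : ContDiffAt ℂ 2 k z := by
    have h1 : ContDiffAt ℂ 2 Complex.log (g z / g z) := by
      rw [div_self h0]
      exact Complex.contDiffAt_log Complex.one_mem_slitPlane
    exact contDiffAt_const.mul (ContDiffAt.comp (f := fun y => g y / g z) z h1 (hg.div_const (g z)))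
  have e : (fun y => Real.log (‖g y‖ ^ 2)) =ᶠ[𝓝 z]
      fun y => (k y).re + Real.log (‖g z‖ ^ 2) := by
    filter_upwards [hg.continuousAt.eventually_ne h0] with y hy
    rw [hk]
    simp only [Complex.mul_re, Complex.re_ofNat, Complex.im_ofNat, zero_mul, sub_zero,
      Complex.log_re, norm_div]
    rw [Real.log_div (norm_ne_zero_iff.2 hy) (norm_ne_zero_iff.2 h0), Real.log_pow, Real.log_pow]
    push_cast
    ring
  have e2 : fderiv ℝ (fun y => Real.log (‖g y‖ ^ 2)) =ᶠ[𝓝 z] fderiv ℝ (fun y => (k y).re) := by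
    refine e.fderiv.trans (Eventually.of_forall fun y => ?_)
    exact fderiv_add_const _
  have h1 : levi (fun y => Real.log (‖g y‖ ^ 2)) z u v = levi (fun y => (k y).re) z u v := by
    simp only [levi, e2.fderiv_eq]
  rw [h1, levi_comp (f := Complex.re) Complex.reCLM.contDiff.contDiffAt hkd, levi_re]

end Levi

/-! ### Algebra of complex Hessians and their transformation under holomorphic maps. -/

section Hessian

variable {n : ℕ}

theorem complexHessian_eq_levi (f : (Fin n → ℂ) → ℝ) (z : Fin n → ℂ) (j k : Fin n) :
    complexHessian f z j k = levi f z (stdVec j) (stdVec k) := by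
  have hI : ∀ i : Fin n, Complex.I • (Pi.single i 1 : Fin n → ℂ) = Pi.single i Complex.I :=
    fun i => by rw [← Pi.single_smul]; simp
  simp only [levi, hI]
  rfl

theorem levi_eq_sum (f : (Fin n → ℂ) → ℝ) (z u v : Fin n → ℂ) :
    levi f z u v = ∑ a, ∑ b, u a * conj (v b) * complexHessian f z a b := by
  have h : ∀ w : Fin n → ℂ, w = ∑ a, w a • stdVec a := fun w => by
    simpa using (Pi.basisFun ℂ (Fin n)).sum_repr w |>.symm
  change leviMap f z u v = _
  conv_lhs => rw [h u, h v]
  rw [LinearMap.map_sum₂]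
  refine Finset.sum_congr rfl fun a _ => ?_
  rw [map_smul, LinearMap.smul_apply, map_sum, smul_eq_mul, Finset.mul_sum]
  refine Finset.sum_congr rfl fun b _ => ?_
  rw [LinearMap.map_smulₛₗ, complexHessian_eq_levi, smul_eq_mul, mul_assoc]
  rfl

theorem Filter.EventuallyEq.complexHessian_eq {f g : (Fin n → ℂ) → ℝ} {z : Fin n → ℂ}
    (h : f =ᶠ[𝓝 z] g) : complexHessian f z = complexHessian g z := by
  unfold complexHessian
  rw [h.fderiv.fderiv_eq]

theorem complexHessian_add {f g : (Fin n → ℂ) → ℝ} {z : Fin n → ℂ} (hf : ContDiffAt ℝ 2 f z)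
    (hg : ContDiffAt ℝ 2 g z) :
    complexHessian (fun y => f y + g y) z = complexHessian f z + complexHessian g z := by
  have h1 : fderiv ℝ (fun y => f y + g y) =ᶠ[𝓝 z] fun y => fderiv ℝ f y + fderiv ℝ g y := by
    filter_upwards [hf.eventually (by simp), hg.eventually (by simp)] with y hy hy'
    exact fderiv_add (hy.differentiableAt two_ne_zero) (hy'.differentiableAt two_ne_zero)
  have h2 := fderiv_add ((hf.fderiv_right (m := 1) le_rfl).differentiableAt one_ne_zero)
    ((hg.fderiv_right (m := 1) le_rfl).differentiableAt one_ne_zero)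
  ext j k
  rw [Matrix.add_apply, complexHessian_eq_levi, complexHessian_eq_levi, complexHessian_eq_levi]
  simp only [levi, h1.fderiv_eq]
  erw [h2]
  simp
  ring

theorem complexHessian_const_mul {f : (Fin n → ℂ) → ℝ} {z : Fin n → ℂ} (hf : ContDiffAt ℝ 2 f z)
    (c : ℝ) : complexHessian (fun y => c * f y) z = (c : ℂ) • complexHessian f z := by
  have h1 : fderiv ℝ (fun y => c * f y) =ᶠ[𝓝 z] fun y => c • fderiv ℝ f y := by
    filter_upwards [hf.eventually (by simp)] with y hy
    exact fderiv_const_mul (hy.differentiableAt two_ne_zero) c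
  have h2 := fderiv_const_smul
    ((hf.fderiv_right (m := 1) le_rfl).differentiableAt one_ne_zero) c
  ext j k
  rw [Matrix.smul_apply, complexHessian_eq_levi, complexHessian_eq_levi]
  simp only [levi, h1.fderiv_eq]
  erw [h2]
  simp
  ring

theorem complexHessian_isHermitian {f : (Fin n → ℂ) → ℝ} {z : Fin n → ℂ}
    (hf : ContDiffAt ℝ 2 f z) : (complexHessian f z).IsHermitian := by
  ext j k
  have s := fun u v => hf.isSymmSndFDerivAt (by simp) u v
  rw [Matrix.conjTranspose_apply, complexHessian_eq_levi, complexHessian_eq_levi, levi, levi,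
    s (stdVec k) (stdVec j), s (Complex.I • stdVec k) (stdVec j),
    s (stdVec k) (Complex.I • stdVec j), s (Complex.I • stdVec k) (Complex.I • stdVec j)]
  simp only [RCLike.star_def, map_mul, map_add, map_sub, Complex.conj_ofReal, Complex.conj_I,
    map_div₀, map_one, map_ofNat]
  ring

/-- The matrix with entries conjugate to those of the holomorphic derivative of `g`. -/
def conjJacobian (g : (Fin n → ℂ) → Fin n → ℂ) (z : Fin n → ℂ) : Matrix (Fin n) (Fin n) ℂ :=
  (LinearMap.toMatrix' (fderiv ℂ g z : (Fin n → ℂ) →ₗ[ℂ] Fin n → ℂ)).map (starRingEnd ℂ)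

/-- The holomorphic index of the Hessian is the row index, so the law reads `Jᵀ H J̄`. With `B = J̄`
this is `Bᴴ H B`, which explains the conjugate in `conjJacobian`. -/
theorem complexHessian_comp {f : (Fin n → ℂ) → ℝ} {g : (Fin n → ℂ) → Fin n → ℂ} {z : Fin n → ℂ}
    (hf : ContDiffAt ℝ 2 f (g z)) (hg : ContDiffAt ℂ 2 g z) :
    complexHessian (fun y => f (g y)) z =
      (conjJacobian g z).conjTranspose * complexHessian f (g z) * conjJacobian g z := by
  ext j k
  rw [complexHessian_eq_levi, levi_comp hf hg, levi_eq_sum]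
  simp only [Matrix.mul_apply, Matrix.conjTranspose_apply, conjJacobian, Matrix.map_apply,
    LinearMap.toMatrix'_apply, Finset.sum_mul]
  rw [Finset.sum_comm]
  refine Finset.sum_congr rfl fun a _ => Finset.sum_congr rfl fun b _ => ?_
  simp
  ring

theorem det_conjTranspose_mul_mul (A B : Matrix (Fin n) (Fin n) ℂ) :
    (B.conjTranspose * A * B).det = (Complex.normSq B.det : ℂ) * A.det := by
  rw [Matrix.det_mul, Matrix.det_mul, Matrix.det_conjTranspose, ← Complex.mul_conj]
  simp
  ring

/-- The real determinant of a complex linear map is the norm from `ℂ` to `ℝ` of its complex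
determinant. This matches the factor by which the determinant of a Hermitian form changes, so `det
g` is a density. -/
theorem abs_det_restrictScalars (A : (Fin n → ℂ) →L[ℂ] Fin n → ℂ) :
    |(A.restrictScalars ℝ).det| = Complex.normSq A.det := by
  have : (A.restrictScalars ℝ).det = Complex.normSq A.det := by
    rw [ContinuousLinearMap.det, ContinuousLinearMap.det, ← Algebra.norm_complex_apply,
      ← LinearMap.det_restrictScalars]
    rfl
  rw [this, abs_of_nonneg (Complex.normSq_nonneg _)]

theorem normSq_det_conjJacobian (g : (Fin n → ℂ) → Fin n → ℂ) (z : Fin n → ℂ) :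
    Complex.normSq (conjJacobian g z).det = Complex.normSq (fderiv ℂ g z).det := by
  have := (RingHom.map_det (starRingEnd ℂ)
    (LinearMap.toMatrix' (fderiv ℂ g z : (Fin n → ℂ) →ₗ[ℂ] Fin n → ℂ))).symm
  rw [RingHom.mapMatrix_apply] at this
  rw [conjJacobian, this, LinearMap.det_toMatrix', Complex.normSq_conj]

/-! ### The second derivative test -/

/-- Restrict `f` to the line through `z` along `u`. A positive second derivative would make `0` a
local minimum as well as a local maximum; the restriction would then be locally constant, with
second derivative zero. -/
theorem fderiv_fderiv_nonpos_of_isLocalMax {E : Type*} [NormedAddCommGroup E] [NormedSpace ℝ E]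
    {f : E → ℝ} {z : E} (hf : ContDiffAt ℝ 2 f z) (h : IsLocalMax f z) (u : E) :
    fderiv ℝ (fderiv ℝ f) z u u ≤ 0 := by
  set g : ℝ → ℝ := fun t => f (z + t • u) with hg
  have hl : ∀ t : ℝ, HasDerivAt (fun t : ℝ => z + t • u) u t := fun t => by
    simpa using ((hasDerivAt_id t).smul_const u).const_add z
  have h00 : z + (0 : ℝ) • u = z := by simp
  have hcl : ContinuousAt (fun t : ℝ => z + t • u) 0 := (hl 0).continuousAt
  have h1 : deriv g =ᶠ[𝓝 0] fun t => fderiv ℝ f (z + t • u) u := by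
    have : ∀ᶠ y in 𝓝 (z + (0 : ℝ) • u), ContDiffAt ℝ 2 f y := by
      rw [h00]
      exact hf.eventually (by simp)
    filter_upwards [hcl.eventually this] with t ht
    have hd : HasFDerivAt f (fderiv ℝ f (z + t • u)) (z + t • u) :=
      (ht.differentiableAt two_ne_zero).hasFDerivAt
    exact (HasFDerivAt.comp_hasDerivAt (f := fun t : ℝ => z + t • u) t hd (hl t)).deriv
  have df : DifferentiableAt ℝ (fderiv ℝ f) (z + (0 : ℝ) • u) := by
    rw [h00]
    exact (hf.fderiv_right (m := 1) le_rfl).differentiableAt one_ne_zero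
  have h2 : deriv (deriv g) 0 = fderiv ℝ (fderiv ℝ f) z u u := by
    rw [h1.deriv_eq]
    have h3 : HasDerivAt (fun t : ℝ => fderiv ℝ f (z + t • u))
        (fderiv ℝ (fderiv ℝ f) (z + (0 : ℝ) • u) u) 0 :=
      HasFDerivAt.comp_hasDerivAt (f := fun t : ℝ => z + t • u) 0 df.hasFDerivAt (hl 0)
    have h4 := (h3.clm_apply (hasDerivAt_const 0 u)).deriv
    rw [h00] at h4
    rw [h4]
    simp
  have hgc : ContinuousAt g 0 := by
    have : ContinuousAt f (z + (0 : ℝ) • u) := by rw [h00]; exact hf.continuousAt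
    exact ContinuousAt.comp (f := fun t : ℝ => z + t • u) this hcl
  have hmax : IsLocalMax g 0 := by
    have : ∀ᶠ y in 𝓝 (z + (0 : ℝ) • u), f y ≤ f z := by rw [h00]; exact h
    filter_upwards [hcl.eventually this] with t ht
    simpa [hg] using ht
  by_contra! hc
  have hmin := isLocalMin_of_deriv_deriv_pos (f := g) (x₀ := 0) (by rw [h2]; exact hc)
    hmax.deriv_eq_zero hgc
  have : g =ᶠ[𝓝 0] fun _ => g 0 := by
    filter_upwards [hmax, hmin] with t h1 h2 using le_antisymm h1 h2
  have h3 : deriv (deriv g) 0 = 0 := by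
    rw [this.deriv.deriv_eq]
    simp
  rw [h2] at h3
  exact hc.ne' h3

theorem posSemidef_neg_complexHessian {f : (Fin n → ℂ) → ℝ} {z : Fin n → ℂ}
    (hf : ContDiffAt ℝ 2 f z) (h : IsLocalMax f z) : (-complexHessian f z).PosSemidef := by
  refine Matrix.PosSemidef.of_dotProduct_mulVec_nonneg (complexHessian_isHermitian hf).neg
    fun x => ?_
  -- The matrix form conjugates its left vector, whereas `levi` is linear in its first argument;
  -- hence `star x` in both places.
  have e : star x ⬝ᵥ (-complexHessian f z).mulVec x = -levi f z (star x) (star x) := by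
    rw [levi_eq_sum]
    simp only [dotProduct, Matrix.mulVec, Matrix.neg_apply, Finset.mul_sum, Pi.star_apply,
      RCLike.star_def, Complex.conj_conj, ← Finset.sum_neg_distrib]
    refine Finset.sum_congr rfl fun a _ => Finset.sum_congr rfl fun b _ => ?_
    ring
  have s := hf.isSymmSndFDerivAt (by simp) (star x) (Complex.I • star x)
  have a1 := fderiv_fderiv_nonpos_of_isLocalMax hf h (star x)
  have a2 := fderiv_fderiv_nonpos_of_isLocalMax hf h (Complex.I • star x)
  -- The value of the Levi form on the diagonal is a quarter of the sum of the real second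
  -- derivatives along `star x` and `i • star x`, both nonpositive.
  have e2 : -levi f z (star x) (star x) = ((-(1 / 4) * (fderiv ℝ (fderiv ℝ f) z (star x) (star x) +
      fderiv ℝ (fderiv ℝ f) z (Complex.I • star x) (Complex.I • star x)) : ℝ) : ℂ) := by
    rw [levi, s]
    push_cast
    ring
  rw [e, e2]
  exact Complex.zero_le_real.2 (by linarith)

open scoped MatrixOrder in
-- With `adj A = det A • A⁻¹` and `A⁻¹ = Bᴴ B`, cyclicity of the trace gives `tr(A⁻¹ P) = tr(B P Bᴴ)
-- ≥ 0`.
theorem trace_adjugate_mul_nonneg {A P : Matrix (Fin n) (Fin n) ℂ} (hA : A.PosDef)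
    (hP : P.PosSemidef) : 0 ≤ (A.adjugate * P).trace.re := by
  obtain ⟨B, hB⟩ : ∃ B : Matrix (Fin n) (Fin n) ℂ, A⁻¹ = B.conjTranspose * B :=
    CStarAlgebra.nonneg_iff_eq_star_mul_self.1 hA.inv.posSemidef.nonneg
  have h1 : A.adjugate = A.det • A⁻¹ := by
    rw [Matrix.inv_def, Ring.inverse_eq_inv', smul_smul, mul_inv_cancel₀ hA.det_pos.ne', one_smul]
  have h2 : (A⁻¹ * P).trace = (B * P * B.conjTranspose).trace := by
    rw [hB, Matrix.mul_assoc, Matrix.trace_mul_comm]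
  rw [h1, Matrix.smul_mul, Matrix.trace_smul, h2]
  exact (Complex.nonneg_iff.1
    (mul_nonneg hA.det_pos.le (hP.mul_mul_conjTranspose_same B).trace_nonneg)).1

end Hessian

/-! ### Functions on a complex manifold, in charts -/

section Charts

variable {n : ℕ} {X : Type*} [TopologicalSpace X] [ChartedSpace (Fin n → ℂ) X]

/-- A complex manifold is a smooth real manifold. -/
instance isManifold_real [IsManifold 𝓘(ℂ, Fin n → ℂ) ω X] : IsManifold 𝓘(ℝ, Fin n → ℂ) ∞ X := by
  refine isManifold_of_contDiffOn _ _ _ fun e e' he he' => ?_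
  have h := HasGroupoid.compatible (G := contDiffGroupoid ω 𝓘(ℂ, Fin n → ℂ)) he he'
  rw [contDiffGroupoid, mem_groupoid_of_pregroupoid] at h
  have h1 := h.1
  simp only [contDiffPregroupoid] at h1
  exact (h1.restrict_scalars ℝ).of_le le_top

/-- The complex Hessian of a function on `X` at `x`, in the chart at `p`. -/
def chartHessian (u : X → ℝ) (p x : X) : Matrix (Fin n) (Fin n) ℂ :=
  complexHessian (fun z => u ((chartAt (Fin n → ℂ) p).symm z)) (chartAt (Fin n → ℂ) p x)

/-- The change of coordinates from the chart at `p` to the chart at `q`. -/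
def transition (p q : X) (z : Fin n → ℂ) : Fin n → ℂ :=
  chartAt (Fin n → ℂ) q ((chartAt (Fin n → ℂ) p).symm z)

variable [IsManifold 𝓘(ℂ, Fin n → ℂ) ω X]

theorem contDiffAt_transition {p q x : X} (hp : x ∈ (chartAt (Fin n → ℂ) p).source)
    (hq : x ∈ (chartAt (Fin n → ℂ) q).source) :
    ContDiffAt ℂ ω (transition p q) (chartAt (Fin n → ℂ) p x) := by
  have h := contDiffOn_ext_coord_change (I := 𝓘(ℂ, Fin n → ℂ)) (n := ω) q p
  have hs : ((extChartAt 𝓘(ℂ, Fin n → ℂ) p).symm.trans (extChartAt 𝓘(ℂ, Fin n → ℂ) q)).source =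
      ((chartAt (Fin n → ℂ) p).symm.trans (chartAt (Fin n → ℂ) q)).source := by
    ext z
    simp
  rw [hs] at h
  refine (h.contDiffAt (((chartAt (Fin n → ℂ) p).symm.trans
    (chartAt (Fin n → ℂ) q)).open_source.mem_nhds ?_)).congr_of_eventuallyEq ?_
  · simp [hp, hq]
  · exact Eventually.of_forall fun z => by simp [transition]

omit [IsManifold 𝓘(ℂ, Fin n → ℂ) ω X] in
theorem eventually_symm_mem {p x : X} (hp : x ∈ (chartAt (Fin n → ℂ) p).source) {s : Set X}
    (hs : s ∈ 𝓝 x) : ∀ᶠ z in 𝓝 (chartAt (Fin n → ℂ) p x), (chartAt (Fin n → ℂ) p).symm z ∈ s := by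
  have := (chartAt (Fin n → ℂ) p).continuousAt_symm ((chartAt (Fin n → ℂ) p).map_source hp)
  rw [ContinuousAt, (chartAt (Fin n → ℂ) p).left_inv hp] at this
  exact this hs

omit [IsManifold 𝓘(ℂ, Fin n → ℂ) ω X] in
theorem transition_apply {p q x : X} (hp : x ∈ (chartAt (Fin n → ℂ) p).source) :
    transition p q (chartAt (Fin n → ℂ) p x) = chartAt (Fin n → ℂ) q x := by
  rw [transition, (chartAt (Fin n → ℂ) p).left_inv hp]

omit [IsManifold 𝓘(ℂ, Fin n → ℂ) ω X] in
theorem symm_transition_eventuallyEq {p q x : X} (hp : x ∈ (chartAt (Fin n → ℂ) p).source)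
    (hq : x ∈ (chartAt (Fin n → ℂ) q).source) :
    ∀ᶠ z in 𝓝 (chartAt (Fin n → ℂ) p x),
      (chartAt (Fin n → ℂ) q).symm (transition p q z) = (chartAt (Fin n → ℂ) p).symm z := by
  filter_upwards [eventually_symm_mem hp ((chartAt (Fin n → ℂ) q).open_source.mem_nhds hq)]
    with z hz
  exact (chartAt (Fin n → ℂ) q).left_inv hz

theorem det_conjJacobian_ne_zero {p q x : X} (hp : x ∈ (chartAt (Fin n → ℂ) p).source)
    (hq : x ∈ (chartAt (Fin n → ℂ) q).source) :
    (conjJacobian (transition p q) (chartAt (Fin n → ℂ) p x)).det ≠ 0 := by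
  have h1 : HasFDerivAt (transition p q) (fderiv ℂ (transition p q) (chartAt (Fin n → ℂ) p x))
      (chartAt (Fin n → ℂ) p x) :=
    ((contDiffAt_transition hp hq).differentiableAt (by simp)).hasFDerivAt
  have h2 : HasFDerivAt (transition q p) (fderiv ℂ (transition q p) (chartAt (Fin n → ℂ) q x))
      (transition p q (chartAt (Fin n → ℂ) p x)) := by
    rw [transition_apply hp]
    exact ((contDiffAt_transition hq hp).differentiableAt (by simp)).hasFDerivAt
  have h3 := h2.comp _ h1
  have h4 : transition q p ∘ transition p q =ᶠ[𝓝 (chartAt (Fin n → ℂ) p x)] id := by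
    filter_upwards [symm_transition_eventuallyEq hp hq,
      (chartAt (Fin n → ℂ) p).open_target.mem_nhds ((chartAt (Fin n → ℂ) p).map_source hp)]
      with z hz hz'
    rw [Function.comp_apply, transition, hz, (chartAt (Fin n → ℂ) p).right_inv hz', id]
  have h5 := h3.unique ((hasFDerivAt_id _).congr_of_eventuallyEq h4)
  have h6 : (fderiv ℂ (transition p q) (chartAt (Fin n → ℂ) p x)).det ≠ 0 := fun h0 => by
    have := congrArg ContinuousLinearMap.det h5
    rw [ContinuousLinearMap.det, ContinuousLinearMap.toLinearMap_comp, LinearMap.det_comp] at this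
    rw [ContinuousLinearMap.det] at h0
    rw [h0, mul_zero] at this
    simp [ContinuousLinearMap.det] at this
  rw [← Complex.normSq_pos, normSq_det_conjJacobian, Complex.normSq_pos]
  exact h6

theorem complexHessian_transition {p q x : X} (hp : x ∈ (chartAt (Fin n → ℂ) p).source)
    (hq : x ∈ (chartAt (Fin n → ℂ) q).source) {u : X → ℝ}
    (hu : ContDiffAt ℝ 2 (fun z => u ((chartAt (Fin n → ℂ) q).symm z)) (chartAt (Fin n → ℂ) q x)) :
    chartHessian u p x = (conjJacobian (transition p q) (chartAt (Fin n → ℂ) p x)).conjTranspose *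
      chartHessian u q x * conjJacobian (transition p q) (chartAt (Fin n → ℂ) p x) := by
  have h1 : (fun z => u ((chartAt (Fin n → ℂ) p).symm z)) =ᶠ[𝓝 (chartAt (Fin n → ℂ) p x)]
      fun z => (fun y => u ((chartAt (Fin n → ℂ) q).symm y)) (transition p q z) := by
    filter_upwards [symm_transition_eventuallyEq hp hq] with z hz
    rw [hz]
  have h2 := transition_apply (q := q) hp
  rw [chartHessian, Filter.EventuallyEq.complexHessian_eq h1, complexHessian_comp
    (f := fun y => u ((chartAt (Fin n → ℂ) q).symm y)) (g := transition p q) (by rwa [h2])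
    ((contDiffAt_transition hp hq).of_le le_top), h2]
  rfl

variable {F : Type*} [NormedAddCommGroup F] [NormedSpace ℝ F]

theorem contDiffOn_comp_chart_symm {p : X} {f : X → F} {U : Set X}
    (hf : ContMDiffOn 𝓘(ℝ, Fin n → ℂ) 𝓘(ℝ, F) ∞ f U) :
    ContDiffOn ℝ ∞ (fun z => f ((chartAt (Fin n → ℂ) p).symm z))
      ((chartAt (Fin n → ℂ) p).target ∩ (chartAt (Fin n → ℂ) p).symm ⁻¹' U) := by
  rw [← contMDiffOn_iff_contDiffOn]
  exact hf.comp ((contMDiffOn_chart_symm (I := 𝓘(ℝ, Fin n → ℂ)) (n := ∞)).mono inter_subset_left)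
    fun z hz => hz.2

theorem contDiffOn_comp_chart {p : X} {f : X → F}
    (hf : ContMDiff 𝓘(ℝ, Fin n → ℂ) 𝓘(ℝ, F) ∞ f) :
    ContDiffOn ℝ ∞ (fun z => f ((chartAt (Fin n → ℂ) p).symm z))
      (chartAt (Fin n → ℂ) p).target := by
  simpa using contDiffOn_comp_chart_symm (p := p) hf.contMDiffOn (U := univ)

theorem contDiffAt_comp_chart_symm {p x : X} (hp : x ∈ (chartAt (Fin n → ℂ) p).source) {f : X → F}
    (hf : ContMDiff 𝓘(ℝ, Fin n → ℂ) 𝓘(ℝ, F) ∞ f) :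
    ContDiffAt ℝ ∞ (fun z => f ((chartAt (Fin n → ℂ) p).symm z)) (chartAt (Fin n → ℂ) p x) :=
  (contDiffOn_comp_chart hf).contDiffAt
    ((chartAt (Fin n → ℂ) p).open_target.mem_nhds ((chartAt (Fin n → ℂ) p).map_source hp))

theorem contMDiffAt_of_chart {p x : X} (hp : x ∈ (chartAt (Fin n → ℂ) p).source) {f : X → F}
    {g : (Fin n → ℂ) → F} (hg : ContDiffAt ℝ ∞ g (chartAt (Fin n → ℂ) p x))
    (h : ∀ᶠ y in 𝓝 x, f y = g (chartAt (Fin n → ℂ) p y)) :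
    ContMDiffAt 𝓘(ℝ, Fin n → ℂ) 𝓘(ℝ, F) ∞ f x := by
  have h1 : ContMDiffAt 𝓘(ℝ, Fin n → ℂ) 𝓘(ℝ, Fin n → ℂ) ∞ (chartAt (Fin n → ℂ) p) x :=
    (contMDiffOn_chart (I := 𝓘(ℝ, Fin n → ℂ)) (n := ∞)).contMDiffAt
      ((chartAt (Fin n → ℂ) p).open_source.mem_nhds hp)
  exact (hg.contMDiffAt.comp x h1).congr_of_eventuallyEq h

omit [IsManifold 𝓘(ℂ, Fin n → ℂ) ω X] in
theorem isOpen_target_inter {p : X} {U : Set X} (hU : IsOpen U) :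
    IsOpen ((chartAt (Fin n → ℂ) p).target ∩ (chartAt (Fin n → ℂ) p).symm ⁻¹' U) :=
  (chartAt (Fin n → ℂ) p).symm.isOpen_inter_preimage hU

end Charts

/-! ### The matrix of `ω_h` in charts -/

section Kahler

variable {n : ℕ} {X : Type*} [TopologicalSpace X] [ChartedSpace (Fin n → ℂ) X]
  [IsManifold 𝓘(ℂ, Fin n → ℂ) ω X]
  {L : X → Type*} [∀ x, AddCommGroup (L x)] [∀ x, Module ℂ (L x)]
  [TopologicalSpace (TotalSpace ℂ L)] [∀ x, TopologicalSpace (L x)] [FiberBundle ℂ L]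
  [VectorBundle ℂ ℂ L] [ContMDiffVectorBundle ω ℂ L 𝓘(ℂ, Fin n → ℂ)]

namespace HermitianMetric

/-- The logarithm of the norm squared of the local frame at `p`. -/
def logFrame (h : HermitianMetric n L) (p x : X) : ℝ := Real.log (h.normSq (frame (L := L) p x))

omit [IsManifold 𝓘(ℂ, Fin n → ℂ) ω X] [ContMDiffVectorBundle ω ℂ L 𝓘(ℂ, Fin n → ℂ)] in
theorem contMDiffOn_logFrame (h : HermitianMetric n L) (p : X) :
    ContMDiffOn 𝓘(ℝ, Fin n → ℂ) 𝓘(ℝ, ℝ) ∞ (h.logFrame p) (trivializationAt ℂ L p).baseSet := by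
  intro x hx
  have h1 := ((h.smooth p).contMDiffAt ((trivializationAt ℂ L p).open_baseSet.mem_nhds hx))
  have h2 : h.normSq (frame (L := L) p x) ≠ 0 := (h.normSq_pos (frame_ne_zero hx)).ne'
  exact (ContMDiffAt.comp x ((Real.contDiffAt_log.2 h2).contMDiffAt (n := ∞)) h1).contMDiffWithinAt

omit [ContMDiffVectorBundle ω ℂ L 𝓘(ℂ, Fin n → ℂ)] in
theorem contDiffOn_logFrame_chart (h : HermitianMetric n L) (p q : X) :
    ContDiffOn ℝ ∞ (fun z => h.logFrame q ((chartAt (Fin n → ℂ) p).symm z))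
      ((chartAt (Fin n → ℂ) p).target ∩
        (chartAt (Fin n → ℂ) p).symm ⁻¹' (trivializationAt ℂ L q).baseSet) :=
  contDiffOn_comp_chart_symm (h.contMDiffOn_logFrame q)

omit [ContMDiffVectorBundle ω ℂ L 𝓘(ℂ, Fin n → ℂ)] in
theorem contDiffAt_logFrame_chart (h : HermitianMetric n L) {p q x : X}
    (hp : x ∈ (chartAt (Fin n → ℂ) p).source) (hq : x ∈ (trivializationAt ℂ L q).baseSet) :
    ContDiffAt ℝ ∞ (fun z => h.logFrame q ((chartAt (Fin n → ℂ) p).symm z))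
      (chartAt (Fin n → ℂ) p x) := by
  refine (h.contDiffOn_logFrame_chart p q).contDiffAt
    ((isOpen_target_inter (trivializationAt ℂ L q).open_baseSet).mem_nhds
      ⟨(chartAt (Fin n → ℂ) p).map_source hp, ?_⟩)
  rwa [mem_preimage, (chartAt (Fin n → ℂ) p).left_inv hp]

end HermitianMetric

omit [IsManifold 𝓘(ℂ, Fin n → ℂ) ω X] in
theorem contMDiffAt_coord_frame {p q x : X} (hp : x ∈ (trivializationAt ℂ L p).baseSet)
    (hq : x ∈ (trivializationAt ℂ L q).baseSet) :
    ContMDiffAt 𝓘(ℂ, Fin n → ℂ) 𝓘(ℂ, ℂ) ω (fun y => coord q (frame (L := L) p y)) x := by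
  have h1 := (contMDiffOn_coordChangeL (n := ω) (IB := 𝓘(ℂ, Fin n → ℂ))
    (trivializationAt ℂ L p) (trivializationAt ℂ L q)).contMDiffAt
    (((trivializationAt ℂ L p).open_baseSet.inter
      (trivializationAt ℂ L q).open_baseSet).mem_nhds ⟨hp, hq⟩)
  have h2 : ContMDiffAt 𝓘(ℂ, Fin n → ℂ) 𝓘(ℂ, ℂ) ω (fun y => ((trivializationAt ℂ L p).coordChangeL ℂ
      (trivializationAt ℂ L q) y : ℂ →L[ℂ] ℂ) 1) x := h1.clm_apply contMDiffAt_const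
  refine h2.congr_of_eventuallyEq ?_
  filter_upwards [(trivializationAt ℂ L p).open_baseSet.mem_nhds hp,
    (trivializationAt ℂ L q).open_baseSet.mem_nhds hq] with y hy hy'
  exact ((trivializationAt ℂ L p).coordChangeL_apply (R := ℂ) (trivializationAt ℂ L q)
    ⟨hy, hy'⟩ 1).symm

namespace HermitianMetric

/-- `kahlerMatrix` uses at each point the frame attached to that point. Another frame differs by a
nonvanishing holomorphic factor `g`, which only adds the pluriharmonic `log |g|²`. So one fixed
frame serves a whole neighbourhood, which gives smoothness of the entries and a local potential. -/
theorem kahlerMatrix_eq (h : HermitianMetric n L) {p q x : X}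
    (hp : x ∈ (chartAt (Fin n → ℂ) p).source) (hq : x ∈ (trivializationAt ℂ L q).baseSet) :
    h.kahlerMatrix (chartAt (Fin n → ℂ) p) x = -chartHessian (h.logFrame q) p x := by
  have hx := FiberBundle.mem_baseSet_trivializationAt' (F := ℂ) (E := L) x
  set g : (Fin n → ℂ) → ℂ := fun z =>
    coord q (frame (L := L) x ((chartAt (Fin n → ℂ) p).symm z)) with hg
  have hgd : ContDiffAt ℂ ω g (chartAt (Fin n → ℂ) p x) := by
    rw [← contMDiffAt_iff_contDiffAt]
    have h1 : ContMDiffAt 𝓘(ℂ, Fin n → ℂ) 𝓘(ℂ, ℂ) ω (fun y => coord q (frame (L := L) x y))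
        ((chartAt (Fin n → ℂ) p).symm (chartAt (Fin n → ℂ) p x)) := by
      rw [(chartAt (Fin n → ℂ) p).left_inv hp]
      exact contMDiffAt_coord_frame hx hq
    exact h1.comp _ ((contMDiffOn_chart_symm (I := 𝓘(ℂ, Fin n → ℂ)) (n := ω)).contMDiffAt
      ((chartAt (Fin n → ℂ) p).open_target.mem_nhds ((chartAt (Fin n → ℂ) p).map_source hp)))
  have hne : ∀ y ∈ (trivializationAt ℂ L x).baseSet ∩ (trivializationAt ℂ L q).baseSet,
      coord q (frame (L := L) x y) ≠ 0 := fun y hy h0 => by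
    have := eq_coord_smul_frame hy.2 (frame (L := L) x y)
    rw [h0, zero_smul] at this
    exact frame_ne_zero hy.1 this
  have hg0 : g (chartAt (Fin n → ℂ) p x) ≠ 0 := by
    refine hne _ ?_
    rw [(chartAt (Fin n → ℂ) p).left_inv hp]
    exact ⟨hx, hq⟩
  have e : (fun z => Real.log (h.normSq (frame (L := L) x ((chartAt (Fin n → ℂ) p).symm z))))
      =ᶠ[𝓝 (chartAt (Fin n → ℂ) p x)] fun z =>
        h.logFrame q ((chartAt (Fin n → ℂ) p).symm z) + Real.log (‖g z‖ ^ 2) := by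
    filter_upwards [eventually_symm_mem hp (((trivializationAt ℂ L x).open_baseSet.inter
      (trivializationAt ℂ L q).open_baseSet).mem_nhds ⟨hx, hq⟩)] with z hz
    have h1 := hne _ hz
    rw [eq_coord_smul_frame hz.2 (frame (L := L) x ((chartAt (Fin n → ℂ) p).symm z)), normSq_smul,
      Real.log_mul (by positivity) (h.normSq_pos (frame_ne_zero hz.2)).ne', add_comm]
    rfl
  have hlog : ContDiffAt ℝ 2 (fun z => Real.log (‖g z‖ ^ 2)) (chartAt (Fin n → ℂ) p x) := by
    have h1 : ContDiffAt ℝ 2 (fun z => ‖g z‖ ^ 2) (chartAt (Fin n → ℂ) p x) :=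
      ((hgd.restrict_scalars ℝ).of_le le_top).norm_sq ℝ
    exact h1.log (by positivity)
  have hz : complexHessian (fun z => Real.log (‖g z‖ ^ 2)) (chartAt (Fin n → ℂ) p x) = 0 := by
    ext j k
    rw [complexHessian_eq_levi, levi_log_normSq (hgd.of_le le_top) hg0]
    rfl
  rw [kahlerMatrix, Filter.EventuallyEq.complexHessian_eq e,
    complexHessian_add ((h.contDiffAt_logFrame_chart hp hq).of_le two_le_infty) hlog, hz, add_zero]
  rfl

theorem kahlerMatrix_isHermitian (h : HermitianMetric n L) {p x : X}
    (hp : x ∈ (chartAt (Fin n → ℂ) p).source) :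
    (h.kahlerMatrix (chartAt (Fin n → ℂ) p) x).IsHermitian := by
  have hx := FiberBundle.mem_baseSet_trivializationAt' (F := ℂ) (E := L) x
  rw [h.kahlerMatrix_eq hp hx]
  exact (complexHessian_isHermitian
    ((h.contDiffAt_logFrame_chart hp hx).of_le two_le_infty)).neg

theorem kahlerMatrix_transition (h : HermitianMetric n L) {p q x : X}
    (hp : x ∈ (chartAt (Fin n → ℂ) p).source) (hq : x ∈ (chartAt (Fin n → ℂ) q).source) :
    h.kahlerMatrix (chartAt (Fin n → ℂ) p) x =
      (conjJacobian (transition p q) (chartAt (Fin n → ℂ) p x)).conjTranspose *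
      h.kahlerMatrix (chartAt (Fin n → ℂ) q) x *
      conjJacobian (transition p q) (chartAt (Fin n → ℂ) p x) := by
  have hx := FiberBundle.mem_baseSet_trivializationAt' (F := ℂ) (E := L) x
  rw [h.kahlerMatrix_eq hp hx, h.kahlerMatrix_eq hq hx, complexHessian_transition hp hq
    ((h.contDiffAt_logFrame_chart hq hx).of_le two_le_infty), Matrix.mul_neg, Matrix.neg_mul]

/-- The factor is the absolute Jacobian of the transition as a real map, so the local volumes agree
on overlaps. -/
theorem det_kahlerMatrix_transition (h : HermitianMetric n L) {p q x : X}
    (hp : x ∈ (chartAt (Fin n → ℂ) p).source) (hq : x ∈ (chartAt (Fin n → ℂ) q).source) :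
    (h.kahlerMatrix (chartAt (Fin n → ℂ) p) x).det.re =
      Complex.normSq (fderiv ℂ (transition p q) (chartAt (Fin n → ℂ) p x)).det *
      (h.kahlerMatrix (chartAt (Fin n → ℂ) q) x).det.re := by
  rw [h.kahlerMatrix_transition hp hq, det_conjTranspose_mul_mul, Complex.re_ofReal_mul,
    normSq_det_conjJacobian]

theorem kahlerMatrix_posDef (h : HermitianMetric n L) {p q x : X}
    (hp : x ∈ (chartAt (Fin n → ℂ) p).source) (hq : x ∈ (chartAt (Fin n → ℂ) q).source)
    (hh : (h.kahlerMatrix (chartAt (Fin n → ℂ) q) x).PosDef) :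
    (h.kahlerMatrix (chartAt (Fin n → ℂ) p) x).PosDef := by
  rw [h.kahlerMatrix_transition hp hq]
  exact hh.conjTranspose_mul_mul_same (Matrix.mulVec_injective_of_isUnit
    ((Matrix.isUnit_iff_isUnit_det _).2 (det_conjJacobian_ne_zero hp hq).isUnit))

theorem IsPositive.posDef {h : HermitianMetric n L} (hh : h.IsPositive) {p x : X}
    (hp : x ∈ (chartAt (Fin n → ℂ) p).source) :
    (h.kahlerMatrix (chartAt (Fin n → ℂ) p) x).PosDef :=
  h.kahlerMatrix_posDef hp (mem_chart_source _ x) (hh x)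

theorem IsPositive.det_pos {h : HermitianMetric n L} (hh : h.IsPositive) {p x : X}
    (hp : x ∈ (chartAt (Fin n → ℂ) p).source) :
    0 < (h.kahlerMatrix (chartAt (Fin n → ℂ) p) x).det.re :=
  (Complex.pos_iff.1 (hh.posDef hp).det_pos).1

omit [IsManifold 𝓘(ℂ, Fin n → ℂ) ω X] [ContMDiffVectorBundle ω ℂ L 𝓘(ℂ, Fin n → ℂ)] in
omit [VectorBundle ℂ ℂ L] in
theorem normSq_expMul (φ : SmoothFn n X) (h : HermitianMetric n L) {x : X} (v : L x) :
    (expMul φ h).normSq v = Real.exp (φ x) * h.normSq v := Complex.re_ofReal_mul _ _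

omit [IsManifold 𝓘(ℂ, Fin n → ℂ) ω X] [ContMDiffVectorBundle ω ℂ L 𝓘(ℂ, Fin n → ℂ)] in
theorem logFrame_expMul (φ : SmoothFn n X) (h : HermitianMetric n L) {p x : X}
    (hp : x ∈ (trivializationAt ℂ L p).baseSet) :
    (expMul φ h).logFrame p x = h.logFrame p x + φ x := by
  rw [logFrame, normSq_expMul, Real.log_mul (Real.exp_pos _).ne'
    (h.normSq_pos (frame_ne_zero hp)).ne', Real.log_exp, add_comm]
  rfl

/-- The logarithm of the norm of a frame gains the summand `φ`, so the matrix is affine in `φ`.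
Convexity of `𝒦` and the linearization of the volume both come from this. -/
theorem kahlerMatrix_expMul (φ : SmoothFn n X) (h : HermitianMetric n L) {p x : X}
    (hp : x ∈ (chartAt (Fin n → ℂ) p).source) :
    (expMul φ h).kahlerMatrix (chartAt (Fin n → ℂ) p) x =
      h.kahlerMatrix (chartAt (Fin n → ℂ) p) x - chartHessian φ p x := by
  have hx := FiberBundle.mem_baseSet_trivializationAt' (F := ℂ) (E := L) x
  have e : (fun z => (expMul φ h).logFrame x ((chartAt (Fin n → ℂ) p).symm z))
      =ᶠ[𝓝 (chartAt (Fin n → ℂ) p x)] fun z => h.logFrame x ((chartAt (Fin n → ℂ) p).symm z) +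
        φ ((chartAt (Fin n → ℂ) p).symm z) := by
    filter_upwards [eventually_symm_mem hp ((trivializationAt ℂ L x).open_baseSet.mem_nhds hx)]
      with z hz
    exact logFrame_expMul φ h hz
  rw [kahlerMatrix_eq _ hp hx, kahlerMatrix_eq _ hp hx, chartHessian,
    Filter.EventuallyEq.complexHessian_eq e,
    complexHessian_add ((h.contDiffAt_logFrame_chart hp hx).of_le two_le_infty)
      ((contDiffAt_comp_chart_symm hp φ.contMDiff).of_le two_le_infty), neg_add']
  rfl

theorem contDiffOn_kahlerMatrix (h : HermitianMetric n L) (p : X) (j k : Fin n) :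
    ContDiffOn ℝ ∞ (fun z => h.kahlerMatrix (chartAt (Fin n → ℂ) p)
      ((chartAt (Fin n → ℂ) p).symm z) j k) (chartAt (Fin n → ℂ) p).target := by
  intro z hz
  set x := (chartAt (Fin n → ℂ) p).symm z with hx'
  have hx := FiberBundle.mem_baseSet_trivializationAt' (F := ℂ) (E := L) x
  have ho := isOpen_target_inter (p := p) (n := n) (trivializationAt ℂ L x).open_baseSet
  have hm : z ∈ (chartAt (Fin n → ℂ) p).target ∩
      (chartAt (Fin n → ℂ) p).symm ⁻¹' (trivializationAt ℂ L x).baseSet := ⟨hz, hx⟩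
  have h1 := (contDiffOn_complexHessian ho (h.contDiffOn_logFrame_chart p x) j k).neg
  refine ((h1.congr fun y hy => ?_).contDiffAt (ho.mem_nhds hm)).contDiffWithinAt
  rw [h.kahlerMatrix_eq ((chartAt (Fin n → ℂ) p).map_target hy.1) hy.2, Matrix.neg_apply,
    chartHessian, (chartAt (Fin n → ℂ) p).right_inv hy.1]

end HermitianMetric

end Kahler

/-! ### The volume measure, its independence of charts, and the ratio of two volume forms. -/

section Volume

variable {n : ℕ} {X : Type*} [TopologicalSpace X] [ChartedSpace (Fin n → ℂ) X]
  [IsManifold 𝓘(ℂ, Fin n → ℂ) ω X]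
  {L : X → Type*} [∀ x, AddCommGroup (L x)] [∀ x, Module ℂ (L x)]
  [TopologicalSpace (TotalSpace ℂ L)] [∀ x, TopologicalSpace (L x)] [FiberBundle ℂ L]
  [VectorBundle ℂ ℂ L] [ContMDiffVectorBundle ω ℂ L 𝓘(ℂ, Fin n → ℂ)]

namespace HermitianMetric

/-- The density of the measure of `h` with respect to Lebesgue measure, in the chart at `p`. -/
def density (h : HermitianMetric n L) (p : X) (z : Fin n → ℂ) : ℝ :=
  2 ^ n * (h.kahlerMatrix (chartAt (Fin n → ℂ) p) ((chartAt (Fin n → ℂ) p).symm z)).det.re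

theorem contDiffOn_density (h : HermitianMetric n L) (p : X) :
    ContDiffOn ℝ ∞ (h.density p) (chartAt (Fin n → ℂ) p).target :=
  contDiffOn_const.mul (Complex.reCLM.contDiff.comp_contDiffOn
    (contDiffOn_det (h.contDiffOn_kahlerMatrix p)))

theorem IsPositive.density_pos {h : HermitianMetric n L} (hh : h.IsPositive) {p : X}
    {z : Fin n → ℂ} (hz : z ∈ (chartAt (Fin n → ℂ) p).target) : 0 < h.density p z :=
  mul_pos (by positivity) (hh.det_pos ((chartAt (Fin n → ℂ) p).map_target hz))

/-- The ratio of the volume forms of `e^φ h` and `h`. -/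
def volRatio (h : HermitianMetric n L) (φ : SmoothFn n X) (x : X) : ℝ :=
  ((expMul φ h).kahlerMatrix (chartAt (Fin n → ℂ) x) x).det.re /
    (h.kahlerMatrix (chartAt (Fin n → ℂ) x) x).det.re

/-- Both determinants acquire the same Jacobian factor under a change of chart, and it cancels in
the quotient. -/
theorem volRatio_eq (h : HermitianMetric n L) (φ : SmoothFn n X) {p x : X}
    (hp : x ∈ (chartAt (Fin n → ℂ) p).source) :
    h.volRatio φ x = ((expMul φ h).kahlerMatrix (chartAt (Fin n → ℂ) p) x).det.re /
      (h.kahlerMatrix (chartAt (Fin n → ℂ) p) x).det.re := by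
  have hx := mem_chart_source (Fin n → ℂ) x
  rw [volRatio, det_kahlerMatrix_transition _ hx hp, det_kahlerMatrix_transition h hx hp,
    mul_div_mul_left]
  rw [← normSq_det_conjJacobian]
  exact (Complex.normSq_pos.2 (det_conjJacobian_ne_zero hx hp)).ne'

theorem IsPositive.volRatio_pos {h : HermitianMetric n L} (hh : h.IsPositive) {φ : SmoothFn n X}
    (hφ : (expMul φ h).IsPositive) (x : X) : 0 < h.volRatio φ x :=
  div_pos (hφ.det_pos (mem_chart_source _ x)) (hh.det_pos (mem_chart_source _ x))

theorem density_expMul {h : HermitianMetric n L} (hh : h.IsPositive) (φ : SmoothFn n X) {p : X}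
    {z : Fin n → ℂ} (hz : z ∈ (chartAt (Fin n → ℂ) p).target) :
    (expMul φ h).density p z =
      h.density p z * h.volRatio φ ((chartAt (Fin n → ℂ) p).symm z) := by
  have hs := (chartAt (Fin n → ℂ) p).map_target hz
  rw [h.volRatio_eq φ hs, density, density, mul_assoc, mul_div_cancel₀ _ (hh.det_pos hs).ne']

theorem contMDiff_volRatio {h : HermitianMetric n L} (hh : h.IsPositive) (φ : SmoothFn n X) :
    ContMDiff 𝓘(ℝ, Fin n → ℂ) 𝓘(ℝ, ℝ) ∞ (h.volRatio φ) := by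
  intro x
  have hx := mem_chart_source (Fin n → ℂ) x
  have ho := (chartAt (Fin n → ℂ) x).open_target.mem_nhds
    ((chartAt (Fin n → ℂ) x).map_source hx)
  have h0 : h.density x (chartAt (Fin n → ℂ) x x) ≠ 0 :=
    (hh.density_pos ((chartAt (Fin n → ℂ) x).map_source hx)).ne'
  refine contMDiffAt_of_chart hx (g := fun z => (expMul φ h).density x z / h.density x z)
    ((((expMul φ h).contDiffOn_density x).contDiffAt ho).div
      ((h.contDiffOn_density x).contDiffAt ho) h0) ?_
  filter_upwards [(chartAt (Fin n → ℂ) x).open_source.mem_nhds hx] with y hy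
  have hy' := (chartAt (Fin n → ℂ) x).map_source hy
  rw [density_expMul hh φ hy', (chartAt (Fin n → ℂ) x).left_inv hy,
    mul_div_cancel_left₀ _ (hh.density_pos hy').ne']

variable [MeasurableSpace X] [BorelSpace X]

omit [IsManifold 𝓘(ℂ, Fin n → ℂ) ω X] in
theorem aemeasurable_chart_symm (p : X) (ν : Measure (Fin n → ℂ)) :
    AEMeasurable (chartAt (Fin n → ℂ) p).symm (ν.restrict (chartAt (Fin n → ℂ) p).target) :=
  (chartAt (Fin n → ℂ) p).continuousOn_symm.aemeasurable
    (chartAt (Fin n → ℂ) p).open_target.measurableSet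

omit [IsManifold 𝓘(ℂ, Fin n → ℂ) ω X] in
theorem measurableSet_target_inter (p : X) {A : Set X} (hA : MeasurableSet A) :
    MeasurableSet ((chartAt (Fin n → ℂ) p).target ∩ (chartAt (Fin n → ℂ) p).symm ⁻¹' A) := by
  have h1 := (continuousOn_iff_continuous_domRestrict.1
    (chartAt (Fin n → ℂ) p).continuousOn_symm).measurable hA
  have h2 := MeasurableSet.subtype_image (chartAt (Fin n → ℂ) p).open_target.measurableSet h1
  convert h2 using 1
  ext z
  simp [and_comm]

omit [IsManifold 𝓘(ℂ, Fin n → ℂ) ω X] [VectorBundle ℂ ℂ L]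
  [ContMDiffVectorBundle ω ℂ L 𝓘(ℂ, Fin n → ℂ)] [BorelSpace X] in
theorem localVolume_eq (h : HermitianMetric n L) (p : X) :
    h.localVolume (chartAt (Fin n → ℂ) p) = Measure.map (chartAt (Fin n → ℂ) p).symm
      ((volume.restrict (chartAt (Fin n → ℂ) p).target).withDensity
        fun z => ENNReal.ofReal (h.density p z)) := rfl

omit [MeasurableSpace X] [BorelSpace X] in
theorem aemeasurable_density (h : HermitianMetric n L) (p : X) :
    AEMeasurable (fun z => ENNReal.ofReal (h.density p z))
      (volume.restrict (chartAt (Fin n → ℂ) p).target) :=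
  ((h.contDiffOn_density p).continuousOn.aemeasurable
    (chartAt (Fin n → ℂ) p).open_target.measurableSet).ennreal_ofReal

theorem lintegral_localVolume (h : HermitianMetric n L) (p : X) {g : X → ENNReal}
    (hg : Measurable g) : ∫⁻ x, g x ∂h.localVolume (chartAt (Fin n → ℂ) p) =
      ∫⁻ z in (chartAt (Fin n → ℂ) p).target,
        ENNReal.ofReal (h.density p z) * g ((chartAt (Fin n → ℂ) p).symm z) := by
  rw [localVolume_eq, lintegral_map' hg.aemeasurable
    ((aemeasurable_chart_symm p _).mono_ac (withDensity_absolutelyContinuous _ _)),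
    lintegral_withDensity_eq_lintegral_mul₀ (g := fun z => g ((chartAt (Fin n → ℂ) p).symm z))
      (h.aemeasurable_density p) (hg.comp_aemeasurable (aemeasurable_chart_symm p _))]
  rfl

theorem localVolume_apply (h : HermitianMetric n L) (p : X) {A : Set X} (hA : MeasurableSet A) :
    h.localVolume (chartAt (Fin n → ℂ) p) A =
      ∫⁻ z in (chartAt (Fin n → ℂ) p).target ∩ (chartAt (Fin n → ℂ) p).symm ⁻¹' A,
        ENNReal.ofReal (h.density p z) := by
  rw [← lintegral_indicator_one hA, h.lintegral_localVolume p (measurable_one.indicator hA),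
    ← lintegral_indicator (chartAt (Fin n → ℂ) p).open_target.measurableSet,
    ← lintegral_indicator (measurableSet_target_inter p hA)]
  refine lintegral_congr fun z => ?_
  by_cases hz : z ∈ (chartAt (Fin n → ℂ) p).target
  · by_cases hz' : (chartAt (Fin n → ℂ) p).symm z ∈ A
    · rw [indicator_of_mem hz, indicator_of_mem hz', indicator_of_mem (show z ∈ _ ∩ _ from ⟨hz, hz'⟩)]
      simp
    · rw [indicator_of_mem hz, indicator_of_notMem hz', indicator_of_notMem (fun h => hz' h.2 :
        z ∉ _ ∩ (chartAt (Fin n → ℂ) p).symm ⁻¹' A),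
        mul_zero]
  · rw [indicator_of_notMem hz, indicator_of_notMem (fun h => hz h.1 :
      z ∉ (chartAt (Fin n → ℂ) p).target ∩ _)]

theorem localVolume_compl_source (h : HermitianMetric n L) (p : X) :
    h.localVolume (chartAt (Fin n → ℂ) p) (chartAt (Fin n → ℂ) p).sourceᶜ = 0 := by
  rw [h.localVolume_apply p (chartAt (Fin n → ℂ) p).open_source.measurableSet.compl]
  have : (chartAt (Fin n → ℂ) p).target ∩
      (chartAt (Fin n → ℂ) p).symm ⁻¹' (chartAt (Fin n → ℂ) p).sourceᶜ = ∅ := by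
    ext z
    simp only [mem_inter_iff, mem_preimage, mem_compl_iff, mem_empty_iff_false, iff_false,
      not_and, not_not]
    exact fun hz => (chartAt (Fin n → ℂ) p).map_target hz
  rw [this]
  simp

/-- The volume does not depend on the chart. -/
theorem localVolume_eq_of_subset (h : HermitianMetric n L) {p q : X} {A : Set X}
    (hA : MeasurableSet A) (hp : A ⊆ (chartAt (Fin n → ℂ) p).source)
    (hq : A ⊆ (chartAt (Fin n → ℂ) q).source) :
    h.localVolume (chartAt (Fin n → ℂ) q) A = h.localVolume (chartAt (Fin n → ℂ) p) A := by
  rw [h.localVolume_apply p hA, h.localVolume_apply q hA]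
  set S := (chartAt (Fin n → ℂ) p).target ∩ (chartAt (Fin n → ℂ) p).symm ⁻¹' A with hS
  have himg : (chartAt (Fin n → ℂ) q).target ∩ (chartAt (Fin n → ℂ) q).symm ⁻¹' A =
      transition p q '' S := by
    ext w
    constructor
    · rintro ⟨hw, hwA⟩
      refine ⟨chartAt (Fin n → ℂ) p ((chartAt (Fin n → ℂ) q).symm w),
        ⟨(chartAt (Fin n → ℂ) p).map_source (hp hwA), ?_⟩, ?_⟩
      · rw [mem_preimage, (chartAt (Fin n → ℂ) p).left_inv (hp hwA)]
        exact hwA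
      · rw [transition, (chartAt (Fin n → ℂ) p).left_inv (hp hwA),
          (chartAt (Fin n → ℂ) q).right_inv hw]
    · rintro ⟨z, ⟨hz, hzA⟩, rfl⟩
      refine ⟨(chartAt (Fin n → ℂ) q).map_source (hq hzA), ?_⟩
      rw [mem_preimage, transition, (chartAt (Fin n → ℂ) q).left_inv (hq hzA)]
      exact hzA
  have hpt : ∀ z ∈ S, chartAt (Fin n → ℂ) p ((chartAt (Fin n → ℂ) p).symm z) = z :=
    fun z hz => (chartAt (Fin n → ℂ) p).right_inv hz.1
  have hd : ∀ z ∈ S, HasFDerivWithinAt (transition p q)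
      ((fderiv ℂ (transition p q) z).restrictScalars ℝ) S z := fun z hz => by
    have := contDiffAt_transition (n := n) (hp hz.2) (hq hz.2)
    rw [hpt z hz] at this
    exact ((this.differentiableAt (by simp)).hasFDerivAt.restrictScalars ℝ).hasFDerivWithinAt
  have hinj : InjOn (transition p q) S := fun z hz w hw hzw => by
    have h1 := congrArg (chartAt (Fin n → ℂ) q).symm hzw
    rw [transition, transition, (chartAt (Fin n → ℂ) q).left_inv (hq hz.2),
      (chartAt (Fin n → ℂ) q).left_inv (hq hw.2)] at h1
    rw [← hpt z hz, ← hpt w hw, h1]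
  -- In the change of variables the real Jacobian is `|det|²` of the complex derivative, exactly the
  -- factor relating the two densities.
  rw [himg, lintegral_image_eq_lintegral_abs_det_fderiv_mul volume
    (measurableSet_target_inter p hA) hd hinj]
  refine setLIntegral_congr_fun (measurableSet_target_inter p hA) fun z hz => ?_
  have h1 := h.det_kahlerMatrix_transition (hp hz.2) (hq hz.2)
  rw [hpt z hz] at h1
  rw [abs_det_restrictScalars, ← ENNReal.ofReal_mul (Complex.normSq_nonneg _), density, density, h1,
    transition, (chartAt (Fin n → ℂ) q).left_inv (hq hz.2)]
  congr 1
  ring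

/-- `vol` is the least upper bound of the local volumes, so it suffices to exhibit an upper bound
with the right value on `A`. The local volume at `p` plus the restriction of `vol` to the complement
of its chart domain is one, because local volumes agree on overlaps. -/
theorem vol_apply (h : HermitianMetric n L) {p : X} {A : Set X} (hA : MeasurableSet A)
    (hp : A ⊆ (chartAt (Fin n → ℂ) p).source) :
    h.vol A = h.localVolume (chartAt (Fin n → ℂ) p) A := by
  set S := (chartAt (Fin n → ℂ) p).source with hS
  have hSm : MeasurableSet S := (chartAt (Fin n → ℂ) p).open_source.measurableSet
  refine le_antisymm ?_ (le_iSup (fun q : X => h.localVolume (chartAt (Fin n → ℂ) q)) p A)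
  have hle : h.vol ≤ h.localVolume (chartAt (Fin n → ℂ) p) + h.vol.restrict Sᶜ := by
    refine iSup_le fun q => Measure.le_iff.2 fun B hB => ?_
    rw [Measure.add_apply, Measure.restrict_apply hB, ← measure_inter_add_sdiff B hSm]
    refine add_le_add ?_ ?_
    · set T := (chartAt (Fin n → ℂ) q).source with hT
      have hTm : MeasurableSet T := (chartAt (Fin n → ℂ) q).open_source.measurableSet
      rw [← measure_inter_add_sdiff (B ∩ S) hTm, measure_mono_null
        (fun x hx => hx.2 : (B ∩ S) \ T ⊆ Tᶜ) (h.localVolume_compl_source q), add_zero,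
        h.localVolume_eq_of_subset ((hB.inter hSm).inter hTm) (fun x hx => hx.1.2)
          (fun x hx => hx.2)]
      exact measure_mono fun x hx => hx.1.1
    · exact le_iSup (fun q : X => h.localVolume (chartAt (Fin n → ℂ) q)) q (B \ S)
  refine (hle A).trans ?_
  rw [Measure.add_apply, Measure.restrict_apply hA]
  have : A ∩ Sᶜ = ∅ := by
    ext x
    simp only [mem_inter_iff, mem_compl_iff, mem_empty_iff_false, iff_false, not_and, not_not]
    exact fun hx => hp hx
  rw [this, measure_empty, add_zero]

theorem vol_restrict_source (h : HermitianMetric n L) (p : X) :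
    h.vol.restrict (chartAt (Fin n → ℂ) p).source = h.localVolume (chartAt (Fin n → ℂ) p) := by
  have hSm : MeasurableSet (chartAt (Fin n → ℂ) p).source :=
    (chartAt (Fin n → ℂ) p).open_source.measurableSet
  ext A hA
  rw [Measure.restrict_apply hA, h.vol_apply (hA.inter hSm) inter_subset_right,
    ← measure_inter_add_sdiff A hSm, measure_mono_null
      (fun x hx => hx.2 : A \ (chartAt (Fin n → ℂ) p).source ⊆ _) (h.localVolume_compl_source p),
    add_zero]

theorem setIntegral_vol {F : Type*} [NormedAddCommGroup F] [NormedSpace ℝ F]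
    [SecondCountableTopology F]
    {h : HermitianMetric n L} (hh : h.IsPositive) (p : X)
    {f : X → F} (hf : Continuous f) : ∫ x in (chartAt (Fin n → ℂ) p).source, f x ∂h.vol =
      ∫ z in (chartAt (Fin n → ℂ) p).target,
        h.density p z • f ((chartAt (Fin n → ℂ) p).symm z) := by
  borelize F
  rw [h.vol_restrict_source p, localVolume_eq, integral_map
    ((aemeasurable_chart_symm p _).mono_ac (withDensity_absolutelyContinuous _ _))
    hf.aestronglyMeasurable, integral_withDensity_eq_integral_toReal_smul₀
    (h.aemeasurable_density p) (ae_of_all _ fun z => ENNReal.ofReal_lt_top)]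
  refine setIntegral_congr_fun (chartAt (Fin n → ℂ) p).open_target.measurableSet fun z hz => ?_
  rw [ENNReal.toReal_ofReal (hh.density_pos hz).le]

instance isLocallyFiniteMeasure_vol (h : HermitianMetric n L) : IsLocallyFiniteMeasure h.vol := by
  refine ⟨fun x => ?_⟩
  set c := chartAt (Fin n → ℂ) x with hc
  have hx : x ∈ c.source := mem_chart_source _ x
  obtain ⟨K, hK, hKx, hKt⟩ : ∃ K, IsCompact K ∧ K ∈ 𝓝 (c x) ∧ K ⊆ c.target := by
    obtain ⟨K, h1, h2, h3⟩ := local_compact_nhds (c.open_target.mem_nhds (c.map_source hx))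
    exact ⟨K, h3, h1, h2⟩
  have hs : c.source ∩ c ⁻¹' (interior K) ∈ 𝓝 x :=
    (c.isOpen_inter_preimage isOpen_interior).mem_nhds ⟨hx, mem_interior_iff_mem_nhds.2 hKx⟩
  refine ⟨_, hs, ?_⟩
  have hm : MeasurableSet (c.source ∩ c ⁻¹' (interior K)) :=
    (c.isOpen_inter_preimage isOpen_interior).measurableSet
  rw [h.vol_apply (p := x) hm inter_subset_left, h.localVolume_apply x hm]
  obtain ⟨C, hC⟩ := hK.exists_bound_of_continuousOn ((h.contDiffOn_density x).continuousOn.mono hKt)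
  calc _ ≤ ∫⁻ z in K, ENNReal.ofReal (h.density x z) := by
        refine lintegral_mono_set fun z hz => ?_
        have := interior_subset hz.2.2
        rwa [c.right_inv hz.1] at this
    _ ≤ ∫⁻ z in K, ENNReal.ofReal C := by
        refine setLIntegral_mono measurable_const fun z hz => ENNReal.ofReal_le_ofReal ?_
        exact (le_abs_self _).trans (hC z hz)
    _ < ⊤ := by
        rw [setLIntegral_const]
        exact ENNReal.mul_lt_top ENNReal.ofReal_lt_top hK.measure_lt_top

theorem IsPositive.isOpenPosMeasure {h : HermitianMetric n L} (hh : h.IsPositive) :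
    h.vol.IsOpenPosMeasure := by
  refine ⟨fun U hU hne h0 => ?_⟩
  obtain ⟨x, hxU⟩ := hne
  set c := chartAt (Fin n → ℂ) x with hc
  have hx : x ∈ c.source := mem_chart_source _ x
  have h1 : h.vol (U ∩ c.source) = 0 := measure_mono_null inter_subset_left h0
  have hm : MeasurableSet (U ∩ c.source) := (hU.inter c.open_source).measurableSet
  rw [h.vol_apply (p := x) hm inter_subset_right, h.localVolume_apply x hm,
    lintegral_eq_zero_iff' ((h.aemeasurable_density x).mono_measure
      (Measure.restrict_mono inter_subset_left le_rfl))] at h1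
  have ho : IsOpen (c.target ∩ c.symm ⁻¹' (U ∩ c.source)) :=
    isOpen_target_inter (hU.inter c.open_source)
  have h2 : ∀ᵐ z ∂(volume.restrict (c.target ∩ c.symm ⁻¹' (U ∩ c.source))), False := by
    filter_upwards [h1, ae_restrict_mem ho.measurableSet] with z hz hz'
    exact (ENNReal.ofReal_pos.2 (hh.density_pos hz'.1)).ne' hz
  have h3 : volume (c.target ∩ c.symm ⁻¹' (U ∩ c.source)) = 0 := by
    rw [← Measure.restrict_eq_zero]
    exact ae_eq_bot.1 (eventually_false_iff_eq_bot.1 h2)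
  refine (ho.measure_pos volume ⟨c x, c.map_source hx, ?_⟩).ne' h3
  rw [mem_preimage, c.left_inv hx]
  exact ⟨hxU, hx⟩

theorem vol_expMul [CompactSpace X] {h : HermitianMetric n L} (hh : h.IsPositive)
    (φ : SmoothFn n X) :
    (expMul φ h).vol = h.vol.withDensity fun x => ENNReal.ofReal (h.volRatio φ x) := by
  have hmeas : Measurable fun x => ENNReal.ofReal (h.volRatio φ x) :=
    (contMDiff_volRatio hh φ).continuous.measurable.ennreal_ofReal
  -- Equality of measures can be tested on a countable cover; compactness supplies a finite one by
  -- chart domains.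
  obtain ⟨t, ht⟩ := CompactSpace.elim_nhds_subcover
    (fun x : X => (chartAt (Fin n → ℂ) x).source) (fun x => chart_source_mem_nhds _ x)
  have hcov : ⋃ x : t, (chartAt (Fin n → ℂ) x.1).source = univ := by
    rw [← top_eq_univ, ← ht]
    ext y
    simp
  rw [← Measure.restrict_univ (μ := (expMul φ h).vol), ← Measure.restrict_univ
    (μ := h.vol.withDensity _), ← hcov, Measure.restrict_iUnion_congr]
  intro p
  have hSm : MeasurableSet (chartAt (Fin n → ℂ) p.1).source :=
    (chartAt (Fin n → ℂ) p.1).open_source.measurableSet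
  rw [restrict_withDensity hSm, vol_restrict_source, vol_restrict_source]
  ext A hA
  rw [withDensity_apply _ hA, ← lintegral_indicator hA,
    h.lintegral_localVolume p.1 (hmeas.indicator hA), ← lintegral_indicator_one hA,
    (expMul φ h).lintegral_localVolume p.1 (measurable_one.indicator hA)]
  refine setLIntegral_congr_fun (chartAt (Fin n → ℂ) p.1).open_target.measurableSet fun z hz => ?_
  by_cases hz' : (chartAt (Fin n → ℂ) p.1).symm z ∈ A
  · rw [indicator_of_mem hz', indicator_of_mem hz', density_expMul hh φ hz,
      ENNReal.ofReal_mul (hh.density_pos hz).le]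
    simp
  · rw [indicator_of_notMem hz', indicator_of_notMem hz', mul_zero, mul_zero]

/-- Transfers every integral to the fixed measure `dμ_h`, so that only the integrand depends on the
parameter. -/
theorem integral_vol_expMul [CompactSpace X] {F : Type*} [NormedAddCommGroup F] [NormedSpace ℝ F]
    {h : HermitianMetric n L} (hh : h.IsPositive) {φ : SmoothFn n X}
    (hφ : (expMul φ h).IsPositive) (f : X → F) :
    ∫ x, f x ∂(expMul φ h).vol = ∫ x, h.volRatio φ x • f x ∂h.vol := by
  rw [vol_expMul hh φ, integral_withDensity_eq_integral_toReal_smul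
    (contMDiff_volRatio hh φ).continuous.measurable.ennreal_ofReal
    (ae_of_all _ fun x => ENNReal.ofReal_lt_top)]
  refine integral_congr_ae (ae_of_all _ fun x => ?_)
  simp only [ENNReal.toReal_ofReal (hh.volRatio_pos hφ x).le]

end HermitianMetric

end Volume

/-! ### Derivatives of functions with a real parameter -/

section Slices

variable {E : Type*} [NormedAddCommGroup E] [NormedSpace ℝ E]

/-- The derivative of `G` in the direction `w`. -/
def dirDeriv {E : Type*} [NormedAddCommGroup E] [NormedSpace ℝ E] (w : E) (G : E → ℝ) (q : E) : ℝ :=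
  fderiv ℝ G q w

theorem contDiffOn_dirDeriv {W : Set E} (hW : IsOpen W) {G : E → ℝ} (hG : ContDiffOn ℝ ∞ G W)
    (w : E) : ContDiffOn ℝ ∞ (dirDeriv w G) W :=
  (hG.fderiv_of_isOpen hW (m := ∞) (by simp)).clm_apply contDiffOn_const

theorem dirDeriv_congr {W : Set E} (hW : IsOpen W) {G G' : E → ℝ} (h : EqOn G G' W) (w : E) :
    EqOn (dirDeriv w G) (dirDeriv w G') W := fun q hq => by
  have : G =ᶠ[𝓝 q] G' := by filter_upwards [hW.mem_nhds hq] with y hy using h hy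
  rw [dirDeriv, dirDeriv, this.fderiv_eq]

theorem dirDeriv_dirDeriv {W : Set E} (hW : IsOpen W) {G : E → ℝ} (hG : ContDiffOn ℝ ∞ G W)
    (u v : E) {q : E} (hq : q ∈ W) :
    dirDeriv u (dirDeriv v G) q = fderiv ℝ (fderiv ℝ G) q u v := by
  have h1 : DifferentiableAt ℝ (fderiv ℝ G) q :=
    ((hG.fderiv_of_isOpen hW (m := ∞) (by simp)).contDiffAt (hW.mem_nhds hq)).differentiableAt
      (by simp)
  have h2 := (h1.hasFDerivAt.clm_apply (hasFDerivAt_const v q)).fderiv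
  rw [dirDeriv]
  unfold dirDeriv
  rw [h2]
  simp

theorem dirDeriv_comm {W : Set E} (hW : IsOpen W) {G : E → ℝ} (hG : ContDiffOn ℝ ∞ G W)
    (u v : E) : EqOn (dirDeriv u (dirDeriv v G)) (dirDeriv v (dirDeriv u G)) W := fun q hq => by
  rw [dirDeriv_dirDeriv hW hG u v hq, dirDeriv_dirDeriv hW hG v u hq]
  exact ((hG.contDiffAt (hW.mem_nhds hq)).of_le two_le_infty).isSymmSndFDerivAt (by simp) u v

variable {W : Set E} {G : ℝ → E → ℝ}

theorem dirDeriv_slice (hW : IsOpen W)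
    (hG : ContDiffOn ℝ ∞ (fun q : ℝ × E => G q.1 q.2) (univ ×ˢ W)) {s : ℝ} {z : E} (hz : z ∈ W)
    (v : E) : dirDeriv v (G s) z = dirDeriv (0, v) (fun q : ℝ × E => G q.1 q.2) (s, z) := by
  have h1 : HasFDerivAt (fun q : ℝ × E => G q.1 q.2)
      (fderiv ℝ (fun q : ℝ × E => G q.1 q.2) (s, z)) (s, z) :=
    ((hG.contDiffAt ((isOpen_univ.prod hW).mem_nhds ⟨mem_univ _, hz⟩)).differentiableAt
      (by simp)).hasFDerivAt
  have h2 : HasFDerivAt (fun y : E => (s, y)) (ContinuousLinearMap.inr ℝ ℝ E) z :=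
    (hasFDerivAt_const s z).prodMk (hasFDerivAt_id z)
  have h3 := (HasFDerivAt.comp (f := fun y : E => (s, y)) z h1 h2).fderiv
  rw [dirDeriv, dirDeriv]
  erw [h3]
  simp

theorem contDiffOn_slice (hG : ContDiffOn ℝ ∞ (fun q : ℝ × E => G q.1 q.2) (univ ×ˢ W)) (s : ℝ) :
    ContDiffOn ℝ ∞ (G s) W := by
  have h2 : ContDiff ℝ ∞ (fun y : E => (s, y)) := contDiff_const.prodMk contDiff_id
  exact hG.comp h2.contDiffOn fun y hy => ⟨mem_univ _, hy⟩

/-- Derivatives of a slice are partial derivatives of the joint function, so derivatives in the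
parameter and in space commute by symmetry of second derivatives. -/
theorem fderiv_fderiv_slice (hW : IsOpen W)
    (hG : ContDiffOn ℝ ∞ (fun q : ℝ × E => G q.1 q.2) (univ ×ˢ W)) {s : ℝ} {z : E} (hz : z ∈ W)
    (u v : E) : fderiv ℝ (fderiv ℝ (G s)) z u v =
      dirDeriv (0, u) (dirDeriv (0, v) (fun q : ℝ × E => G q.1 q.2)) (s, z) := by
  rw [← dirDeriv_dirDeriv hW (contDiffOn_slice hG s) u v hz,
    dirDeriv_congr hW (fun y hy => dirDeriv_slice hW hG hy v) u hz]
  exact dirDeriv_slice (G := fun s y => dirDeriv (0, v) (fun q : ℝ × E => G q.1 q.2) (s, y)) hW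
    (contDiffOn_dirDeriv (isOpen_univ.prod hW) hG _) hz u

theorem hasDerivAt_slice (hW : IsOpen W)
    (hG : ContDiffOn ℝ ∞ (fun q : ℝ × E => G q.1 q.2) (univ ×ˢ W)) (s : ℝ) {z : E} (hz : z ∈ W) :
    HasDerivAt (fun r => G r z) (dirDeriv (1, 0) (fun q : ℝ × E => G q.1 q.2) (s, z)) s := by
  have h1 : HasFDerivAt (fun q : ℝ × E => G q.1 q.2)
      (fderiv ℝ (fun q : ℝ × E => G q.1 q.2) (s, z)) (s, z) :=
    ((hG.contDiffAt ((isOpen_univ.prod hW).mem_nhds ⟨mem_univ _, hz⟩)).differentiableAt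
      (by simp)).hasFDerivAt
  have h2 : HasDerivAt (fun r : ℝ => (r, z)) ((1 : ℝ), (0 : E)) s :=
    (hasDerivAt_id s).prodMk (hasDerivAt_const s z)
  exact HasFDerivAt.comp_hasDerivAt (f := fun r : ℝ => (r, z)) s h1 h2

/-- If `G'` is the derivative of `G` with respect to the parameter, then the second derivatives
of `G'` are the derivatives of those of `G`. -/
theorem hasDerivAt_fderiv_fderiv_slice (hW : IsOpen W)
    (hG : ContDiffOn ℝ ∞ (fun q : ℝ × E => G q.1 q.2) (univ ×ˢ W)) {G' : ℝ → E → ℝ}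
    (hG' : ∀ s, ∀ z ∈ W, HasDerivAt (fun r => G r z) (G' s z) s) (s : ℝ) {z : E} (hz : z ∈ W)
    (u v : E) : HasDerivAt (fun r => fderiv ℝ (fderiv ℝ (G r)) z u v)
      (fderiv ℝ (fderiv ℝ (G' s)) z u v) s := by
  have ho := isOpen_univ.prod (X := ℝ) hW
  have hE : EqOn (fun q : ℝ × E => G' q.1 q.2)
      (dirDeriv (1, 0) (fun q : ℝ × E => G q.1 q.2)) (univ ×ˢ W) := fun q hq =>
    (hG' q.1 q.2 hq.2).unique (hasDerivAt_slice hW hG q.1 hq.2)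
  have sG' : ContDiffOn ℝ ∞ (fun q : ℝ × E => G' q.1 q.2) (univ ×ˢ W) :=
    (contDiffOn_dirDeriv ho hG _).congr hE
  have s1 := contDiffOn_dirDeriv ho hG (0, v)
  have s2 := contDiffOn_dirDeriv ho s1 (0, u)
  have h1 := hasDerivAt_slice (G := fun r y => dirDeriv (0, u) (dirDeriv (0, v)
    (fun q : ℝ × E => G q.1 q.2)) (r, y)) hW s2 s hz
  have hm : (s, z) ∈ (univ : Set ℝ) ×ˢ W := ⟨mem_univ _, hz⟩
  refine (h1.congr_deriv ?_).congr_of_eventuallyEq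
    (Eventually.of_forall fun r => fderiv_fderiv_slice hW hG hz u v)
  rw [fderiv_fderiv_slice hW sG' hz]
  change dirDeriv (1, 0) (dirDeriv (0, u) (dirDeriv (0, v) fun q : ℝ × E => G q.1 q.2)) (s, z) = _
  rw [dirDeriv_comm ho s1 _ _ hm, dirDeriv_congr ho (dirDeriv_comm ho hG (1, 0) (0, v)) _ hm]
  exact (dirDeriv_congr ho (dirDeriv_congr ho hE _) _ hm).symm

end Slices

/-! ### Complex Hessians of functions with a real parameter. -/

section HessianSlices

variable {n : ℕ} {W : Set (Fin n → ℂ)} {G : ℝ → (Fin n → ℂ) → ℝ}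

theorem contDiffOn_complexHessian_slice (hW : IsOpen W)
    (hG : ContDiffOn ℝ ∞ (fun q : ℝ × (Fin n → ℂ) => G q.1 q.2) (univ ×ˢ W)) (j k : Fin n) :
    ContDiffOn ℝ ∞ (fun q : ℝ × (Fin n → ℂ) => complexHessian (G q.1) q.2 j k) (univ ×ˢ W) := by
  have ho := isOpen_univ.prod (X := ℝ) hW
  have hs : ∀ u v, ContDiffOn ℝ ∞ (fun q : ℝ × (Fin n → ℂ) =>
      ((fderiv ℝ (fderiv ℝ (G q.1)) q.2 u v : ℝ) : ℂ)) (univ ×ˢ W) := fun u v => by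
    refine Complex.ofRealCLM.contDiff.comp_contDiffOn
      ((contDiffOn_dirDeriv ho (contDiffOn_dirDeriv ho hG (0, v)) (0, u)).congr fun q hq => ?_)
    exact fderiv_fderiv_slice hW hG hq.2 u v
  exact contDiffOn_const.mul (((hs _ _).add (hs _ _)).add
    (contDiffOn_const.mul ((hs _ _).sub (hs _ _))))

theorem hasDerivAt_complexHessian_slice (hW : IsOpen W)
    (hG : ContDiffOn ℝ ∞ (fun q : ℝ × (Fin n → ℂ) => G q.1 q.2) (univ ×ˢ W))
    {G' : ℝ → (Fin n → ℂ) → ℝ} (hG' : ∀ s, ∀ z ∈ W, HasDerivAt (fun r => G r z) (G' s z) s)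
    (s : ℝ) {z : Fin n → ℂ} (hz : z ∈ W) (j k : Fin n) :
    HasDerivAt (fun r => complexHessian (G r) z j k) (complexHessian (G' s) z j k) s := by
  have hd := fun u v => (hasDerivAt_fderiv_fderiv_slice hW hG hG' s hz u v).ofReal_comp
  exact (((hd _ _).add (hd _ _)).add (((hd _ _).sub (hd _ _)).const_mul Complex.I)).const_mul (1 / 4)

end HessianSlices

/-! ### Smooth families of functions -/

section Families

variable {n : ℕ} {X : Type*} [TopologicalSpace X] [ChartedSpace (Fin n → ℂ) X]
  [IsManifold 𝓘(ℂ, Fin n → ℂ) ω X]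

/-- A family of functions on `X` that depends smoothly on a real parameter. -/
def IsSmoothFamily (φ : ℝ → SmoothFn n X) : Prop :=
  ContMDiff (𝓘(ℝ, ℝ).prod 𝓘(ℝ, Fin n → ℂ)) 𝓘(ℝ, ℝ) ∞ (fun q : ℝ × X => φ q.1 q.2)

omit [IsManifold 𝓘(ℂ, Fin n → ℂ) ω X] in
theorem isSmoothFamily_const (ψ : SmoothFn n X) : IsSmoothFamily fun _ => ψ :=
  ψ.contMDiff.comp contMDiff_snd

omit [IsManifold 𝓘(ℂ, Fin n → ℂ) ω X] in
theorem IsSmoothFamily.continuous {φ : ℝ → SmoothFn n X} (hφ : IsSmoothFamily φ) :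
    Continuous fun q : ℝ × X => φ q.1 q.2 := ContMDiff.continuous hφ

theorem IsSmoothFamily.contDiffOn {φ : ℝ → SmoothFn n X} (hφ : IsSmoothFamily φ) (p : X) :
    ContDiffOn ℝ ∞ (fun q : ℝ × (Fin n → ℂ) => φ q.1 ((chartAt (Fin n → ℂ) p).symm q.2))
      (univ ×ˢ (chartAt (Fin n → ℂ) p).target) := by
  rw [← contMDiffOn_iff_contDiffOn]
  have h1 : ContMDiffOn 𝓘(ℝ, ℝ × (Fin n → ℂ)) 𝓘(ℝ, ℝ) ∞ (fun q : ℝ × (Fin n → ℂ) => q.1)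
      (univ ×ˢ (chartAt (Fin n → ℂ) p).target) := contDiff_fst.contMDiff.contMDiffOn
  have h2 : ContMDiffOn 𝓘(ℝ, ℝ × (Fin n → ℂ)) 𝓘(ℝ, Fin n → ℂ) ∞
      (fun q : ℝ × (Fin n → ℂ) => (chartAt (Fin n → ℂ) p).symm q.2)
      (univ ×ˢ (chartAt (Fin n → ℂ) p).target) :=
    (contMDiffOn_chart_symm (I := 𝓘(ℝ, Fin n → ℂ)) (n := ∞)).comp
      contDiff_snd.contMDiff.contMDiffOn fun q hq => hq.2
  exact ContMDiff.comp_contMDiffOn hφ (h1.prodMk h2)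

/-- The derivative of a smooth family with respect to the parameter is a smooth family. -/
theorem IsSmoothFamily.exists_deriv {φ : ℝ → SmoothFn n X} (hφ : IsSmoothFamily φ) :
    ∃ φ' : ℝ → SmoothFn n X, IsSmoothFamily φ' ∧
      ∀ s x, HasDerivAt (fun r => φ r x) (φ' s x) s := by
  have key : ContMDiff (𝓘(ℝ, ℝ).prod 𝓘(ℝ, Fin n → ℂ)) 𝓘(ℝ, ℝ) ∞
      (fun q : ℝ × X => deriv (fun r => φ r q.2) q.1) := by
    rintro ⟨s, x⟩
    have hx := mem_chart_source (Fin n → ℂ) x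
    have ho := isOpen_univ.prod (X := ℝ) (chartAt (Fin n → ℂ) x).open_target
    have h1 : ContMDiffAt 𝓘(ℝ, Fin n → ℂ) 𝓘(ℝ, Fin n → ℂ) ∞ (chartAt (Fin n → ℂ) x) x :=
      (contMDiffOn_chart (I := 𝓘(ℝ, Fin n → ℂ)) (n := ∞)).contMDiffAt
        ((chartAt (Fin n → ℂ) x).open_source.mem_nhds hx)
    have h2 : ContMDiffAt (𝓘(ℝ, ℝ).prod 𝓘(ℝ, Fin n → ℂ)) 𝓘(ℝ, ℝ × (Fin n → ℂ)) ∞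
        (fun q : ℝ × X => (q.1, chartAt (Fin n → ℂ) x q.2)) (s, x) :=
      contMDiffAt_fst.prodMk_space (ContMDiffAt.comp (s, x) h1 contMDiffAt_snd)
    have h3 := ((contDiffOn_dirDeriv ho (hφ.contDiffOn x) (1, 0)).contDiffAt (ho.mem_nhds
      (⟨mem_univ s, (chartAt (Fin n → ℂ) x).map_source hx⟩ :
        (s, chartAt (Fin n → ℂ) x x) ∈ _ ×ˢ _))).contMDiffAt
    refine (ContMDiffAt.comp (f := fun q : ℝ × X => (q.1, chartAt (Fin n → ℂ) x q.2)) (s, x)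
      h3 h2).congr_of_eventuallyEq ?_
    filter_upwards [(isOpen_univ.prod (chartAt (Fin n → ℂ) x).open_source).mem_nhds
      (⟨mem_univ s, hx⟩ : (s, x) ∈ univ ×ˢ _)] with q hq
    have h4 := hasDerivAt_slice (G := fun r z => φ r ((chartAt (Fin n → ℂ) x).symm z))
      (chartAt (Fin n → ℂ) x).open_target (hφ.contDiffOn x) q.1
      ((chartAt (Fin n → ℂ) x).map_source hq.2)
    rw [(chartAt (Fin n → ℂ) x).left_inv hq.2] at h4
    exact h4.deriv
  have hsl : ∀ s : ℝ, ContMDiff 𝓘(ℝ, Fin n → ℂ) (𝓘(ℝ, ℝ).prod 𝓘(ℝ, Fin n → ℂ)) ∞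
      (fun x : X => (s, x)) := fun s => contMDiff_const.prodMk contMDiff_id
  refine ⟨fun s => ⟨fun x => deriv (fun r => φ r x) s, key.comp (hsl s)⟩, key, fun s x => ?_⟩
  have hx := mem_chart_source (Fin n → ℂ) x
  have h4 := hasDerivAt_slice (G := fun r z => φ r ((chartAt (Fin n → ℂ) x).symm z))
    (chartAt (Fin n → ℂ) x).open_target (hφ.contDiffOn x) s
    ((chartAt (Fin n → ℂ) x).map_source hx)
  rw [(chartAt (Fin n → ℂ) x).left_inv hx] at h4
  exact h4.differentiableAt.hasDerivAt

theorem chartHessian_add (u v : SmoothFn n X) {p x : X}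
    (hp : x ∈ (chartAt (Fin n → ℂ) p).source) :
    chartHessian (n := n) (u + v : SmoothFn n X) p x =
      chartHessian (n := n) u p x + chartHessian (n := n) v p x :=
  complexHessian_add ((contDiffAt_comp_chart_symm hp u.contMDiff).of_le two_le_infty)
    ((contDiffAt_comp_chart_symm hp v.contMDiff).of_le two_le_infty)

theorem chartHessian_smul (c : ℝ) (u : SmoothFn n X) {p x : X}
    (hp : x ∈ (chartAt (Fin n → ℂ) p).source) :
    chartHessian (n := n) (c • u : SmoothFn n X) p x = (c : ℂ) • chartHessian (n := n) u p x :=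
  complexHessian_const_mul ((contDiffAt_comp_chart_symm hp u.contMDiff).of_le two_le_infty) c

theorem IsSmoothFamily.contDiffOn_chartHessian {φ : ℝ → SmoothFn n X} (hφ : IsSmoothFamily φ)
    (p : X) (j k : Fin n) : ContDiffOn ℝ ∞ (fun q : ℝ × (Fin n → ℂ) =>
      chartHessian (φ q.1) p ((chartAt (Fin n → ℂ) p).symm q.2) j k)
      (univ ×ˢ (chartAt (Fin n → ℂ) p).target) := by
  refine (contDiffOn_complexHessian_slice (chartAt (Fin n → ℂ) p).open_target
    (G := fun r z => φ r ((chartAt (Fin n → ℂ) p).symm z)) (hφ.contDiffOn p) j k).congr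
    fun q hq => ?_
  simp only [chartHessian]
  rw [(chartAt (Fin n → ℂ) p).right_inv hq.2]

theorem IsSmoothFamily.hasDerivAt_chartHessian {φ φ' : ℝ → SmoothFn n X} (hφ : IsSmoothFamily φ)
    (hd : ∀ s x, HasDerivAt (fun r => φ r x) (φ' s x) s) (s : ℝ) {p x : X}
    (hp : x ∈ (chartAt (Fin n → ℂ) p).source) (j k : Fin n) :
    HasDerivAt (fun r => chartHessian (φ r) p x j k) (chartHessian (φ' s) p x j k) s :=
  hasDerivAt_complexHessian_slice (G := fun r z => φ r ((chartAt (Fin n → ℂ) p).symm z))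
    (G' := fun r z => φ' r ((chartAt (Fin n → ℂ) p).symm z))
    (chartAt (Fin n → ℂ) p).open_target (hφ.contDiffOn p) (fun s _ _ => hd s _) s
    ((chartAt (Fin n → ℂ) p).map_source hp) j k

end Families

/-- Positive definiteness is an open condition. -/
theorem eventually_posDef {n : ℕ} {T : Type*} [TopologicalSpace T]
    {M : T → Matrix (Fin n) (Fin n) ℂ} {t₀ : T} (hc : ∀ i j, ContinuousAt (fun t => M t i j) t₀)
    (hH : ∀ᶠ t in 𝓝 t₀, (M t).IsHermitian) (h0 : (M t₀).PosDef) : ∀ᶠ t in 𝓝 t₀, (M t).PosDef := by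
  set Q : T → (Fin n → ℂ) → ℝ := fun t x => (∑ i, ∑ j, conj (x i) * (M t i j * x j)).re with hQ
  have eQ : ∀ t x, (star x ⬝ᵥ (M t).mulVec x).re = Q t x := fun t x => by
    simp only [hQ, dotProduct, Matrix.mulVec, Finset.mul_sum, Pi.star_apply, RCLike.star_def]
  -- The form is jointly continuous and positive on the compact unit sphere at `t₀`, so it stays
  -- positive on the whole sphere for nearby `t`. Homogeneity (`h3`) extends this to all nonzero
  -- vectors.
  have h1 : ∀ᶠ t in 𝓝 t₀, ∀ x ∈ Metric.sphere (0 : Fin n → ℂ) 1, 0 < Q t x := by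
    refine (isCompact_sphere _ _).eventually_forall_of_forall_eventually fun x hx => ?_
    have hx0 : x ≠ 0 := fun h => by simp [h] at hx
    have hpos : 0 < Q t₀ x := by
      rw [← eQ]
      exact (Complex.pos_iff.1 (h0.dotProduct_mulVec_pos hx0)).1
    have hcont : ContinuousAt (fun z : T × (Fin n → ℂ) => Q z.1 z.2) (t₀, x) := by
      refine Complex.continuous_re.continuousAt.comp (f := fun z : T × (Fin n → ℂ) =>
        ∑ i, ∑ j, conj (z.2 i) * (M z.1 i j * z.2 j)) ?_
      refine tendsto_finsetSum _ fun i _ => tendsto_finsetSum _ fun j _ => ?_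
      have a1 : ContinuousAt (fun z : T × (Fin n → ℂ) => M z.1 i j) (t₀, x) :=
        ContinuousAt.comp (f := Prod.fst) (g := fun t => M t i j) (x := (t₀, x)) (hc i j) continuousAt_fst
      have a2 : ∀ k, ContinuousAt (fun z : T × (Fin n → ℂ) => z.2 k) (t₀, x) := fun k =>
        ((continuous_apply k).comp continuous_snd).continuousAt
      exact (Complex.continuous_conj.continuousAt.comp (a2 i)).mul (a1.mul (a2 j))
    exact hcont.eventually (lt_mem_nhds hpos)
  filter_upwards [h1, hH] with t ht hHt
  refine Matrix.PosDef.of_dotProduct_mulVec_pos hHt fun {x} hx => ?_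
  have hn : ‖x‖ ≠ 0 := norm_ne_zero_iff.2 hx
  have h2 := ht (((‖x‖⁻¹ : ℝ) : ℂ) • x) (by
    rw [mem_sphere_zero_iff_norm, norm_smul]
    simp [hn])
  have h3 : Q t (((‖x‖⁻¹ : ℝ) : ℂ) • x) = ‖x‖⁻¹ ^ 2 * Q t x := by
    simp only [hQ]
    rw [← Complex.re_ofReal_mul, Finset.mul_sum]
    congr 1
    refine Finset.sum_congr rfl fun i _ => ?_
    rw [Finset.mul_sum]
    refine Finset.sum_congr rfl fun j _ => ?_
    simp only [Pi.smul_apply, smul_eq_mul, map_mul, Complex.conj_ofReal]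
    push_cast
    ring
  rw [h3] at h2
  have h4 : 0 < Q t x := by
    by_contra! hle
    exact absurd h2 (not_lt.2 (mul_nonpos_of_nonneg_of_nonpos (by positivity) hle))
  have him : (star x ⬝ᵥ (M t).mulVec x).im = 0 := hHt.im_star_dotProduct_mulVec_self x
  exact Complex.pos_iff.2 ⟨by rw [eQ]; exact h4, him.symm⟩

/-! ### The linearization of the volume form and the openness of positivity. -/

section

variable {n : ℕ} {X : Type*} [TopologicalSpace X] [ChartedSpace (Fin n → ℂ) X]
  [IsManifold 𝓘(ℂ, Fin n → ℂ) ω X]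
  {L : X → Type*} [∀ x, AddCommGroup (L x)] [∀ x, Module ℂ (L x)]
  [TopologicalSpace (TotalSpace ℂ L)] [∀ x, TopologicalSpace (L x)] [FiberBundle ℂ L]
  [VectorBundle ℂ ℂ L] [ContMDiffVectorBundle ω ℂ L 𝓘(ℂ, Fin n → ℂ)]

namespace HermitianMetric

/-- The matrix of `e^{t φ_s} h` in the chart at `p`. -/
theorem contDiffOn_kahlerMatrix_family (h : HermitianMetric n L) {φ : ℝ → SmoothFn n X}
    (hφ : IsSmoothFamily φ) (p : X) (j k : Fin n) :
    ContDiffOn ℝ ∞ (fun q : (ℝ × ℝ) × (Fin n → ℂ) =>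
      (expMul (q.1.2 • φ q.1.1) h).kahlerMatrix (chartAt (Fin n → ℂ) p)
        ((chartAt (Fin n → ℂ) p).symm q.2) j k)
      (univ ×ˢ (chartAt (Fin n → ℂ) p).target) := by
  have h1 : ContDiffOn ℝ ∞ (fun q : (ℝ × ℝ) × (Fin n → ℂ) => h.kahlerMatrix
      (chartAt (Fin n → ℂ) p) ((chartAt (Fin n → ℂ) p).symm q.2) j k)
      (univ ×ˢ (chartAt (Fin n → ℂ) p).target) :=
    (h.contDiffOn_kahlerMatrix p j k).comp contDiff_snd.contDiffOn fun q hq => hq.2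
  have h2 : ContDiffOn ℝ ∞ (fun q : (ℝ × ℝ) × (Fin n → ℂ) => chartHessian (φ q.1.1) p
      ((chartAt (Fin n → ℂ) p).symm q.2) j k) (univ ×ˢ (chartAt (Fin n → ℂ) p).target) :=
    (hφ.contDiffOn_chartHessian p j k).comp (f := fun q : (ℝ × ℝ) × (Fin n → ℂ) => (q.1.1, q.2))
      ((contDiff_fst.comp contDiff_fst).prodMk contDiff_snd).contDiffOn
      fun q hq => ⟨mem_univ _, hq.2⟩
  have h3 : ContDiffOn ℝ ∞ (fun q : (ℝ × ℝ) × (Fin n → ℂ) => ((q.1.2 : ℝ) : ℂ))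
      (univ ×ˢ (chartAt (Fin n → ℂ) p).target) :=
    (Complex.ofRealCLM.contDiff.comp (contDiff_snd.comp contDiff_fst)).contDiffOn
  refine (h1.sub (h3.mul h2)).congr fun q hq => ?_
  have hs := (chartAt (Fin n → ℂ) p).map_target hq.2
  rw [kahlerMatrix_expMul _ _ hs, chartHessian_smul _ _ hs]
  rfl

/-- The derivative of `volRatio h` at `φ`, in the direction `v`. -/
def volRatioDeriv (h : HermitianMetric n L) (φ v : SmoothFn n X) (x : X) : ℝ :=
  deriv (fun ε : ℝ => h.volRatio (φ + ε • v) x) 0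

theorem hasDerivAt_det_kahlerMatrix (h : HermitianMetric n L) {φ φ' : ℝ → SmoothFn n X} {s : ℝ}
    {p x : X} (hp : x ∈ (chartAt (Fin n → ℂ) p).source)
    (hd : ∀ j k, HasDerivAt (fun r => chartHessian (n := n) (φ r) p x j k)
      (chartHessian (n := n) (φ' s) p x j k) s) :
    HasDerivAt (fun r => ((expMul (φ r) h).kahlerMatrix (chartAt (Fin n → ℂ) p) x).det.re)
      (((expMul (φ s) h).kahlerMatrix (chartAt (Fin n → ℂ) p) x).adjugate *
        -chartHessian (n := n) (φ' s) p x).trace.re s := by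
  have h1 : ∀ j k, HasDerivAt (fun r => (expMul (φ r) h).kahlerMatrix (chartAt (Fin n → ℂ) p) x j k)
      ((-chartHessian (n := n) (φ' s) p x : Matrix (Fin n) (Fin n) ℂ) j k) s := fun j k => by
    simp only [kahlerMatrix_expMul _ _ hp, Matrix.sub_apply, Matrix.neg_apply]
    exact (hd j k).const_sub _
  exact (Complex.reCLM.hasFDerivAt.comp_hasDerivAt s (hasDerivAt_det h1))

/-- Jacobi's formula for a matrix that is affine in the direction. It shows that the operator is
linear in `v`, is of second order, and has the same expression in every chart around `x`. -/
theorem volRatioDeriv_eq (h : HermitianMetric n L) (φ v : SmoothFn n X) {p x : X}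
    (hp : x ∈ (chartAt (Fin n → ℂ) p).source) :
    h.volRatioDeriv φ v x = (((expMul φ h).kahlerMatrix (chartAt (Fin n → ℂ) p) x).adjugate *
        -chartHessian (n := n) v p x).trace.re / (h.kahlerMatrix (chartAt (Fin n → ℂ) p) x).det.re := by
  have h1 : ∀ j k, HasDerivAt (fun ε : ℝ => chartHessian (n := n) (φ + ε • v : SmoothFn n X) p x j k)
      (chartHessian (n := n) v p x j k) 0 := fun j k => by
    simp only [chartHessian_add _ _ hp, chartHessian_smul _ _ hp, Matrix.add_apply,
      Matrix.smul_apply, smul_eq_mul]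
    simpa using ((hasDerivAt_id (0 : ℝ)).ofReal_comp.mul_const
      (chartHessian (n := n) v p x j k)).const_add (chartHessian (n := n) φ p x j k)
  have h2 := (h.hasDerivAt_det_kahlerMatrix (φ := fun ε => φ + ε • v) (φ' := fun _ => v) hp
    h1).div_const (h.kahlerMatrix (chartAt (Fin n → ℂ) p) x).det.re
  simp only [zero_smul, add_zero] at h2
  rw [volRatioDeriv, ← h2.deriv]
  simp only [h.volRatio_eq _ hp]

theorem hasDerivAt_volRatio_family (h : HermitianMetric n L) {φ φ' : ℝ → SmoothFn n X}
    (hφ : IsSmoothFamily φ) (hd : ∀ s x, HasDerivAt (fun r => φ r x) (φ' s x) s) (t s : ℝ) (x : X) :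
    HasDerivAt (fun r => h.volRatio (t • φ r) x) (t * h.volRatioDeriv (t • φ s) (φ' s) x) s := by
  have hx := mem_chart_source (Fin n → ℂ) x
  have h1 : ∀ j k, HasDerivAt (fun r => chartHessian (n := n) (t • φ r : SmoothFn n X) x x j k)
      (chartHessian (n := n) (t • φ' s : SmoothFn n X) x x j k) s := fun j k => by
    simp only [chartHessian_smul _ _ hx, Matrix.smul_apply]
    exact (hφ.hasDerivAt_chartHessian hd s hx j k).const_mul _
  have h2 := (h.hasDerivAt_det_kahlerMatrix (φ := fun r => t • φ r) (φ' := fun r => t • φ' r) hx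
    h1).div_const (h.kahlerMatrix (chartAt (Fin n → ℂ) x) x).det.re
  refine h2.congr_deriv ?_
  rw [h.volRatioDeriv_eq _ _ hx, chartHessian_smul _ _ hx, ← mul_div_assoc, ← smul_neg,
    Matrix.mul_smul, Matrix.trace_smul, smul_eq_mul, Complex.re_ofReal_mul]

theorem hasDerivAt_volRatio_smul (h : HermitianMetric n L) (ψ : SmoothFn n X) (t : ℝ) (x : X) :
    HasDerivAt (fun r : ℝ => h.volRatio (r • ψ) x) (h.volRatioDeriv (t • ψ) ψ x) t := by
  have hx := mem_chart_source (Fin n → ℂ) x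
  have h1 : ∀ j k, HasDerivAt (fun r : ℝ => chartHessian (n := n) (r • ψ : SmoothFn n X) x x j k)
      (chartHessian (n := n) ψ x x j k) t := fun j k => by
    simp only [chartHessian_smul _ _ hx, Matrix.smul_apply, smul_eq_mul]
    simpa using (hasDerivAt_id t).ofReal_comp.mul_const (chartHessian (n := n) ψ x x j k)
  refine ((h.hasDerivAt_det_kahlerMatrix (φ := fun r => r • ψ) (φ' := fun _ => ψ) hx
    h1).div_const (h.kahlerMatrix (chartAt (Fin n → ℂ) x) x).det.re).congr_deriv ?_
  rw [h.volRatioDeriv_eq _ _ hx]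

theorem volRatioDeriv_add (h : HermitianMetric n L) (φ u v : SmoothFn n X) (x : X) :
    h.volRatioDeriv φ (u + v) x = h.volRatioDeriv φ u x + h.volRatioDeriv φ v x := by
  have hx := mem_chart_source (Fin n → ℂ) x
  rw [h.volRatioDeriv_eq _ _ hx, h.volRatioDeriv_eq _ _ hx, h.volRatioDeriv_eq _ _ hx,
    chartHessian_add _ _ hx, neg_add, Matrix.mul_add, Matrix.trace_add, Complex.add_re, add_div]

omit [IsManifold 𝓘(ℂ, Fin n → ℂ) ω X] in
theorem chartHessian_eq_zero {u : X → ℝ} {p x : X} (hp : x ∈ (chartAt (Fin n → ℂ) p).source) {c : ℝ}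
    (hu : ∀ᶠ y in 𝓝 x, u y = c) : chartHessian (n := n) u p x = 0 := by
  have h1 : (fun z => u ((chartAt (Fin n → ℂ) p).symm z)) =ᶠ[𝓝 (chartAt (Fin n → ℂ) p x)]
      fun _ => c := eventually_symm_mem hp hu
  rw [chartHessian, Filter.EventuallyEq.complexHessian_eq h1]
  ext j k
  simp [complexHessian]

/-- The operator depends only on the Hessian of `v` at `x`. This makes it local, for the partition
of unity, and makes it annihilate constants. -/
theorem volRatioDeriv_eq_zero (h : HermitianMetric n L) (φ : SmoothFn n X) {v : SmoothFn n X}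
    {x : X} {c : ℝ} (hv : ∀ᶠ y in 𝓝 x, v y = c) : h.volRatioDeriv φ v x = 0 := by
  have hx := mem_chart_source (Fin n → ℂ) x
  rw [h.volRatioDeriv_eq _ _ hx, chartHessian_eq_zero hx hv]
  simp

/-- `volRatioDeriv` of a family, in a chart. -/
theorem exists_contDiffOn_volRatioDeriv {h : HermitianMetric n L} (hh : h.IsPositive)
    {φ ψ : ℝ → SmoothFn n X} (hφ : IsSmoothFamily φ) (hψ : IsSmoothFamily ψ) (p : X) :
    ∃ g : (ℝ × ℝ) × (Fin n → ℂ) → ℝ, ContDiffOn ℝ ∞ g (univ ×ˢ (chartAt (Fin n → ℂ) p).target) ∧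
      ∀ (q : ℝ × ℝ), ∀ x ∈ (chartAt (Fin n → ℂ) p).source,
        h.volRatioDeriv (q.2 • φ q.1) (ψ q.1) x = g (q, chartAt (Fin n → ℂ) p x) := by
  have h1 := contDiffOn_adjugate (h.contDiffOn_kahlerMatrix_family hφ p)
  have h2 : ∀ j k, ContDiffOn ℝ ∞ (fun q : (ℝ × ℝ) × (Fin n → ℂ) => chartHessian (ψ q.1.1) p
      ((chartAt (Fin n → ℂ) p).symm q.2) j k) (univ ×ˢ (chartAt (Fin n → ℂ) p).target) := fun j k =>
    (hψ.contDiffOn_chartHessian p j k).comp (f := fun q : (ℝ × ℝ) × (Fin n → ℂ) => (q.1.1, q.2))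
      ((contDiff_fst.comp contDiff_fst).prodMk contDiff_snd).contDiffOn
      fun q hq => ⟨mem_univ _, hq.2⟩
  have h3 : ContDiffOn ℝ ∞ (fun q : (ℝ × ℝ) × (Fin n → ℂ) => (h.kahlerMatrix
      (chartAt (Fin n → ℂ) p) ((chartAt (Fin n → ℂ) p).symm q.2)).det.re)
      (univ ×ˢ (chartAt (Fin n → ℂ) p).target) :=
    Complex.reCLM.contDiff.comp_contDiffOn
      ((contDiffOn_det (h.contDiffOn_kahlerMatrix p)).comp contDiff_snd.contDiffOn
        fun q hq => hq.2)
  refine ⟨fun q => (∑ k, ∑ j, ((expMul (q.1.2 • φ q.1.1) h).kahlerMatrix (chartAt (Fin n → ℂ) p)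
      ((chartAt (Fin n → ℂ) p).symm q.2)).adjugate k j *
      -chartHessian (ψ q.1.1) p ((chartAt (Fin n → ℂ) p).symm q.2) j k).re /
      (h.kahlerMatrix (chartAt (Fin n → ℂ) p) ((chartAt (Fin n → ℂ) p).symm q.2)).det.re, ?_, ?_⟩
  · refine ContDiffOn.div (Complex.reCLM.contDiff.comp_contDiffOn (ContDiffOn.sum fun k _ =>
      ContDiffOn.sum fun j _ => (h1 k j).mul (h2 j k).neg)) h3 fun q hq => ?_
    exact (hh.det_pos ((chartAt (Fin n → ℂ) p).map_target hq.2)).ne'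
  · intro q x hx
    rw [h.volRatioDeriv_eq _ _ hx]
    simp only [(chartAt (Fin n → ℂ) p).left_inv hx, Matrix.trace, Matrix.diag, Matrix.mul_apply,
      Matrix.neg_apply]

theorem continuous_volRatioDeriv_family {h : HermitianMetric n L} (hh : h.IsPositive)
    {φ ψ : ℝ → SmoothFn n X} (hφ : IsSmoothFamily φ) (hψ : IsSmoothFamily ψ) :
    Continuous fun q : (ℝ × ℝ) × X => h.volRatioDeriv (q.1.2 • φ q.1.1) (ψ q.1.1) q.2 := by
  rw [continuous_iff_continuousAt]
  rintro ⟨q, x⟩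
  have hx := mem_chart_source (Fin n → ℂ) x
  obtain ⟨g, hg, he⟩ := exists_contDiffOn_volRatioDeriv hh hφ hψ x
  have h1 : ContinuousAt g (q, chartAt (Fin n → ℂ) x x) :=
    (hg.contDiffAt ((isOpen_univ.prod (chartAt (Fin n → ℂ) x).open_target).mem_nhds
      ⟨mem_univ _, (chartAt (Fin n → ℂ) x).map_source hx⟩)).continuousAt
  have h2 : ContinuousAt (fun r : (ℝ × ℝ) × X => (r.1, chartAt (Fin n → ℂ) x r.2)) (q, x) :=
    continuousAt_fst.prodMk
      (ContinuousAt.comp (f := Prod.snd) ((chartAt (Fin n → ℂ) x).continuousAt hx) continuousAt_snd)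
  refine (ContinuousAt.comp (f := fun r : (ℝ × ℝ) × X => (r.1, chartAt (Fin n → ℂ) x r.2))
    h1 h2).congr ?_
  filter_upwards [(isOpen_univ.prod (chartAt (Fin n → ℂ) x).open_source).mem_nhds
      (⟨mem_univ q, hx⟩ : (q, x) ∈ univ ×ˢ _)] with r hr
  exact (he r.1 r.2 hr.2).symm

theorem contMDiff_volRatioDeriv {h : HermitianMetric n L} (hh : h.IsPositive)
    (φ ψ : SmoothFn n X) :
    ContMDiff 𝓘(ℝ, Fin n → ℂ) 𝓘(ℝ, ℝ) ∞ (h.volRatioDeriv φ ψ) := by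
  intro x
  have hx := mem_chart_source (Fin n → ℂ) x
  obtain ⟨g, hg, he⟩ := exists_contDiffOn_volRatioDeriv hh (isSmoothFamily_const φ)
    (isSmoothFamily_const ψ) x
  have h1 : ContDiffAt ℝ ∞ g ((0, 1), chartAt (Fin n → ℂ) x x) :=
    hg.contDiffAt ((isOpen_univ.prod (chartAt (Fin n → ℂ) x).open_target).mem_nhds
      ⟨mem_univ _, (chartAt (Fin n → ℂ) x).map_source hx⟩)
  have h2 : ContDiff ℝ ∞ (fun z : Fin n → ℂ => (((0 : ℝ), (1 : ℝ)), z)) :=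
    contDiff_const.prodMk contDiff_id
  refine contMDiffAt_of_chart hx (g := fun z => g ((0, 1), z))
    (ContDiffAt.comp _ h1 h2.contDiffAt) ?_
  filter_upwards [(chartAt (Fin n → ℂ) x).open_source.mem_nhds hx] with y hy
  simpa using he (0, 1) y hy

theorem continuous_volRatio_family {h : HermitianMetric n L} (hh : h.IsPositive)
    {φ : ℝ → SmoothFn n X} (hφ : IsSmoothFamily φ) :
    Continuous fun q : (ℝ × ℝ) × X => h.volRatio (q.1.2 • φ q.1.1) q.2 := by
  rw [continuous_iff_continuousAt]
  rintro ⟨q, x⟩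
  have hx := mem_chart_source (Fin n → ℂ) x
  have h3 : ContDiffOn ℝ ∞ (fun q : (ℝ × ℝ) × (Fin n → ℂ) => (h.kahlerMatrix
      (chartAt (Fin n → ℂ) x) ((chartAt (Fin n → ℂ) x).symm q.2)).det.re)
      (univ ×ˢ (chartAt (Fin n → ℂ) x).target) :=
    Complex.reCLM.contDiff.comp_contDiffOn
      ((contDiffOn_det (h.contDiffOn_kahlerMatrix x)).comp contDiff_snd.contDiffOn
        fun q hq => hq.2)
  have hg := (Complex.reCLM.contDiff.comp_contDiffOn
    (contDiffOn_det (h.contDiffOn_kahlerMatrix_family hφ x))).div h3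
    fun q hq => (hh.det_pos ((chartAt (Fin n → ℂ) x).map_target hq.2)).ne'
  have h1 := (hg.contDiffAt ((isOpen_univ.prod (chartAt (Fin n → ℂ) x).open_target).mem_nhds
      (⟨mem_univ q, (chartAt (Fin n → ℂ) x).map_source hx⟩ :
        (q, chartAt (Fin n → ℂ) x x) ∈ univ ×ˢ _))).continuousAt
  have h2 : ContinuousAt (fun r : (ℝ × ℝ) × X => (r.1, chartAt (Fin n → ℂ) x r.2)) (q, x) :=
    continuousAt_fst.prodMk
      (ContinuousAt.comp (f := Prod.snd) ((chartAt (Fin n → ℂ) x).continuousAt hx) continuousAt_snd)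
  refine (ContinuousAt.comp (f := fun r : (ℝ × ℝ) × X => (r.1, chartAt (Fin n → ℂ) x r.2))
    h1 h2).congr ?_
  filter_upwards [(isOpen_univ.prod (chartAt (Fin n → ℂ) x).open_source).mem_nhds
      (⟨mem_univ q, hx⟩ : (q, x) ∈ univ ×ˢ _)] with r hr
  rw [h.volRatio_eq _ hr.2]
  simp [(chartAt (Fin n → ℂ) x).left_inv hr.2]

/-- Positivity is an open condition on smooth families. -/
theorem eventually_isPositive [CompactSpace X] (h : HermitianMetric n L) {φ : ℝ → SmoothFn n X}
    (hφ : IsSmoothFamily φ) {s₀ : ℝ} (h0 : (expMul (φ s₀) h).IsPositive) :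
    ∀ᶠ s in 𝓝 s₀, (expMul (φ s) h).IsPositive := by
  suffices H : ∀ᶠ s in 𝓝 s₀, ∀ x ∈ (univ : Set X),
      ((expMul (φ s) h).kahlerMatrix (chartAt (Fin n → ℂ) x) x).PosDef by
    filter_upwards [H] with s hs x using hs x (mem_univ x)
  refine isCompact_univ.eventually_forall_of_forall_eventually fun x _ => ?_
  have hx := mem_chart_source (Fin n → ℂ) x
  have hsrc : ∀ᶠ z : ℝ × X in 𝓝 (s₀, x), z.2 ∈ (chartAt (Fin n → ℂ) x).source :=
    continuousAt_snd.eventually ((chartAt (Fin n → ℂ) x).open_source.mem_nhds hx)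
  have h2 : ContinuousAt (fun r : ℝ × X => ((r.1, (1 : ℝ)), chartAt (Fin n → ℂ) x r.2)) (s₀, x) :=
    (continuousAt_fst.prodMk continuousAt_const).prodMk
      (ContinuousAt.comp (f := Prod.snd) ((chartAt (Fin n → ℂ) x).continuousAt hx) continuousAt_snd)
  have hc : ∀ i j, ContinuousAt (fun z : ℝ × X =>
      (expMul (φ z.1) h).kahlerMatrix (chartAt (Fin n → ℂ) x) z.2 i j) (s₀, x) := fun i j => by
    have h1 := ((h.contDiffOn_kahlerMatrix_family hφ x i j).contDiffAt
      ((isOpen_univ.prod (chartAt (Fin n → ℂ) x).open_target).mem_nhds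
      (⟨mem_univ ((s₀, 1) : ℝ × ℝ), (chartAt (Fin n → ℂ) x).map_source hx⟩ :
        (((s₀, 1) : ℝ × ℝ), chartAt (Fin n → ℂ) x x) ∈ univ ×ˢ _))).continuousAt
    refine (ContinuousAt.comp (f := fun r : ℝ × X => ((r.1, (1 : ℝ)), chartAt (Fin n → ℂ) x r.2))
      h1 h2).congr ?_
    filter_upwards [hsrc] with z hz
    simp [(chartAt (Fin n → ℂ) x).left_inv hz]
  -- `IsPositive` refers at each point to the chart at that point. Near `x` the matrix is studied in
  -- the fixed chart at `x`, where its entries are jointly continuous; `kahlerMatrix_posDef` then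
  -- returns to the moving chart.
  have hev := eventually_posDef (M := fun z : ℝ × X =>
    (expMul (φ z.1) h).kahlerMatrix (chartAt (Fin n → ℂ) x) z.2) hc
    (hsrc.mono fun z hz => kahlerMatrix_isHermitian _ hz) (h0 x)
  filter_upwards [hev, hsrc] with z hz hz'
  exact kahlerMatrix_posDef _ (mem_chart_source _ z.2) hz' hz

end HermitianMetric

end

section

variable {n : ℕ} {X : Type*} [TopologicalSpace X] [ChartedSpace (Fin n → ℂ) X]
  [IsManifold 𝓘(ℂ, Fin n → ℂ) ω X]
  {L : X → Type*} [∀ x, AddCommGroup (L x)] [∀ x, Module ℂ (L x)]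
  [TopologicalSpace (TotalSpace ℂ L)] [∀ x, TopologicalSpace (L x)] [FiberBundle ℂ L]
  [VectorBundle ℂ ℂ L] [ContMDiffVectorBundle ω ℂ L 𝓘(ℂ, Fin n → ℂ)]

namespace HermitianMetric

/-! ### Symmetry of the linearized volume form with respect to `dμ_h`. -/

section SelfAdjoint

variable [MeasurableSpace X] [BorelSpace X] [CompactSpace X]

omit [MeasurableSpace X] [BorelSpace X] [CompactSpace X] in
theorem density_mul_volRatioDeriv {h : HermitianMetric n L} (hh : h.IsPositive)
    (φ v : SmoothFn n X) {p : X} {z : Fin n → ℂ} (hz : z ∈ (chartAt (Fin n → ℂ) p).target) :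
    h.density p z * h.volRatioDeriv φ v ((chartAt (Fin n → ℂ) p).symm z) =
      2 ^ n * (((expMul φ h).kahlerMatrix (chartAt (Fin n → ℂ) p)
        ((chartAt (Fin n → ℂ) p).symm z)).adjugate *
        -chartHessian (n := n) v p ((chartAt (Fin n → ℂ) p).symm z)).trace.re := by
  have hs := (chartAt (Fin n → ℂ) p).map_target hz
  rw [h.volRatioDeriv_eq _ _ hs, density, mul_assoc, mul_div_cancel₀ _ (hh.det_pos hs).ne']

/-- Self-adjointness, for functions with support in the domain of a chart and a trivialization. -/
theorem integral_mul_volRatioDeriv_symm_of_support {h : HermitianMetric n L} (hh : h.IsPositive)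
    (φ u v : SmoothFn n X) {p : X} (hu : tsupport u ⊆
      (chartAt (Fin n → ℂ) p).source ∩ (trivializationAt ℂ L p).baseSet) :
    ∫ x, u x * h.volRatioDeriv φ v x ∂h.vol = ∫ x, v x * h.volRatioDeriv φ u x ∂h.vol := by
  set c := chartAt (Fin n → ℂ) p with hc
  set W := c.target ∩ c.symm ⁻¹' (trivializationAt ℂ L p).baseSet with hW
  have hWo : IsOpen W := isOpen_target_inter (trivializationAt ℂ L p).open_baseSet
  set K := c '' tsupport u with hK
  have hKc : IsCompact K := ((isClosed_tsupport u).isCompact).image_of_continuousOn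
    (c.continuousOn.mono fun x hx => (hu hx).1)
  have hKW : K ⊆ W := by
    rintro _ ⟨x, hx, rfl⟩
    refine ⟨c.map_source (hu hx).1, ?_⟩
    rw [mem_preimage, c.left_inv (hu hx).1]
    exact (hu hx).2
  have hoff : ∀ z ∈ c.target, z ∉ K → c.symm z ∉ tsupport u := fun z hz hzK hx =>
    hzK ⟨c.symm z, hx, c.right_inv hz⟩
  have hev : ∀ x ∉ tsupport u, ∀ᶠ y in 𝓝 x, u y = 0 := fun x hx => by
    filter_upwards [(isClosed_tsupport u).isOpen_compl.mem_nhds hx] with y hy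
    exact image_eq_zero_of_notMem_tsupport hy
  have cu : ∀ w : SmoothFn n X, Continuous w := fun w => w.contMDiff.continuous
  have cd : ∀ w : SmoothFn n X, Continuous (h.volRatioDeriv φ w) := fun w =>
    (contMDiff_volRatioDeriv hh φ w).continuous
  -- Both integrands vanish off the support of `u`, the second one because the operator is local.
  -- The integrals therefore live on the part `W` of one chart over which the frame at `p` is
  -- defined.
  have global : ∀ f : X → ℝ, Continuous f → (∀ x ∉ tsupport u, f x = 0) →
      ∫ x, f x ∂h.vol = ∫ z in W, h.density p z * f (c.symm z) := fun f hf h0 => by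
    rw [← setIntegral_eq_integral_of_forall_compl_eq_zero (s := c.source)
      (fun x hx => h0 x fun h' => hx (hu h').1), setIntegral_vol hh p hf]
    refine setIntegral_eq_of_subset_of_forall_sdiff_eq_zero c.open_target.measurableSet
      inter_subset_left fun z hz => ?_
    rw [h0 _ (hoff z hz.1 fun h' => hz.2 (hKW h')), smul_zero]
  -- Minus the logarithm of the norm squared of the frame is a local potential of the form, so the
  -- identity on `ℂⁿ` applies.
  set l : (Fin n → ℂ) → ℝ := fun z => (-1 : ℝ) * (expMul φ h).logFrame p (c.symm z) with hl
  have sl0 : ContDiffOn ℝ ∞ (fun z => (expMul φ h).logFrame p (c.symm z)) W :=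
    (expMul φ h).contDiffOn_logFrame_chart p p
  have sl : ContDiffOn ℝ ∞ l W := contDiffOn_const.mul sl0
  have hM : ∀ z ∈ W, complexHessian l z = (expMul φ h).kahlerMatrix c (c.symm z) := fun z hz => by
    rw [(expMul φ h).kahlerMatrix_eq (c.map_target hz.1) hz.2, chartHessian,
      complexHessian_const_mul ((sl0.contDiffAt (hWo.mem_nhds hz)).of_le two_le_infty),
      ← hc, c.right_inv hz.1]
    simp
  have hH : ∀ w : SmoothFn n X, ∀ z ∈ W, chartHessian (n := n) w p (c.symm z) =
      complexHessian (fun y => w (c.symm y)) z := fun w z hz => by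
    rw [chartHessian, ← hc, c.right_inv hz.1]
  have sw : ∀ w : SmoothFn n X, ContDiffOn ℝ ∞ (fun z => w (c.symm z)) W := fun w =>
    (contDiffOn_comp_chart w.contMDiff).mono inter_subset_left
  have key := setIntegral_trace_adjugate_symm hWo hKc hKW sl (sw u) (sw v) fun z hz hzK =>
    (hev _ (hoff z hz.1 hzK)).self_of_nhds
  have tr : ∀ w w' : SmoothFn n X, ∫ z in W, h.density p z *
      (w (c.symm z) * h.volRatioDeriv φ w' (c.symm z)) = -2 ^ n * ∫ z in W, w (c.symm z) *
        ((complexHessian l z).adjugate * complexHessian (fun y => w' (c.symm y)) z).trace.re := by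
    intro w w'
    rw [← integral_const_mul]
    refine setIntegral_congr_fun hWo.measurableSet fun z hz => ?_
    have h1 := density_mul_volRatioDeriv hh φ w' hz.1
    rw [← hc, hH w' z hz, ← hM z hz, Matrix.mul_neg, Matrix.trace_neg, Complex.neg_re] at h1
    change h.density p z * (w (c.symm z) * h.volRatioDeriv φ w' (c.symm z)) = _
    rw [mul_left_comm, h1]
    ring
  rw [global (fun x => u x * h.volRatioDeriv φ v x) ((cu u).mul (cd v)) fun x hx => by rw [(hev x hx).self_of_nhds, zero_mul],
    global (fun x => v x * h.volRatioDeriv φ u x) ((cu v).mul (cd u)) fun x hx => by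
      rw [h.volRatioDeriv_eq_zero φ (hev x hx), mul_zero], tr, tr, key]

theorem integrable_of_continuous (h : HermitianMetric n L) {F : Type*} [NormedAddCommGroup F]
    [SecondCountableTopology F] {f : X → F} (hf : Continuous f) : Integrable f h.vol := by
  borelize F
  obtain ⟨B, hB⟩ := (isCompact_univ (X := X)).exists_bound_of_continuousOn hf.continuousOn
  exact Integrable.of_bound hf.aestronglyMeasurable B (ae_of_all _ fun x => hB x (mem_univ x))

omit [MeasurableSpace X] [BorelSpace X] [CompactSpace X] in
theorem volRatioDeriv_sum (h : HermitianMetric n L) (φ : SmoothFn n X) {ι : Type*} (s : Finset ι)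
    (u : ι → SmoothFn n X) (x : X) :
    h.volRatioDeriv φ (∑ i ∈ s, u i) x = ∑ i ∈ s, h.volRatioDeriv φ (u i) x := by
  classical
  induction s using Finset.induction_on with
  | empty =>
    rw [Finset.sum_empty, Finset.sum_empty]
    exact h.volRatioDeriv_eq_zero φ (c := 0) (Eventually.of_forall fun y => rfl)
  | insert a s ha ih => rw [Finset.sum_insert ha, Finset.sum_insert ha, volRatioDeriv_add, ih]

omit [IsManifold 𝓘(ℂ, Fin n → ℂ) ω X] [MeasurableSpace X] [BorelSpace X] [CompactSpace X] in
theorem smoothFn_sum_apply {ι : Type*} (s : Finset ι) (u : ι → SmoothFn n X) (x : X) :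
    (∑ i ∈ s, u i) x = ∑ i ∈ s, u i x := by
  classical
  induction s using Finset.induction_on with
  | empty => rfl
  | insert a s ha ih =>
    rw [Finset.sum_insert ha, Finset.sum_insert ha, ← ih]
    rfl

/-- The linearization of the volume form is self-adjoint. -/
theorem integral_mul_volRatioDeriv_symm [T2Space X] {h : HermitianMetric n L} (hh : h.IsPositive)
    (φ u v : SmoothFn n X) :
    ∫ x, u x * h.volRatioDeriv φ v x ∂h.vol = ∫ x, v x * h.volRatioDeriv φ u x ∂h.vol := by
  set U : X → Set X := fun p =>
    (chartAt (Fin n → ℂ) p).source ∩ (trivializationAt ℂ L p).baseSet with hU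
  have hUo : ∀ p, IsOpen (U p) := fun p =>
    (chartAt (Fin n → ℂ) p).open_source.inter (trivializationAt ℂ L p).open_baseSet
  obtain ⟨t, ht⟩ := CompactSpace.elim_nhds_subcover U fun x => (hUo x).mem_nhds
    ⟨mem_chart_source _ x, FiberBundle.mem_baseSet_trivializationAt' (F := ℂ) (E := L) x⟩
  -- Both sides are linear in `u`, and the local result constrains only the support of `u`; hence
  -- only `u` is cut into pieces.
  obtain ⟨ρ, hρ⟩ := SmoothPartitionOfUnity.exists_isSubordinate 𝓘(ℝ, Fin n → ℂ) isClosed_univ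
    (fun p : t => U p.1) (fun p => hUo p.1) (by
      rw [univ_subset_iff, ← top_eq_univ, ← ht]
      ext y
      simp)
  set w : t → SmoothFn n X := fun p => ρ p * u with hw
  have hsum : u = ∑ p : t, w p := by
    ext x
    rw [smoothFn_sum_apply]
    have h1 := ρ.sum_eq_one (mem_univ x)
    rw [finsum_eq_sum_of_fintype] at h1
    calc u x = (∑ p, ρ p x) * u x := by rw [h1, one_mul]
      _ = ∑ p, w p x := by rw [Finset.sum_mul]; rfl
  have hsupp : ∀ p : t, tsupport (w p) ⊆ U p.1 := fun p =>
    (tsupport_mul_subset_left (f := ρ p) (g := u)).trans (hρ p)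
  have cd : ∀ w' : SmoothFn n X, Continuous (h.volRatioDeriv φ w') := fun w' =>
    (contMDiff_volRatioDeriv hh φ w').continuous
  have h1 : ∀ x, u x * h.volRatioDeriv φ v x = ∑ p : t, w p x * h.volRatioDeriv φ v x := fun x => by
    rw [← Finset.sum_mul, ← smoothFn_sum_apply, ← hsum]
  have h2 : ∀ x, v x * h.volRatioDeriv φ u x = ∑ p : t, v x * h.volRatioDeriv φ (w p) x := fun x => by
    rw [← Finset.mul_sum, ← volRatioDeriv_sum, ← hsum]
  simp only [h1, h2]
  have i1 : ∀ p, Integrable (fun x => w p x * h.volRatioDeriv φ v x) h.vol := fun p =>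
    h.integrable_of_continuous ((w p).contMDiff.continuous.mul (cd v))
  have i2 : ∀ p, Integrable (fun x => v x * h.volRatioDeriv φ (w p) x) h.vol := fun p =>
    h.integrable_of_continuous (v.contMDiff.continuous.mul (cd (w p)))
  rw [integral_finsetSum _ fun p _ => i1 p, integral_finsetSum _ fun p _ => i2 p]
  exact Finset.sum_congr rfl fun p _ =>
    integral_mul_volRatioDeriv_symm_of_support hh φ (w p) v (hsupp p)

end SelfAdjoint

/-! ### Metrics are determined by their norms -/

omit [IsManifold 𝓘(ℂ, Fin n → ℂ) ω X] [ContMDiffVectorBundle ω ℂ L 𝓘(ℂ, Fin n → ℂ)] in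
omit [VectorBundle ℂ ℂ L] in
theorem pair_smul_smul (h : HermitianMetric n L) {x : X} (a b : ℂ) (v w : L x) :
    h.pair (a • v) (b • w) = conj a * b * h.pair v w := by
  have h1 : h.pair v (b • w) = b * h.pair v w := by
    rw [pair, ← (h.core x).conj_inner_symm, (h.core x).smul_left, map_mul,
      (h.core x).conj_inner_symm, Complex.conj_conj, pair]
  have h2 : h.pair (a • v) (b • w) = conj a * h.pair v (b • w) := (h.core x).smul_left _ _ _
  rw [h2, h1, mul_assoc]

omit [IsManifold 𝓘(ℂ, Fin n → ℂ) ω X] [ContMDiffVectorBundle ω ℂ L 𝓘(ℂ, Fin n → ℂ)] in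
omit [VectorBundle ℂ ℂ L] in
theorem pair_self (h : HermitianMetric n L) {x : X} (v : L x) : h.pair v v = h.normSq v := by
  apply Complex.ext
  · rfl
  · have := congrArg Complex.im ((h.core x).conj_inner_symm v v)
    rw [Complex.conj_im] at this
    rw [Complex.ofReal_im]
    change ((h.core x).inner v v).im = 0
    linarith

omit [IsManifold 𝓘(ℂ, Fin n → ℂ) ω X] [ContMDiffVectorBundle ω ℂ L 𝓘(ℂ, Fin n → ℂ)] in
theorem pair_eq (h : HermitianMetric n L) {p x : X} (hp : x ∈ (trivializationAt ℂ L p).baseSet)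
    (v w : L x) :
    h.pair v w = conj (coord p v) * coord p w * h.normSq (frame (L := L) p x) := by
  conv_lhs => rw [eq_coord_smul_frame hp v, eq_coord_smul_frame hp w]
  rw [pair_smul_smul, pair_self]

omit [IsManifold 𝓘(ℂ, Fin n → ℂ) ω X] [ContMDiffVectorBundle ω ℂ L 𝓘(ℂ, Fin n → ℂ)] in
-- A Hermitian form on a line is determined by the norm of a single nonzero vector, here the frame
-- (`pair_eq`).
theorem ext_normSq {h h' : HermitianMetric n L} (e : ∀ (x : X) (v : L x), h.normSq v = h'.normSq v) :
    h = h' := by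
  have hc : h.core = h'.core := by
    funext x
    have hi : (h.core x).inner = (h'.core x).inner := by
      funext v w
      have hx := FiberBundle.mem_baseSet_trivializationAt' (F := ℂ) (E := L) x
      change h.pair v w = h'.pair v w
      rw [h.pair_eq hx, h'.pair_eq hx, e]
    generalize h.core x = a at hi
    generalize h'.core x = b at hi
    rcases a with ⟨⟨⟨f⟩, _, _, _, _⟩, _⟩
    rcases b with ⟨⟨⟨g⟩, _, _, _, _⟩, _⟩
    cases hi
    rfl
  cases h
  cases h'
  cases hc
  rfl

omit [IsManifold 𝓘(ℂ, Fin n → ℂ) ω X] [ContMDiffVectorBundle ω ℂ L 𝓘(ℂ, Fin n → ℂ)] in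
theorem expMul_logRatio (h h₀ : HermitianMetric n L) : expMul (logRatio h h₀) h₀ = h := by
  refine ext_normSq fun x v => ?_
  have hx := FiberBundle.mem_baseSet_trivializationAt' (F := ℂ) (E := L) x
  have h0 := h₀.normSq_pos (frame_ne_zero hx)
  have h1 := h.normSq_pos (frame_ne_zero hx)
  rw [eq_coord_smul_frame hx v, normSq_smul, normSq_smul, normSq_expMul]
  change _ * (Real.exp (Real.log (h.normSq (frame (L := L) x x) /
    h₀.normSq (frame (L := L) x x))) * _) = _
  rw [Real.exp_log (div_pos h1 h0), div_mul_cancel₀ _ h0.ne']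

omit [IsManifold 𝓘(ℂ, Fin n → ℂ) ω X] [ContMDiffVectorBundle ω ℂ L 𝓘(ℂ, Fin n → ℂ)] in
theorem logRatio_expMul (φ : SmoothFn n X) (h h₀ : HermitianMetric n L) (x : X) :
    logRatio (expMul φ h) h₀ x = φ x + logRatio h h₀ x := by
  have hx := FiberBundle.mem_baseSet_trivializationAt' (F := ℂ) (E := L) x
  have h0 := h₀.normSq_pos (frame_ne_zero hx)
  have h1 := h.normSq_pos (frame_ne_zero hx)
  change Real.log (_ / _) = φ x + Real.log (_ / _)
  rw [normSq_expMul, mul_div_assoc, Real.log_mul (Real.exp_pos _).ne' (div_pos h1 h0).ne',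
    Real.log_exp]

omit [IsManifold 𝓘(ℂ, Fin n → ℂ) ω X] [ContMDiffVectorBundle ω ℂ L 𝓘(ℂ, Fin n → ℂ)] in
theorem expMul_zero (h : HermitianMetric n L) : expMul (0 : SmoothFn n X) h = h := by
  refine ext_normSq fun x v => ?_
  rw [normSq_expMul]
  change Real.exp 0 * _ = _
  rw [Real.exp_zero, one_mul]

theorem volRatio_zero {h : HermitianMetric n L} (hh : h.IsPositive) (x : X) :
    h.volRatio (0 : SmoothFn n X) x = 1 := by
  rw [volRatio, expMul_zero, div_self (hh.det_pos (mem_chart_source _ x)).ne']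

/-- Positive metrics form a convex set. -/
theorem IsPositive.smul {h : HermitianMetric n L} (hh : h.IsPositive) {φ : SmoothFn n X}
    (hφ : (expMul φ h).IsPositive) {t : ℝ} (ht : t ∈ Icc (0 : ℝ) 1) :
    (expMul (t • φ) h).IsPositive := fun x => by
  have hx := mem_chart_source (Fin n → ℂ) x
  have h1 := hh x
  have h2 := hφ x
  have e : (expMul (t • φ) h).kahlerMatrix (chartAt (Fin n → ℂ) x) x =
      ((1 - t : ℝ) : ℂ) • h.kahlerMatrix (chartAt (Fin n → ℂ) x) x +
      ((t : ℝ) : ℂ) • (expMul φ h).kahlerMatrix (chartAt (Fin n → ℂ) x) x := by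
    rw [kahlerMatrix_expMul _ _ hx, kahlerMatrix_expMul _ _ hx, chartHessian_smul _ _ hx]
    push_cast
    module
  rw [e]
  -- For `t > 0` the second summand is positive definite and the first is semidefinite; at `t = 0`
  -- definiteness comes from the first.
  rcases eq_or_lt_of_le ht.1 with h0 | h0
  · rw [← h0]
    simpa using h1
  · exact Matrix.PosDef.posSemidef_add (h1.posSemidef.smul (Complex.zero_le_real.2 (by linarith [ht.2])))
      (h2.smul (Complex.zero_lt_real.2 h0))

end HermitianMetric

end

/-! ### The first variation of the energy functional. -/

section

variable {n : ℕ} {X : Type*} [TopologicalSpace X] [ChartedSpace (Fin n → ℂ) X]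
  [IsManifold 𝓘(ℂ, Fin n → ℂ) ω X]
  {L : X → Type*} [∀ x, AddCommGroup (L x)] [∀ x, Module ℂ (L x)]
  [TopologicalSpace (TotalSpace ℂ L)] [∀ x, TopologicalSpace (L x)] [FiberBundle ℂ L]
  [VectorBundle ℂ ℂ L] [ContMDiffVectorBundle ω ℂ L 𝓘(ℂ, Fin n → ℂ)]
  [MeasurableSpace X] [BorelSpace X] [CompactSpace X] [T2Space X]

namespace HermitianMetric

/-- The product rule leaves the operator acting on `χ'`. Symmetry moves it to `χ`, which turns the
expression into a derivative with respect to `t`. -/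
theorem hasDerivAt_integral_mul_volRatio {h : HermitianMetric n L} (hh : h.IsPositive)
    {χ χ' : ℝ → SmoothFn n X} (hχ : IsSmoothFamily χ) (hχ' : IsSmoothFamily χ')
    (hd : ∀ s x, HasDerivAt (fun r => χ r x) (χ' s x) s) (t s : ℝ) :
    HasDerivAt (fun r => ∫ x, χ r x * h.volRatio (t • χ r) x ∂h.vol)
      (∫ x, χ' s x * h.volRatio (t • χ s) x ∂h.vol +
        t * ∫ x, χ' s x * h.volRatioDeriv (t • χ s) (χ s) x ∂h.vol) s := by
  have c0 := hχ.continuous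
  have c1 := hχ'.continuous
  have m : Continuous fun q : ℝ × X => (((q.1, t), q.2) : (ℝ × ℝ) × X) := by fun_prop
  have c2 := (continuous_volRatio_family hh hχ).comp m
  have c3 := (continuous_volRatioDeriv_family hh hχ hχ').comp m
  have ms : Continuous fun x : X => (s, x) := by fun_prop
  have i1 : Integrable (fun x => χ' s x * h.volRatio (t • χ s) x) h.vol :=
    h.integrable_of_continuous ((c1.mul c2).comp ms)
  have i2 : Integrable (fun x => t * (χ s x * h.volRatioDeriv (t • χ s) (χ' s) x)) h.vol :=
    (h.integrable_of_continuous ((c0.mul c3).comp ms)).const_mul t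
  have key := hasDerivAt_integral_of_continuous h.vol (c0.mul c2)
    ((c1.mul c2).add (c0.mul (continuous_const.mul c3)))
    (fun s x => (hd s x).mul (h.hasDerivAt_volRatio_family hχ hd t s x)) s
  refine key.congr_deriv ?_
  rw [integral_mul_volRatioDeriv_symm hh, ← integral_const_mul,
    ← integral_add i1 i2]
  refine integral_congr_ae (ae_of_all _ fun x => ?_)
  ring

omit [T2Space X] in
-- For `u = χ' s` and `ψ = χ s` the derivative is the integrand produced by
-- `hasDerivAt_integral_mul_volRatio`.
theorem hasDerivAt_smul_integral_mul_volRatio {h : HermitianMetric n L} (hh : h.IsPositive)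
    (u ψ : SmoothFn n X) (t : ℝ) :
    HasDerivAt (fun r : ℝ => r * ∫ x, u x * h.volRatio (r • ψ) x ∂h.vol)
      (∫ x, u x * h.volRatio (t • ψ) x ∂h.vol +
        t * ∫ x, u x * h.volRatioDeriv (t • ψ) ψ x ∂h.vol) t := by
  have m : Continuous fun q : ℝ × X => (((0, q.1), q.2) : (ℝ × ℝ) × X) := by fun_prop
  have c2 := (continuous_volRatio_family hh (isSmoothFamily_const ψ)).comp m
  have c3 := (continuous_volRatioDeriv_family hh (isSmoothFamily_const ψ)
    (isSmoothFamily_const ψ)).comp m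
  have c0 := (isSmoothFamily_const u).continuous
  have := hasDerivAt_integral_of_continuous h.vol (c0.mul c2) (c0.mul c3)
    (fun s x => (h.hasDerivAt_volRatio_smul ψ s x).const_mul (u x)) t
  exact ((hasDerivAt_id t).mul this).congr_deriv (by rw [one_mul]; rfl)

omit [T2Space X] in
theorem continuous_integral_of_continuous {Q : Type*} [TopologicalSpace Q]
    [FirstCountableTopology Q] [LocallyCompactSpace Q] (h : HermitianMetric n L) {f : Q × X → ℝ}
    (hf : Continuous f) : Continuous fun q => ∫ x, f (q, x) ∂h.vol := by
  have := continuous_parametric_integral_of_continuous (μ := h.vol) (f := fun q x => f (q, x))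
    hf isCompact_univ
  simpa using this

/-- After differentiation under the integral sign the integrand is the `t`-derivative of `t ∫ χ'
R_{tχ}`, so only the value at `t = 1` survives. -/
theorem hasDerivAt_integral_integral_volRatio {h : HermitianMetric n L} (hh : h.IsPositive)
    {χ χ' : ℝ → SmoothFn n X} (hχ : IsSmoothFamily χ) (hχ' : IsSmoothFamily χ')
    (hd : ∀ s x, HasDerivAt (fun r => χ r x) (χ' s x) s) (s : ℝ) :
    HasDerivAt (fun r => ∫ t in (0 : ℝ)..1, ∫ x, χ r x * h.volRatio (t • χ r) x ∂h.vol)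
      (∫ x, χ' s x * h.volRatio (χ s) x ∂h.vol) s := by
  have c0 := hχ.continuous
  have c1 := hχ'.continuous
  have m : Continuous fun q : (ℝ × ℝ) × X => ((q.1.1, q.2) : ℝ × X) := by fun_prop
  have c2 := continuous_volRatio_family hh hχ
  have c3 := continuous_volRatioDeriv_family hh hχ hχ
  have cA := h.continuous_integral_of_continuous ((c0.comp m).mul c2)
  have cB := (h.continuous_integral_of_continuous ((c1.comp m).mul c2)).add
    (continuous_snd.mul (h.continuous_integral_of_continuous ((c1.comp m).mul c3)))
  -- The interval is replaced by the compact space `unitInterval`, so that the differentiation lemma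
  -- for compact spaces covers the outer integral too.
  have mI : Continuous fun q : ℝ × unitInterval => ((q.1, q.2.1) : ℝ × ℝ) := by fun_prop
  have key := hasDerivAt_integral_of_continuous (volume : Measure unitInterval)
    (cA.comp mI) (cB.comp mI) (fun s t => hasDerivAt_integral_mul_volRatio hh hχ hχ' hd t s) s
  have e : ∀ g : ℝ → ℝ, ∫ t : unitInterval, g t = ∫ t in (0 : ℝ)..1, g t := fun g => by
    rw [intervalIntegral.integral_of_le zero_le_one, ← integral_Icc_eq_integral_Ioc]
    exact integral_subtype_comap measurableSet_Icc g
  have ftc := intervalIntegral.integral_eq_sub_of_hasDerivAt (a := 0) (b := 1)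
    (fun t _ => hasDerivAt_smul_integral_mul_volRatio hh (χ' s) (χ s) t)
    (((cB.comp (by fun_prop : Continuous fun t : ℝ => (s, t))).intervalIntegrable 0 1))
  rw [one_smul, one_mul, zero_mul, sub_zero] at ftc
  rw [← ftc]
  refine (key.congr_deriv ?_).congr_of_eventuallyEq (Eventually.of_forall fun r => ?_)
  · exact e fun t => ∫ x, χ' s x * h.volRatio (t • χ s) x ∂h.vol +
      t * ∫ x, χ' s x * h.volRatioDeriv (t • χ s) (χ s) x ∂h.vol
  · exact (e fun t => ∫ x, χ r x * h.volRatio (t • χ r) x ∂h.vol).symm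

omit [T2Space X] in
-- The metrics `e^{tφ} h₀` with `0 ≤ t ≤ 1` are positive by convexity, so each inner integral can be
-- taken against `dμ_{h₀}`.
theorem energy_eq {h₀ : HermitianMetric n L} (hh : h₀.IsPositive) {φ : SmoothFn n X}
    (hφ : (expMul φ h₀).IsPositive) :
    energy h₀ (expMul φ h₀) = ∫ t in (0 : ℝ)..1, ∫ x, φ x * h₀.volRatio (t • φ) x ∂h₀.vol := by
  have e : logRatio (expMul φ h₀) h₀ = φ := by
    have h0 : ∀ x, logRatio h₀ h₀ x = 0 := fun x => by
      have hx := FiberBundle.mem_baseSet_trivializationAt' (F := ℂ) (E := L) x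
      change Real.log (_ / _) = 0
      rw [div_self (h₀.normSq_pos (frame_ne_zero hx)).ne', Real.log_one]
    ext x
    rw [logRatio_expMul, h0, add_zero]
  rw [energy, e]
  refine intervalIntegral.integral_congr fun t ht => ?_
  rw [uIcc_of_le zero_le_one] at ht
  rw [integral_vol_expMul hh (hh.smul hφ ht)]
  simp only [smul_eq_mul, mul_comm]

/-- The functional `energy h₀` has the derivative that characterizes the functional `I`. -/
theorem isEnergy_energy {h₀ : HermitianMetric n L} (hh : h₀.IsPositive) : IsEnergy (energy h₀) := by
  intro h φ hφ s hs
  obtain ⟨φ', hφ', hd⟩ := IsSmoothFamily.exists_deriv hφ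
  -- The path is given relative to an arbitrary metric `h`, perhaps not in `𝒦`. Adding `logRatio h
  -- h₀` makes it a path relative to `h₀`.
  set χ : ℝ → SmoothFn n X := fun r => φ r + logRatio h h₀ with hχdef
  have hχ : IsSmoothFamily χ := ContMDiff.add hφ (isSmoothFamily_const (logRatio h h₀))
  have hdχ : ∀ s x, HasDerivAt (fun r => χ r x) (φ' s x) s := fun s x => (hd s x).add_const _
  have e : ∀ r, expMul (φ r) h = expMul (χ r) h₀ := fun r => by
    have : χ r = logRatio (expMul (φ r) h) h₀ := by
      ext x
      rw [logRatio_expMul]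
      rfl
    rw [this, expMul_logRatio]
  simp only [e] at hs ⊢
  have key := hasDerivAt_integral_integral_volRatio hh hχ hφ' hdχ s
  rw [integral_vol_expMul hh hs]
  simp only [(hd s _).deriv, smul_eq_mul, mul_comm (h₀.volRatio _ _)]
  refine key.congr_of_eventuallyEq ?_
  filter_upwards [h₀.eventually_isPositive hχ hs] with r hr using energy_eq hh hr

end HermitianMetric

end

/-! ### Gram determinants -/

section Gram

variable {V : Type*} [AddCommGroup V] [Module ℂ V] {ι : Type*} [Fintype ι] [DecidableEq ι]

/-- A change of basis alters `log det` by a constant independent of `H`, so its derivative may be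
computed in a basis orthonormal at the point in question. -/
theorem det_gram_basis_change (H : InnerProductSpace.Core ℂ V) (s b : Module.Basis ι ℂ V) :
    (Matrix.of fun i j => H.inner (b i) (b j)).det =
      (‖(s.toMatrix b).det‖ ^ 2 : ℝ) * (Matrix.of fun i j => H.inner (s i) (s j)).det := by
  let _ : NormedAddCommGroup V := H.toNormedAddCommGroup
  let _ : InnerProductSpace ℂ V := InnerProductSpace.ofCore H.toCore
  have e : (Matrix.of fun i j => H.inner (b i) (b j)) = (s.toMatrix b).conjTranspose *
      (Matrix.of fun i j => H.inner (s i) (s j)) * s.toMatrix b := by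
    ext i j
    have h1 : ∀ k, b k = ∑ l, s.toMatrix b l k • s l := fun k =>
      (s.sum_toMatrix_smul_self b k).symm
    have h2 : inner ℂ (b i) (b j) = ∑ m, ∑ l, conj (s.toMatrix b l i) * inner ℂ (s l) (s m) *
        s.toMatrix b m j := by
      conv_lhs => rw [h1 i, h1 j]
      simp only [sum_inner, inner_sum, inner_smul_left, inner_smul_right]
      refine Finset.sum_congr rfl fun m _ => ?_
      rw [Finset.mul_sum]
      exact Finset.sum_congr rfl fun l _ => mul_comm _ _
    simp only [Matrix.mul_apply, Finset.sum_mul, Matrix.conjTranspose_apply, Matrix.of_apply]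
    exact h2
  rw [e, Matrix.det_mul, Matrix.det_mul, Matrix.det_conjTranspose, mul_right_comm, Complex.ofReal_pow,
    ← Complex.conj_mul']
  rfl

theorem exists_basis_of_isOrthonormal {d : ℕ} [FiniteDimensional ℂ V]
    (hd : d = Module.finrank ℂ V) {H : InnerProductSpace.Core ℂ V} {s : Fin d → V}
    (hs : IsOrthonormal H s) : ∃ c : Module.Basis (Fin d) ℂ V, ⇑c = s := by
  let _ : NormedAddCommGroup V := H.toNormedAddCommGroup
  let _ : InnerProductSpace ℂ V := InnerProductSpace.ofCore H.toCore
  have ho : Orthonormal ℂ s := orthonormal_iff_ite.2 hs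
  have hspan : ⊤ ≤ Submodule.span ℂ (Set.range s) := by
    rw [ho.linearIndependent.span_eq_top_of_card_eq_finrank' (by simp [hd])]
  exact ⟨Module.Basis.mk ho.linearIndependent hspan, Module.Basis.coe_mk _ _⟩

end Gram

section

variable {n : ℕ} {X : Type*} [TopologicalSpace X] [ChartedSpace (Fin n → ℂ) X]
  [IsManifold 𝓘(ℂ, Fin n → ℂ) ω X]
  {L : X → Type*} [∀ x, AddCommGroup (L x)] [∀ x, Module ℂ (L x)]
  [TopologicalSpace (TotalSpace ℂ L)] [∀ x, TopologicalSpace (L x)] [FiberBundle ℂ L]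
  [VectorBundle ℂ ℂ L] [ContMDiffVectorBundle ω ℂ L 𝓘(ℂ, Fin n → ℂ)]

namespace HermitianMetric

/-! ### Pointwise pairings of sections -/

omit [IsManifold 𝓘(ℂ, Fin n → ℂ) ω X] [ContMDiffVectorBundle ω ℂ L 𝓘(ℂ, Fin n → ℂ)] in
theorem normSq_eq (h : HermitianMetric n L) {p x : X} (hp : x ∈ (trivializationAt ℂ L p).baseSet)
    (v : L x) : h.normSq v = ‖coord p v‖ ^ 2 * h.normSq (frame (L := L) p x) := by
  conv_lhs => rw [eq_coord_smul_frame hp v, normSq_smul]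

omit [IsManifold 𝓘(ℂ, Fin n → ℂ) ω X] in
theorem contMDiffAt_coord_section (s : HoloSection n L) {p x : X}
    (hx : x ∈ (trivializationAt ℂ L p).baseSet) :
    ContMDiffAt 𝓘(ℝ, Fin n → ℂ) 𝓘(ℝ, ℂ) ∞ (fun y => coord p (s y)) x :=
  contMDiffAt_real (((trivializationAt ℂ L p).contMDiffAt_section_iff hx).1 (s.contMDiff x))

omit [IsManifold 𝓘(ℂ, Fin n → ℂ) ω X] in
theorem continuous_pair (h : HermitianMetric n L) (s t : HoloSection n L) :
    Continuous fun x => h.pair (s x) (t x) := by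
  refine continuous_iff_continuousAt.2 fun p => ?_
  have hp := FiberBundle.mem_baseSet_trivializationAt' (F := ℂ) (E := L) p
  have hU := (trivializationAt ℂ L p).open_baseSet.mem_nhds hp
  have h1 : ContinuousAt (fun x => conj (coord p (s x)) * coord p (t x) *
      (h.normSq (frame (L := L) p x) : ℂ)) p :=
    ((Complex.continuous_conj.continuousAt.comp
      (contMDiffAt_coord_section s hp).continuousAt).mul
      (contMDiffAt_coord_section t hp).continuousAt).mul
      (Complex.continuous_ofReal.continuousAt.comp
        ((h.smooth p).contMDiffAt hU).continuousAt)
  refine h1.congr ?_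
  filter_upwards [hU] with x hx using (h.pair_eq hx _ _).symm

/-- The function `|s|²_h`. -/
def normSqSection (h : HermitianMetric n L) (s : HoloSection n L) : SmoothFn n X :=
  ⟨fun x => h.normSq (s x), fun p => by
    have hp := FiberBundle.mem_baseSet_trivializationAt' (F := ℂ) (E := L) p
    have hU := (trivializationAt ℂ L p).open_baseSet.mem_nhds hp
    have c : ContDiff ℝ ∞ (fun z : ℂ => ‖z‖ ^ 2) := contDiff_norm_sq ℝ
    refine ((c.contMDiff.contMDiffAt.comp p (contMDiffAt_coord_section s hp)).mul
      ((h.smooth p).contMDiffAt hU)).congr_of_eventuallyEq ?_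
    filter_upwards [hU] with x hx using h.normSq_eq hx _⟩

variable [MeasurableSpace X] [BorelSpace X] [CompactSpace X]

theorem IsPositive.V_pos [Nonempty X] {h : HermitianMetric n L} (hh : h.IsPositive) : 0 < h.V := by
  have := hh.isOpenPosMeasure
  rw [V, measureReal_def]
  exact ENNReal.toReal_pos (isOpen_univ.measure_ne_zero h.vol univ_nonempty) (measure_ne_top _ _)

theorem eq_zero_of_integral_eq_zero {h : HermitianMetric n L} (hh : h.IsPositive) {f : X → ℝ}
    (hf : Continuous f) (h0 : ∀ x, 0 ≤ f x) (hi : ∫ x, f x ∂h.vol = 0) : f = 0 := by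
  have := hh.isOpenPosMeasure
  exact (hf.ae_eq_iff_eq h.vol continuous_const).1
    ((integral_eq_zero_iff_of_nonneg h0 (h.integrable_of_continuous hf)).1 hi)

theorem integrable_pair (h : HermitianMetric n L) (s t : HoloSection n L) :
    Integrable (fun x => h.pair (s x) (t x)) h.vol :=
  h.integrable_of_continuous (h.continuous_pair s t)

omit [IsManifold 𝓘(ℂ, Fin n → ℂ) ω X] [ContMDiffVectorBundle ω ℂ L 𝓘(ℂ, Fin n → ℂ)] [BorelSpace X] [CompactSpace X] in
omit [VectorBundle ℂ ℂ L] in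
theorem integral_pair_self (h : HermitianMetric n L) (s : HoloSection n L) :
    ∫ x, h.pair (s x) (s x) ∂h.vol = ((∫ x, h.normSq (s x) ∂h.vol : ℝ) : ℂ) := by
  rw [← integral_complex_ofReal]
  exact integral_congr_ae (ae_of_all _ fun x => h.pair_self _)

end HermitianMetric

/-! ### The inner product `Hilb(h)` and the Bergman function. -/

section Hilb

variable [MeasurableSpace X] [BorelSpace X] [CompactSpace X] [Nonempty X]
  {E : Submodule ℂ (HoloSection n L)} [FiniteDimensional ℂ E]

omit [IsManifold 𝓘(ℂ, Fin n → ℂ) ω X] [ContMDiffVectorBundle ω ℂ L 𝓘(ℂ, Fin n → ℂ)] [MeasurableSpace X] [BorelSpace X] [CompactSpace X] in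
theorem GivesEmbedding.finrank_pos (hE : GivesEmbedding E) : 0 < Module.finrank ℂ E := by
  obtain ⟨x⟩ := ‹Nonempty X›
  obtain ⟨s, hs, h0⟩ := hE.basePointFree x
  refine Module.finrank_pos_iff_exists_ne_zero.2 ⟨⟨s, hs⟩, fun h => h0 ?_⟩
  rw [show s = 0 from congrArg Subtype.val h]
  rfl

omit [IsManifold 𝓘(ℂ, Fin n → ℂ) ω X] [ContMDiffVectorBundle ω ℂ L 𝓘(ℂ, Fin n → ℂ)] [BorelSpace X] [CompactSpace X]
  [Nonempty X] [FiniteDimensional ℂ E] in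
theorem Hilb_self (h : HermitianMetric n L) (s : E) :
    Hilb E h s s = ((Module.finrank ℂ E / h.V * ∫ x, h.normSq (s.1 x) ∂h.vol : ℝ) : ℂ) := by
  rw [Hilb, h.integral_pair_self, Complex.ofReal_mul]

/-- The inner product `Hilb(h)` on `E`. -/
@[reducible] def hilbCore (hE : GivesEmbedding E) {h : HermitianMetric n L} (hh : h.IsPositive) :
    InnerProductSpace.Core ℂ E where
  inner := Hilb E h
  conj_inner_symm s t := by
    rw [Hilb, Hilb, map_mul, Complex.conj_ofReal, ← integral_conj]
    congr 1
    exact integral_congr_ae (ae_of_all _ fun x => (h.core x).conj_inner_symm _ _)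
  re_inner_nonneg s := by
    rw [Hilb_self, RCLike.re_eq_complex_re, Complex.ofReal_re]
    exact mul_nonneg (div_nonneg (Nat.cast_nonneg _) hh.V_pos.le)
      (integral_nonneg fun x => (h.core x).re_inner_nonneg _)
  add_left s t u := by
    rw [Hilb, Hilb, Hilb, ← mul_add, ← integral_add (h.integrable_pair _ _) (h.integrable_pair _ _)]
    congr 1
    exact integral_congr_ae (ae_of_all _ fun x => (h.core x).add_left _ _ _)
  smul_left s t c := by
    rw [Hilb, Hilb, mul_left_comm, ← integral_const_mul (conj c)]
    congr 1
    exact integral_congr_ae (ae_of_all _ fun x => (h.core x).smul_left _ _ _)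
  definite s hs := by
    have hd : (0 : ℝ) < Module.finrank ℂ E := Nat.cast_pos.2 hE.finrank_pos
    rw [Hilb_self, Complex.ofReal_eq_zero] at hs
    have h1 := HermitianMetric.eq_zero_of_integral_eq_zero hh
      (h.normSqSection s.1).contMDiff.continuous (fun x => (h.core x).re_inner_nonneg _)
      ((mul_eq_zero.1 hs).resolve_left (div_pos hd hh.V_pos).ne')
    refine Subtype.ext (ContMDiffSection.ext fun x => ?_)
    by_contra hx
    exact (h.normSq_pos hx).ne' (congrFun h1 x)

/-- The function `∑ |s_α|²_h`, for an orthonormal basis `(s_α)` of `E` with respect to `Hilb(h)`. -/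
def bergman (hE : GivesEmbedding E) {h : HermitianMetric n L} (hh : h.IsPositive) : SmoothFn n X :=
  ∑ i, h.normSqSection (onb (hilbCore hE hh) i).1

theorem bergman_apply (hE : GivesEmbedding E) {h : HermitianMetric n L} (hh : h.IsPositive) (x : X) :
    bergman hE hh x = ∑ i, h.normSq ((onb (hilbCore hE hh) i).1 x) :=
  HermitianMetric.smoothFn_sum_apply _ _ x

omit [IsManifold 𝓘(ℂ, Fin n → ℂ) ω X] [ContMDiffVectorBundle ω ℂ L 𝓘(ℂ, Fin n → ℂ)] [MeasurableSpace X] [BorelSpace X] [CompactSpace X] [Nonempty X] in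
theorem isOrthonormal_onb (H : InnerProductSpace.Core ℂ E) : IsOrthonormal H (onb H) :=
  Classical.choose_spec (exists_isOrthonormal H)

/-- A metric is balanced if and only if its Bergman function is identically `1`. -/
theorem isBalanced_iff_bergman_eq_one (hE : GivesEmbedding E) {h : HermitianMetric n L}
    (hh : h.IsPositive) : IsBalanced hE h ↔ ∀ x, bergman hE hh x = 1 := by
  constructor
  · rintro ⟨H, hH, hF⟩ x
    have := sum_normSq_FS hE H (onb (hilbCore hE hh)) (fun i j => by
      rw [hH]
      exact isOrthonormal_onb (hilbCore hE hh) i j) x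
    rwa [hF, ← bergman_apply] at this
  · intro h1
    refine ⟨hilbCore hE hh, fun s t => rfl, HermitianMetric.ext_normSq fun x v => ?_⟩
    have hx := FiberBundle.mem_baseSet_trivializationAt' (F := ℂ) (E := L) x
    have h2 := h1 x
    have h3 := sum_normSq_FS hE (hilbCore hE hh) _ (isOrthonormal_onb _) x
    rw [bergman_apply] at h2
    -- For every metric the sum is a factor independent of the metric times the norm squared of the
    -- frame. As `h` and `FS(Hilb(h))` both give the sum `1`, these norms agree.
    have h4 : ∀ k : HermitianMetric n L, ∑ i, k.normSq ((onb (hilbCore hE hh) i).1 x) =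
        (∑ i, ‖coord x ((onb (hilbCore hE hh) i).1 x)‖ ^ 2) * k.normSq (frame (L := L) x x) :=
      fun k => by
        rw [Finset.sum_mul]
        exact Finset.sum_congr rfl fun i _ => k.normSq_eq hx _
    rw [h4] at h2 h3
    rw [HermitianMetric.normSq_eq _ hx, h.normSq_eq hx]
    congr 1
    exact mul_left_cancel₀ (left_ne_zero_of_mul_eq_one h2) (h3.trans h2.symm)

end Hilb

namespace HermitianMetric

/-! ### The linearized equation -/

/-- At a maximum `-∂∂̄v` is positive semidefinite, and its trace against the adjugate of the
positive definite `g` is nonnegative. -/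
theorem volRatioDeriv_zero_nonneg_of_forall_le {h : HermitianMetric n L} (hh : h.IsPositive)
    (v : SmoothFn n X) {x : X} (hx : ∀ y, v y ≤ v x) : 0 ≤ h.volRatioDeriv 0 v x := by
  have hs := mem_chart_source (Fin n → ℂ) x
  rw [h.volRatioDeriv_eq _ _ hs, expMul_zero]
  refine div_nonneg (trace_adjugate_mul_nonneg (hh x)
    (posSemidef_neg_complexHessian ((contDiffAt_comp_chart_symm hs v.contMDiff).of_le two_le_infty)
      (Eventually.of_forall fun z => ?_))) (hh.det_pos hs).le
  simpa [(chartAt (Fin n → ℂ) x).left_inv hs] using hx _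

theorem volRatioDeriv_neg (h : HermitianMetric n L) (φ v : SmoothFn n X) (x : X) :
    h.volRatioDeriv φ (-v) x = -h.volRatioDeriv φ v x := by
  have h0 := h.volRatioDeriv_eq_zero φ (v := (-v + v)) (x := x) (c := 0)
    (Eventually.of_forall fun y => neg_add_cancel (v y))
  rw [volRatioDeriv_add] at h0
  linarith

/-- The maximum principle for the linearized equation. -/
theorem eq_one_of_add_volRatioDeriv_eq_one [CompactSpace X] [Nonempty X] {h : HermitianMetric n L}
    (hh : h.IsPositive) (v : SmoothFn n X) (e : ∀ x, v x + h.volRatioDeriv 0 v x = 1) (x : X) :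
    v x = 1 := by
  obtain ⟨a, -, ha⟩ := isCompact_univ.exists_isMaxOn univ_nonempty v.contMDiff.continuous.continuousOn
  obtain ⟨b, -, hb⟩ := isCompact_univ.exists_isMinOn univ_nonempty v.contMDiff.continuous.continuousOn
  have h1 := volRatioDeriv_zero_nonneg_of_forall_le hh v fun y => ha (mem_univ y)
  have h2 := volRatioDeriv_zero_nonneg_of_forall_le hh (-v) (x := b)
    fun y => neg_le_neg (hb (mem_univ y))
  rw [volRatioDeriv_neg] at h2
  have h3 : v x ≤ v a := ha (mem_univ x)
  have h4 : v b ≤ v x := hb (mem_univ x)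
  -- The equation gives `v a ≤ 1` at the maximum and `v b ≥ 1` at the minimum, which pinches `v x`.
  linarith [e a, e b]

end HermitianMetric

end

/-! ### First variations of `𝓛` and `𝓛 - (d/V) I`, and the Euler–Lagrange equation. -/

section

variable {n : ℕ} {X : Type*} [TopologicalSpace X] [ChartedSpace (Fin n → ℂ) X]
  [IsManifold 𝓘(ℂ, Fin n → ℂ) ω X]
  {L : X → Type*} [∀ x, AddCommGroup (L x)] [∀ x, Module ℂ (L x)]
  [TopologicalSpace (TotalSpace ℂ L)] [∀ x, TopologicalSpace (L x)] [FiberBundle ℂ L]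
  [VectorBundle ℂ ℂ L] [ContMDiffVectorBundle ω ℂ L 𝓘(ℂ, Fin n → ℂ)]

omit [IsManifold 𝓘(ℂ, Fin n → ℂ) ω X] in
theorem isSmoothFamily_smul (ψ : SmoothFn n X) : IsSmoothFamily fun t : ℝ => t • ψ :=
  contMDiff_fst.mul (ψ.contMDiff.comp contMDiff_snd)

namespace HermitianMetric

variable [MeasurableSpace X] [BorelSpace X] [CompactSpace X]

omit [MeasurableSpace X] [BorelSpace X] in
theorem IsPositive.eventually_smul {h : HermitianMetric n L} (hh : h.IsPositive)
    (ψ : SmoothFn n X) : ∀ᶠ t : ℝ in 𝓝 0, (expMul (t • ψ) h).IsPositive :=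
  h.eventually_isPositive (isSmoothFamily_smul ψ) (by rwa [zero_smul, expMul_zero])

omit [MeasurableSpace X] [BorelSpace X] [CompactSpace X] in
theorem continuous_volRatio_smul {h : HermitianMetric n L} (hh : h.IsPositive) (ψ : SmoothFn n X) :
    Continuous fun q : ℝ × X => h.volRatio (q.1 • ψ) q.2 := by
  have m : Continuous fun q : ℝ × X => (((0, q.1), q.2) : (ℝ × ℝ) × X) := by fun_prop
  have c := (continuous_volRatio_family hh (isSmoothFamily_const ψ)).comp m
  exact c

omit [MeasurableSpace X] [BorelSpace X] [CompactSpace X] in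
theorem continuous_volRatioDeriv_smul {h : HermitianMetric n L} (hh : h.IsPositive)
    (ψ : SmoothFn n X) : Continuous fun q : ℝ × X => h.volRatioDeriv (q.1 • ψ) ψ q.2 := by
  have m : Continuous fun q : ℝ × X => (((0, q.1), q.2) : (ℝ × ℝ) × X) := by fun_prop
  have c := (continuous_volRatioDeriv_family hh (isSmoothFamily_const ψ) (isSmoothFamily_const ψ)).comp m
  exact c

/-- The pairing contributes `ψ` and the measure contributes the linearized volume form. -/
theorem hasDerivAt_integral_pair {h : HermitianMetric n L} (hh : h.IsPositive) (ψ : SmoothFn n X)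
    (s s' : HoloSection n L) :
    HasDerivAt (fun t : ℝ => ∫ x, (expMul (t • ψ) h).pair (s x) (s' x) ∂(expMul (t • ψ) h).vol)
      (∫ x, (ψ x + h.volRatioDeriv 0 ψ x) • h.pair (s x) (s' x) ∂h.vol) 0 := by
  have c1 := continuous_volRatio_smul hh ψ
  have c2 := continuous_volRatioDeriv_smul hh ψ
  have c3 : Continuous fun q : ℝ × X => Real.exp (q.1 * ψ q.2) :=
    Real.continuous_exp.comp (isSmoothFamily_smul ψ).continuous
  have c4 : Continuous fun q : ℝ × X => ψ q.2 := ψ.contMDiff.continuous.comp continuous_snd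
  have c5 := (h.continuous_pair s s').comp (continuous_snd (X := ℝ) (Y := X))
  have key := hasDerivAt_integral_of_continuous h.vol ((c1.mul c3).smul c5)
    (((c2.mul c3).add (c1.mul (c3.mul c4))).smul c5) (fun t x =>
      ((h.hasDerivAt_volRatio_smul ψ t x).mul
        ((hasDerivAt_mul_const (ψ x)).exp)).smul_const (h.pair (s x) (s' x))) 0
  refine (key.congr_deriv (integral_congr_ae (ae_of_all _ fun x => ?_))).congr_of_eventuallyEq ?_
  · simp only [zero_smul, zero_mul, Real.exp_zero, mul_one, one_mul, volRatio_zero hh]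
    rw [add_comm]
  · filter_upwards [hh.eventually_smul ψ] with t ht
    rw [integral_vol_expMul hh ht]
    refine integral_congr_ae (ae_of_all _ fun x => ?_)
    change h.volRatio (t • ψ) x • ((Real.exp (t * ψ x) : ℂ) * h.pair (s x) (s' x)) =
      (h.volRatio (t • ψ) x * Real.exp (t * ψ x)) • h.pair (s x) (s' x)
    rw [mul_smul, Complex.real_smul (x := Real.exp _)]

variable [T2Space X]

/-- Symmetry against the constant function `1`, which the operator annihilates. -/
theorem integral_volRatioDeriv_zero {h : HermitianMetric n L} (hh : h.IsPositive)
    (ψ : SmoothFn n X) : ∫ x, h.volRatioDeriv 0 ψ x ∂h.vol = 0 := by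
  have := integral_mul_volRatioDeriv_symm hh 0 1 ψ
  have h1 : ∀ x, h.volRatioDeriv 0 1 x = 0 := fun x =>
    h.volRatioDeriv_eq_zero 0 (c := 1) (Eventually.of_forall fun y => rfl)
  simp only [h1, mul_zero, integral_zero] at this
  rw [← this]
  exact integral_congr_ae (ae_of_all _ fun x => (one_mul _).symm)

/-- The volume is constant to first order. -/
theorem hasDerivAt_V {h : HermitianMetric n L} (hh : h.IsPositive) (ψ : SmoothFn n X) :
    HasDerivAt (fun t : ℝ => (expMul (t • ψ) h).V) 0 0 := by
  have key := hasDerivAt_integral_of_continuous h.vol (continuous_volRatio_smul hh ψ)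
    (continuous_volRatioDeriv_smul hh ψ) (fun t x => h.hasDerivAt_volRatio_smul ψ t x) 0
  refine (key.congr_deriv ?_).congr_of_eventuallyEq ?_
  · simp only [zero_smul]
    exact integral_volRatioDeriv_zero hh ψ
  · filter_upwards [hh.eventually_smul ψ] with t ht
    have := integral_vol_expMul hh ht fun _ => (1 : ℝ)
    simpa [V] using this

omit [IsManifold 𝓘(ℂ, Fin n → ℂ) ω X] [ContMDiffVectorBundle ω ℂ L 𝓘(ℂ, Fin n → ℂ)]
  [BorelSpace X] [CompactSpace X] [T2Space X] in
theorem IsEnergy.hasDerivAt_smul {I : HermitianMetric n L → ℝ} (hI : IsEnergy I)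
    {h : HermitianMetric n L} (hh : h.IsPositive) (ψ : SmoothFn n X) :
    HasDerivAt (fun t : ℝ => I (expMul (t • ψ) h)) (∫ x, ψ x ∂h.vol) 0 := by
  have e : expMul ((0 : ℝ) • ψ) h = h := by rw [zero_smul, expMul_zero]
  have key := hI h (fun t => t • ψ) (isSmoothFamily_smul ψ) 0 (by rwa [e])
  have hd : ∀ x, deriv (fun s : ℝ => (s • ψ : SmoothFn n X) x) 0 = ψ x := fun x =>
    (hasDerivAt_mul_const (ψ x)).deriv
  simpa only [hd, e] using key

end HermitianMetric

variable [MeasurableSpace X] [BorelSpace X] [CompactSpace X] [T2Space X] [Nonempty X]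
  {E : Submodule ℂ (HoloSection n L)} [FiniteDimensional ℂ E]

/-- In `Hilb` and `calLTilde` the factor `d / V` is computed from the varying metric; to first order
it behaves as a constant. -/
theorem hasDerivAt_div_V {h : HermitianMetric n L} (hh : h.IsPositive) (ψ : SmoothFn n X) (d : ℝ) :
    HasDerivAt (fun t : ℝ => d / (HermitianMetric.expMul (t • ψ) h).V) 0 0 := by
  have := (hasDerivAt_const (0 : ℝ) d).div (HermitianMetric.hasDerivAt_V hh ψ) (by
    rw [zero_smul, HermitianMetric.expMul_zero]
    exact hh.V_pos.ne')
  exact this.congr_deriv (by simp)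

omit [FiniteDimensional ℂ E] in
theorem hasDerivAt_Hilb {h : HermitianMetric n L} (hh : h.IsPositive) (ψ : SmoothFn n X) (s s' : E) :
    HasDerivAt (fun t : ℝ => Hilb E (HermitianMetric.expMul (t • ψ) h) s s')
      ((Module.finrank ℂ E / h.V : ℝ) *
        ∫ x, (ψ x + h.volRatioDeriv 0 ψ x) • h.pair (s.1 x) (s'.1 x) ∂h.vol) 0 := by
  have := (hasDerivAt_div_V hh ψ (Module.finrank ℂ E)).ofReal_comp.mul
    (HermitianMetric.hasDerivAt_integral_pair hh ψ s.1 s'.1)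
  refine this.congr_deriv ?_
  rw [Complex.ofReal_zero, zero_mul, zero_add, zero_smul, HermitianMetric.expMul_zero]

omit [IsManifold 𝓘(ℂ, Fin n → ℂ) ω X] [ContMDiffVectorBundle ω ℂ L 𝓘(ℂ, Fin n → ℂ)]
  [BorelSpace X] [CompactSpace X] [T2Space X] [Nonempty X] in
omit [VectorBundle ℂ ℂ L] in
theorem integral_smul_pair_self (h : HermitianMetric n L) {f : X → ℝ} (s : HoloSection n L) :
    ∫ x, f x • h.pair (s x) (s x) ∂h.vol = ((∫ x, f x * h.normSq (s x) ∂h.vol : ℝ) : ℂ) := by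
  rw [← integral_complex_ofReal]
  refine integral_congr_ae (ae_of_all _ fun x => ?_)
  change f x • h.pair (s x) (s x) = ((f x * h.normSq (s x) : ℝ) : ℂ)
  rw [h.pair_self, Complex.real_smul, Complex.ofReal_mul]

/-- The derivative of `log det Hilb(h)`. -/
theorem hasDerivAt_calL (hE : GivesEmbedding E)
    (b : Module.Basis (Fin (Module.finrank ℂ E)) ℂ E) {h : HermitianMetric n L} (hh : h.IsPositive)
    (ψ : SmoothFn n X) : HasDerivAt (fun t : ℝ => calL b (HermitianMetric.expMul (t • ψ) h))
      (Module.finrank ℂ E / h.V * ∫ x, (ψ x + h.volRatioDeriv 0 ψ x) * bergman hE hh x ∂h.vol) 0 := by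
  -- In a basis orthonormal for `Hilb(h)` the Gram matrix at `t = 0` is the identity, so the
  -- derivative of `log det` is the trace of its derivative.
  obtain ⟨s, hs⟩ := exists_basis_of_isOrthonormal rfl (isOrthonormal_onb (hilbCore hE hh))
  set M : ℝ → Matrix (Fin (Module.finrank ℂ E)) (Fin (Module.finrank ℂ E)) ℂ := fun t =>
    Matrix.of fun i j => Hilb E (HermitianMetric.expMul (t • ψ) h) (s i) (s j) with hM
  have hM0 : M 0 = 1 := by
    ext i j
    have := isOrthonormal_onb (hilbCore hE hh) i j
    rw [← hs] at this
    simp only [hM, Matrix.of_apply, zero_smul, HermitianMetric.expMul_zero]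
    rw [Matrix.one_apply]
    exact this
  set M' : Matrix (Fin (Module.finrank ℂ E)) (Fin (Module.finrank ℂ E)) ℂ :=
    Matrix.of fun i j => ((Module.finrank ℂ E / h.V : ℝ) : ℂ) *
      ∫ x, (ψ x + h.volRatioDeriv 0 ψ x) • h.pair ((s i).1 x) ((s j).1 x) ∂h.vol with hM'
  have hd := hasDerivAt_det (M := M) (M' := M') (t := 0) fun i j => hasDerivAt_Hilb hh ψ (s i) (s j)
  rw [hM0, Matrix.adjugate_one, one_mul] at hd
  have hr : HasDerivAt (fun t => (M t).det.re) M'.trace.re 0 := Complex.reCLM.hasFDerivAt.comp_hasDerivAt 0 hd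
  have h1 : (M 0).det.re = 1 := by rw [hM0, Matrix.det_one, Complex.one_re]
  have hl := (hr.log (by rw [h1]; exact one_ne_zero)).const_add
    (Real.log (‖(s.toMatrix b).det‖ ^ 2))
  rw [h1, div_one] at hl
  have ct : Continuous fun x => ψ x + h.volRatioDeriv 0 ψ x :=
    ψ.contMDiff.continuous.add (HermitianMetric.contMDiff_volRatioDeriv hh 0 ψ).continuous
  have htr : M'.trace.re = Module.finrank ℂ E / h.V *
      ∫ x, (ψ x + h.volRatioDeriv 0 ψ x) * bergman hE hh x ∂h.vol := by
    have i1 : ∀ i, Integrable (fun x => (ψ x + h.volRatioDeriv 0 ψ x) * h.normSq ((s i).1 x)) h.vol :=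
      fun i => h.integrable_of_continuous (ct.mul (h.normSqSection (s i).1).contMDiff.continuous)
    simp only [bergman_apply, ← hs, Finset.mul_sum]
    rw [integral_finsetSum _ fun i _ => i1 i, Matrix.trace, Complex.re_sum, Finset.mul_sum]
    refine Finset.sum_congr rfl fun i _ => ?_
    rw [Matrix.diag_apply, hM', Matrix.of_apply, integral_smul_pair_self, ← Complex.ofReal_mul,
      Complex.ofReal_re]
  refine (hl.congr_deriv htr).congr_of_eventuallyEq ?_
  have hP : IsUnit (s.toMatrix b).det := by
    have := s.isUnit_det b
    rwa [s.det_apply] at this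
  -- The return to the basis `b` adds a constant, for `t` so small that the metric is positive and
  -- the real part of the Gram determinant is nonzero.
  filter_upwards [hh.eventually_smul ψ, hr.continuousAt.eventually_ne (by rw [h1]; exact one_ne_zero)]
    with t ht hne
  have hg := det_gram_basis_change (hilbCore hE ht) s b
  change Real.log (Matrix.of fun i j => Hilb E (HermitianMetric.expMul (t • ψ) h) (b i) (b j)).det.re
    = Real.log (‖(s.toMatrix b).det‖ ^ 2) + Real.log (M t).det.re
  have hp : ‖(s.toMatrix b).det‖ ^ 2 ≠ 0 := pow_ne_zero 2 (norm_ne_zero_iff.2 hP.ne_zero)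
  rw [← Real.log_mul hp hne, ← Complex.re_ofReal_mul]
  exact congrArg (fun z : ℂ => Real.log z.re) hg

/-- Symmetry moves the operator from `ψ` to the Bergman function, which isolates `ψ` as a test
function. -/
theorem hasDerivAt_calLTilde (hE : GivesEmbedding E)
    (b : Module.Basis (Fin (Module.finrank ℂ E)) ℂ E) {I : HermitianMetric n L → ℝ}
    (hI : HermitianMetric.IsEnergy I) {h : HermitianMetric n L} (hh : h.IsPositive)
    (ψ : SmoothFn n X) : HasDerivAt (fun t : ℝ => calLTilde b I (HermitianMetric.expMul (t • ψ) h))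
      (Module.finrank ℂ E / h.V *
        ∫ x, ψ x * (bergman hE hh x + h.volRatioDeriv 0 (bergman hE hh) x - 1) ∂h.vol) 0 := by
  have key := (hasDerivAt_calL hE b hh ψ).sub
    ((hasDerivAt_div_V hh ψ (Module.finrank ℂ E)).mul (hI.hasDerivAt_smul hh ψ))
  refine key.congr_deriv ?_
  rw [zero_mul, zero_add, zero_smul, HermitianMetric.expMul_zero, ← mul_sub]
  congr 1
  have cψ := ψ.contMDiff.continuous
  have cρ := (bergman hE hh).contMDiff.continuous
  have cD := fun v => (HermitianMetric.contMDiff_volRatioDeriv hh 0 v).continuous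
  have i1 := h.integrable_of_continuous (cψ.mul cρ)
  have i2 := h.integrable_of_continuous ((cD ψ).mul cρ)
  have i3 := h.integrable_of_continuous (cψ.mul (cD (bergman hE hh)))
  have i4 := h.integrable_of_continuous cψ
  have e1 : ∫ x, (ψ x + h.volRatioDeriv 0 ψ x) * bergman hE hh x ∂h.vol =
      ∫ x, ψ x * bergman hE hh x ∂h.vol + ∫ x, h.volRatioDeriv 0 ψ x * bergman hE hh x ∂h.vol := by
    rw [← integral_add (by exact i1) (by exact i2)]
    exact integral_congr_ae (ae_of_all _ fun x => add_mul _ _ _)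
  have e2 : ∫ x, h.volRatioDeriv 0 ψ x * bergman hE hh x ∂h.vol =
      ∫ x, ψ x * h.volRatioDeriv 0 (bergman hE hh) x ∂h.vol := by
    rw [HermitianMetric.integral_mul_volRatioDeriv_symm hh]
    exact integral_congr_ae (ae_of_all _ fun x => mul_comm _ _)
  rw [e1, e2, ← integral_add (by exact i1) (by exact i3), ← integral_sub (by exact i1.add i3) i4]
  refine integral_congr_ae (ae_of_all _ fun x => ?_)
  simp only
  ring

theorem isCriticalPoint_iff_bergman_eq_one (hE : GivesEmbedding E)
    (b : Module.Basis (Fin (Module.finrank ℂ E)) ℂ E) {I : HermitianMetric n L → ℝ}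
    (hI : HermitianMetric.IsEnergy I) {h : HermitianMetric n L} (hh : h.IsPositive) :
    HermitianMetric.IsCriticalPoint (calLTilde b I) h ↔ ∀ x, bergman hE hh x = 1 := by
  set ρ := bergman hE hh with hρ
  constructor
  · intro hc
    refine HermitianMetric.eq_one_of_add_volRatioDeriv_eq_one hh _ fun x => ?_
    -- The test function is the Euler–Lagrange expression itself, so the vanishing variation is the
    -- integral of its square.
    set ψ : SmoothFn n X := ρ +
      ⟨h.volRatioDeriv 0 ρ, HermitianMetric.contMDiff_volRatioDeriv hh 0 ρ⟩ - 1 with hψ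
    have h1 := (hasDerivAt_calLTilde hE b hI hh ψ).unique (hc ψ)
    have hd : (0 : ℝ) < Module.finrank ℂ E := Nat.cast_pos.2 hE.finrank_pos
    have h2 := (mul_eq_zero.1 h1).resolve_left (div_pos hd hh.V_pos).ne'
    have h3 := HermitianMetric.eq_zero_of_integral_eq_zero hh
      (ψ.contMDiff.continuous.mul ψ.contMDiff.continuous) (fun x => mul_self_nonneg (ψ x)) h2
    have h4 : ρ x + h.volRatioDeriv 0 ρ x - 1 = 0 := mul_self_eq_zero.1 (congrFun h3 x)
    linarith
  · intro h1 ψ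
    refine (hasDerivAt_calLTilde hE b hI hh ψ).congr_deriv ?_
    have h2 : ∀ x, h.volRatioDeriv 0 ρ x = 0 := fun x =>
      h.volRatioDeriv_eq_zero 0 (Eventually.of_forall h1)
    simp only [← hρ, h1, h2, add_zero, sub_self, mul_zero, integral_zero]

end

end Balanced
end

theorem corollary1 {n : ℕ} {X : Type*} [TopologicalSpace X] [CompactSpace X] [T2Space X] [Nonempty X]
    [ChartedSpace (Fin n → ℂ) X] [IsManifold (modelWithCornersSelf ℂ (Fin n → ℂ)) ω X]
    [MeasurableSpace X] [BorelSpace X]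
    {L : X → Type*} [∀ x, AddCommGroup (L x)] [∀ x, Module ℂ (L x)]
    [TopologicalSpace (Bundle.TotalSpace ℂ L)] [∀ x, TopologicalSpace (L x)]
    [FiberBundle ℂ L] [VectorBundle ℂ ℂ L]
    [ContMDiffVectorBundle ω ℂ L (modelWithCornersSelf ℂ (Fin n → ℂ))]
    (E : Submodule ℂ (Balanced.HoloSection n L)) [FiniteDimensional ℂ E]
    (hE : Balanced.GivesEmbedding E)
    (b : Module.Basis (Fin (Module.finrank ℂ E)) ℂ E) :
    (∀ h₀ : Balanced.HermitianMetric n L, h₀.IsPositive →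
      Balanced.HermitianMetric.IsEnergy (Balanced.HermitianMetric.energy h₀)) ∧
    ∀ I : Balanced.HermitianMetric n L → ℝ, Balanced.HermitianMetric.IsEnergy I →
      ∀ h : Balanced.HermitianMetric n L, h.IsPositive →
        (Balanced.IsBalanced hE h ↔
          Balanced.HermitianMetric.IsCriticalPoint (Balanced.calLTilde b I) h) :=
  ⟨fun _ hh => Balanced.HermitianMetric.isEnergy_energy hh, fun _ hI _ hh =>
    (Balanced.isBalanced_iff_bergman_eq_one hE hh).trans
      (Balanced.isCriticalPoint_iff_bergman_eq_one hE b hI hh).symm⟩
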